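/- \textbf{Theorem (equivalence of the categories of double cosets and of pseudobordisms).} Let $n\ge 1$. \emph{Double cosets.} Let $S(\infty)$ be the group of finitely supported permutations of $\mathbb N=\{1,2,\dots\}$, let $G=S(\infty)^{n+1}$, with the factors indexed by $n+1$ colors, and let $K(\alpha)\subset G$ be the group of diagonal elements $(\sigma,\dots,\sigma)$ with $\sigma\in S(\infty)$ fixing $1,\dots,\alpha$. Let $\theta_\beta[j]\in K(\beta)$ be the diagonal element given by the involution that exchanges $\beta+i$ and $\beta+j+i$ for $1\le i\le j$ and fixes all other points. For $g,h\in G$ the sequence of double cosets $K(\alpha)\,g\,\theta_\beta[j]\,h\,K(\gamma)$, $j=1,2,\dots$, is eventually constant, and its eventual value depends only on the double cosets $\mathfrak g=K(\alpha)gK(\beta)$ and $\mathfrak h=K(\beta)hK(\gamma)$; it is denoted by $\mathfrak g\circ\mathfrak h$. With this product the nonnegative integers and the sets $\mathrm{Mor}(\beta,\alpha)=K(\alpha)\backslash G/K(\beta)$ of morphisms $\beta\to\alpha$ form a category $\mathcal K$. \emph{Pseudobordisms.} A simplicial cell complex is a complex glued from simplices along faces, in which every closed face is an embedded simplex and two faces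 may meet in any union of common faces. It is an $n$-dimensional pseudomanifold if every face lies in an $n$-dimensional face (a chamber) and every $(n-1)$-dimensional face lies in exactly two chambers; it is normal if the link of each face of codimension $\ge 2$ is connected. A coloring of a normal pseudomanifold consists of signs $\pm$ of chambers, opposite for chambers with a common $(n-1)$-dimensional face; of a map from the vertices to the $n+1$ colors that is injective on the vertices of each chamber; and of a map from the $(n-1)$-dimensional faces to the colors that is injective on the faces of each chamber, such that the color of a face is that of the opposite vertex of any chamber containing it. A double-chamber is a connected component that consists of two chambers glued along their whole boundaries. A pseudobordism $\beta\to\alpha$ is a finite (possibly empty or disconnected) colored normal $n$-dimensional pseudomanifold with an injective map of $\{1,\dots,\alpha\}$ to its set of plus-chambers and an injective map of $\{1,\dots,\beta\}$ to its set of minus-chambers (labels), in which each double-chamber has at least one label. Pseudobordisms are considered up to isomorphisms that preserve signs, colors and labels. For pseudobordisms $\Sigma:\beta\to\alpha$ and $\Lambda:\gamma\to\beta$ the product $\Sigma\diamond\Lambda:\gamma\to\alpha$ is obtained as follows: remove the interiors of the labeled minus-chambers of $\Sigma$ and of the labeled plus-chambers of $\Lambda$; for each $s\le\beta$ identify the boundaries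 of the two removed chambers with label $s$, preserving the colors of vertices; normalize the result, that is, cut it into chambers and glue them again, identifying points of two chambers only if they coincide in a common $(n-1)$-dimensional face, and extending this by transitivity; finally remove all label-less double-chambers. This is a well-defined operation on isomorphism classes, and with it the nonnegative integers and the isomorphism classes of pseudobordisms form a category $\mathrm{PsBor}$. \emph{Equivalence.} The categories $\mathcal K$ and $\mathrm{PsBor}$ are equivalent, by the functor that is the identity on objects and acts on morphisms as follows. Let $\mathfrak g\in K(\alpha)\backslash G/K(\beta)$ and let $g=(g^{(c)})_c\in\mathfrak g$ be any representative. Take plus-chambers and minus-chambers, each numbered by $\mathbb N$, with vertices colored by the $n+1$ colors, and for each color $c$ and each $q\in\mathbb N$ glue the minus-chamber $q$ and the plus-chamber $g^{(c)}(q)$ along their faces opposite to the vertices of color $c$, preserving the colors of vertices. Forget the labels $>\alpha$ on plus-chambers and the labels $>\beta$ on minus-chambers, and discard all label-less double-chambers. The result is a pseudobordism $\beta\to\alpha$ whose class depends only on $\mathfrak g$, and it is the image of $\mathfrak g$. -/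

import Mathlib

open CategoryTheory

universe u v

namespace PsBor

/-! ### Simplicial cell complexes, through their posets of faces

A simplicial cell complex is recorded by the set of its (non-empty, closed) faces ordered by
inclusion.  Every face is a simplex, so the faces below a given `k`-dimensional face form
the poset of non-empty subsets of a set with `k + 1` elements; two faces may meet in any union of
common faces.  All the complexes are considered up to isomorphism, and a bijection of complexes that
is affine on every face is the same thing as an isomorphism of the posets of faces. -/

section Complexes

variable {P : Type} [Preorder P]

/-- `x` is a face of dimension `k`: the faces contained in `x` are those of a `k`-simplex. -/
def IsFace (k : ℕ) (x : P) : Prop :=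
  Nonempty (Set.Iic x ≃o {s : Finset (Fin (k + 1)) // s.Nonempty})

variable (P)

/-- `P` is the poset of faces of a simplicial cell complex (finiteness is asked for separately).
Antisymmetry of `≤` follows from this condition. -/
def IsSimplicialCellComplex : Prop :=
  ∀ x : P, ∃ k : ℕ, IsFace k x

/-- Pseudomanifolds of dimension `n ≥ 1`.  The `n`-dimensional faces are the chambers. -/
structure IsPseudomanifold (n : ℕ) : Prop where
  complex : IsSimplicialCellComplex P
  pure : ∀ x : P, ∃ C : P, IsFace n C ∧ x ≤ C
  two_chambers : ∀ F : P, IsFace (n - 1) F → {C : P | IsFace n C ∧ F ≤ C}.ncard = 2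

/-- The link of a face `x` is the complex whose faces correspond to the faces `y > x`.  A complex
is connected if it is non-empty and any two of its faces are joined by a chain of faces in which
any two consecutive ones are comparable. -/
def LinkConnected {P : Type} [Preorder P] (x : P) : Prop :=
  Nonempty {y : P // x < y} ∧
    ∀ y z : {y : P // x < y}, Relation.ReflTransGen (fun a b => a ≤ b ∨ b ≤ a) y z

/-- Normality: the links of all (non-empty) faces of codimension at least two are connected. -/
def IsNormal (n : ℕ) : Prop :=
  ∀ (k : ℕ) (x : P), k + 2 ≤ n → IsFace k x → LinkConnected x

end Complexes

/-- The order on a quotient `P / r` that is generated by the images of the relations `x ≤ y`. -/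
abbrev quotPreorder {P : Type} (le r : P → P → Prop) : Preorder (Quot r) where
  le := Relation.ReflTransGen (Relation.Map le (Quot.mk r) (Quot.mk r))
  le_refl _ := Relation.ReflTransGen.refl
  le_trans _ _ _ := Relation.ReflTransGen.trans

/-! ### Colors, signs and labels -/

/-- A complex of dimension `n` with decorations: signs of chambers (`true` is plus, `false` is
minus), colors of vertices, colors of `(n - 1)`-dimensional faces, labels from `A` on
plus-chambers and labels from `B` on minus-chambers.  The decorations are given by their graphs;
`IsColored` and `IsLabeled` below say that they are maps with the required properties. -/
structure Decorated (n : ℕ) (A B : Type) where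
  Cell : Type
  [order : Preorder Cell]
  HasSign : Cell → Bool → Prop
  HasVertexColor : Cell → Fin (n + 1) → Prop
  HasFacetColor : Cell → Fin (n + 1) → Prop
  HasPlusLabel : Cell → A → Prop
  HasMinusLabel : Cell → B → Prop

attribute [instance] Decorated.order

namespace Decorated

variable {n : ℕ} {A B A' B' D : Type}

/-- The signs and the colors of `X` form a coloring. -/
structure IsColored (X : Decorated n A B) : Prop where
  /-- The sign is a function on the set of chambers. -/
  sign_chamber : ∀ C b, X.HasSign C b → IsFace n C
  sign_unique : ∀ C : X.Cell, IsFace n C → ∃! b, X.HasSign C b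
  /-- Distinct chambers with a common `(n - 1)`-dimensional face have opposite signs. -/
  sign_adjacent : ∀ C C' F : X.Cell, IsFace n C → IsFace n C' → IsFace (n - 1) F →
    F ≤ C → F ≤ C' → C ≠ C' → ∀ b, X.HasSign C b → X.HasSign C' (!b)
  /-- The color is a function on the set of vertices. -/
  vertex_vertex : ∀ x c, X.HasVertexColor x c → IsFace 0 x
  vertex_unique : ∀ x : X.Cell, IsFace 0 x → ∃! c, X.HasVertexColor x c
  /-- The vertices of a chamber have pairwise different colors. -/
  vertex_injective : ∀ C x y : X.Cell, IsFace n C → x ≤ C → y ≤ C →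
    ∀ c, X.HasVertexColor x c → X.HasVertexColor y c → x = y
  /-- The color is a function on the set of `(n - 1)`-dimensional faces. -/
  facet_facet : ∀ F c, X.HasFacetColor F c → IsFace (n - 1) F
  facet_unique : ∀ F : X.Cell, IsFace (n - 1) F → ∃! c, X.HasFacetColor F c
  /-- The `(n - 1)`-dimensional faces of a chamber have pairwise different colors. -/
  facet_injective : ∀ C F F' : X.Cell, IsFace n C → F ≤ C → F' ≤ C →
    ∀ c, X.HasFacetColor F c → X.HasFacetColor F' c → F = F'
  /-- The color of a face is that of the opposite vertex in any chamber containing the face. -/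
  facet_opposite : ∀ C F x : X.Cell, IsFace n C → IsFace (n - 1) F → IsFace 0 x →
    F ≤ C → x ≤ C → ¬ x ≤ F → ∀ c, X.HasFacetColor F c ↔ X.HasVertexColor x c

/-- The labels are given by an injective map of `A` to the set of plus-chambers and an
injective map of `B` to the set of minus-chambers. -/
structure IsLabeled (X : Decorated n A B) : Prop where
  plus_chamber : ∀ C a, X.HasPlusLabel C a → X.HasSign C true
  plus_unique : ∀ a, ∃! C, X.HasPlusLabel C a
  plus_injective : ∀ C a a', X.HasPlusLabel C a → X.HasPlusLabel C a' → a = a'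
  minus_chamber : ∀ C b, X.HasMinusLabel C b → X.HasSign C false
  minus_unique : ∀ b, ∃! C, X.HasMinusLabel C b
  minus_injective : ∀ C b b', X.HasMinusLabel C b → X.HasMinusLabel C b' → b = b'

/-- The chambers `C` and `C'` with their faces form a double-chamber: they are two simplices glued
together along their whole boundaries, and they form a connected component of `X`. -/
def IsDoubleChamber (X : Decorated n A B) (C C' : X.Cell) : Prop :=
  IsFace n C ∧ IsFace n C' ∧ C ≠ C' ∧ (∀ x, x < C ↔ x < C') ∧
    ∀ x y, x ≤ C ∨ x ≤ C' → x ≤ y → y ≤ C ∨ y ≤ C'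

/-- The cell `C` carries no label. -/
def Unlabeled (X : Decorated n A B) (C : X.Cell) : Prop :=
  (∀ a, ¬ X.HasPlusLabel C a) ∧ ∀ b, ¬ X.HasMinusLabel C b

/-- A label-less double-chamber. -/
def IsBareDoubleChamber (X : Decorated n A B) (C C' : X.Cell) : Prop :=
  X.IsDoubleChamber C C' ∧ X.Unlabeled C ∧ X.Unlabeled C'

/-- Pseudobordisms: finite colored normal pseudomanifolds, possibly empty or disconnected, with
labels such that each double-chamber has at least one label. -/
structure IsPseudobordism (X : Decorated n A B) : Prop where
  finite : Finite X.Cell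
  pseudomanifold : IsPseudomanifold X.Cell n
  normal : IsNormal X.Cell n
  colored : X.IsColored
  labeled : X.IsLabeled
  no_bare : ∀ C C', ¬ X.IsBareDoubleChamber C C'

/-- Isomorphisms: isomorphisms of complexes preserving signs, colors and labels. -/
structure Iso (X Y : Decorated n A B) where
  toEquiv : X.Cell ≃o Y.Cell
  sign : ∀ x b, X.HasSign x b ↔ Y.HasSign (toEquiv x) b
  vertexColor : ∀ x c, X.HasVertexColor x c ↔ Y.HasVertexColor (toEquiv x) c
  facetColor : ∀ x c, X.HasFacetColor x c ↔ Y.HasFacetColor (toEquiv x) c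
  plusLabel : ∀ x a, X.HasPlusLabel x a ↔ Y.HasPlusLabel (toEquiv x) a
  minusLabel : ∀ x b, X.HasMinusLabel x b ↔ Y.HasMinusLabel (toEquiv x) b

/-- The identity isomorphism. -/
def Iso.refl (X : Decorated n A B) : Iso X X :=
  ⟨OrderIso.refl _, fun _ _ => Iff.rfl, fun _ _ => Iff.rfl, fun _ _ => Iff.rfl,
    fun _ _ => Iff.rfl, fun _ _ => Iff.rfl⟩

/-- The inverse isomorphism. -/
def Iso.symm {X Y : Decorated n A B} (e : Iso X Y) : Iso Y X where
  toEquiv := e.toEquiv.symm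
  sign y b := by rw [e.sign, OrderIso.apply_symm_apply]
  vertexColor y c := by rw [e.vertexColor, OrderIso.apply_symm_apply]
  facetColor y c := by rw [e.facetColor, OrderIso.apply_symm_apply]
  plusLabel y a := by rw [e.plusLabel, OrderIso.apply_symm_apply]
  minusLabel y b := by rw [e.minusLabel, OrderIso.apply_symm_apply]

/-- The composition of isomorphisms. -/
def Iso.trans {X Y Z : Decorated n A B} (e : Iso X Y) (f : Iso Y Z) : Iso X Z where
  toEquiv := e.toEquiv.trans f.toEquiv
  sign x b := (e.sign x b).trans (f.sign _ b)
  vertexColor x c := (e.vertexColor x c).trans (f.vertexColor _ c)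
  facetColor x c := (e.facetColor x c).trans (f.facetColor _ c)
  plusLabel x a := (e.plusLabel x a).trans (f.plusLabel _ a)
  minusLabel x b := (e.minusLabel x b).trans (f.minusLabel _ b)

/-! ### Operations on decorated complexes -/

/-- The faces `x` of `X` and `y` of `Y` have the same set of colors of vertices. -/
def SameColors (X : Decorated n A B) (Y : Decorated n A' B') (x : X.Cell) (y : Y.Cell) : Prop :=
  ∀ c, (∃ v, v ≤ x ∧ X.HasVertexColor v c) ↔ ∃ w, w ≤ y ∧ Y.HasVertexColor w c

/-- What remains of `X` and `Y` when (the interiors of) the labeled minus-chambers of `X` and the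
labeled plus-chambers of `Y` are removed. -/
abbrev Cut (X : Decorated n A B) (Y : Decorated n B D) : Type :=
  {x : X.Cell // ∀ s, ¬ X.HasMinusLabel x s} ⊕ {y : Y.Cell // ∀ s, ¬ Y.HasPlusLabel y s}

/-- For each label `s`, the boundary of the minus-chamber of `X` with label `s` is identified
with the boundary of the plus-chamber of `Y` with label `s`: a face is identified
with the face that has the same colors of vertices. -/
def glueRel (X : Decorated n A B) (Y : Decorated n B D) : Cut X Y → Cut X Y → Prop
  | Sum.inl x, Sum.inr y => ∃ (s : B) (C : X.Cell) (C' : Y.Cell),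
      X.HasMinusLabel C s ∧ Y.HasPlusLabel C' s ∧ x.1 < C ∧ y.1 < C' ∧ SameColors X Y x.1 y.1
  | _, _ => False

/-- Gluing of `X` and `Y` along the chambers labeled by `B`.  The plus-labels of `X` and
the minus-labels of `Y` are kept. -/
def glue (X : Decorated n A B) (Y : Decorated n B D) : Decorated n A D where
  Cell := Quot (glueRel X Y)
  order := quotPreorder (fun x y : Cut X Y => x ≤ y) (glueRel X Y)
  HasSign z b := ∃ x : Cut X Y, Quot.mk _ x = z ∧
    Sum.elim (fun x => X.HasSign x.1 b) (fun y => Y.HasSign y.1 b) x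
  HasVertexColor z c := ∃ x : Cut X Y, Quot.mk _ x = z ∧
    Sum.elim (fun x => X.HasVertexColor x.1 c) (fun y => Y.HasVertexColor y.1 c) x
  HasFacetColor z c := ∃ x : Cut X Y, Quot.mk _ x = z ∧
    Sum.elim (fun x => X.HasFacetColor x.1 c) (fun y => Y.HasFacetColor y.1 c) x
  HasPlusLabel z a := ∃ x : {x : X.Cell // ∀ s, ¬ X.HasMinusLabel x s},
    Quot.mk _ (Sum.inl x) = z ∧ X.HasPlusLabel x.1 a
  HasMinusLabel z d := ∃ y : {y : Y.Cell // ∀ s, ¬ Y.HasPlusLabel y s},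
    Quot.mk _ (Sum.inr y) = z ∧ Y.HasMinusLabel y.1 d

/-- The faces of the disjoint union of the chambers of `X`: the face `face` of the
chamber `chamber`. -/
structure ChamberFace (X : Decorated n A B) where
  chamber : X.Cell
  face : X.Cell
  isFace : IsFace n chamber
  le : face ≤ chamber

/-- Two faces of two chambers are identified when they coincide in `X` and are contained in a common
`(n - 1)`-dimensional face of the two chambers. -/
def normalizeRel (X : Decorated n A B) (p q : X.ChamberFace) : Prop :=
  p.face = q.face ∧ ∃ F, IsFace (n - 1) F ∧ p.face ≤ F ∧ F ≤ p.chamber ∧ F ≤ q.chamber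

/-- The map of the normalization of `X` to `X`. -/
def normalizeMap (X : Decorated n A B) : Quot X.normalizeRel → X.Cell :=
  Quot.lift (fun p => p.face) fun _ _ h => h.1

/-- The normalization of `X`: cut `X` into chambers and glue them together again along
`(n - 1)`-dimensional faces only. -/
def normalize (X : Decorated n A B) : Decorated n A B where
  Cell := Quot X.normalizeRel
  order := quotPreorder (fun p q => p.chamber = q.chamber ∧ p.face ≤ q.face) X.normalizeRel
  HasSign z := X.HasSign (X.normalizeMap z)
  HasVertexColor z := X.HasVertexColor (X.normalizeMap z)
  HasFacetColor z := X.HasFacetColor (X.normalizeMap z)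
  HasPlusLabel z := X.HasPlusLabel (X.normalizeMap z)
  HasMinusLabel z := X.HasMinusLabel (X.normalizeMap z)

/-- Removal of all label-less double-chambers. -/
def trim (X : Decorated n A B) : Decorated n A B where
  Cell := {x : X.Cell // ∀ C C', X.IsBareDoubleChamber C C' → ¬ (x ≤ C ∨ x ≤ C')}
  HasSign x := X.HasSign x.1
  HasVertexColor x := X.HasVertexColor x.1
  HasFacetColor x := X.HasFacetColor x.1
  HasPlusLabel x := X.HasPlusLabel x.1
  HasMinusLabel x := X.HasMinusLabel x.1

/-- The product `X ⋄ Y`: glue, normalize, and remove label-less double-chambers. -/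
def diamond (X : Decorated n A B) (Y : Decorated n B D) : Decorated n A D :=
  (X.glue Y).normalize.trim

/-- Forgetting all plus-labels except the first `α` ones and all minus-labels except
the first `β` ones. -/
def forget (X : Decorated n ℕ ℕ) (α β : ℕ) : Decorated n (Fin α) (Fin β) where
  Cell := X.Cell
  HasSign := X.HasSign
  HasVertexColor := X.HasVertexColor
  HasFacetColor := X.HasFacetColor
  HasPlusLabel x a := X.HasPlusLabel x a
  HasMinusLabel x b := X.HasMinusLabel x b

end Decorated

/-! ### Pseudobordisms up to isomorphism

Labels are numbered from `0`: the labels `1, …, α` are represented by the elements of `Fin α`. -/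

/-- Pseudobordisms `β → α`. -/
def Pseudobordism (n β α : ℕ) : Type 1 :=
  {X : Decorated n (Fin α) (Fin β) // X.IsPseudobordism}

/-- Isomorphism of pseudobordisms. -/
instance isoSetoid (n β α : ℕ) : Setoid (Pseudobordism n β α) where
  r X Y := Nonempty (Decorated.Iso X.1 Y.1)
  iseqv := ⟨fun X => ⟨Decorated.Iso.refl X.1⟩, fun ⟨e⟩ => ⟨e.symm⟩, fun ⟨e⟩ ⟨f⟩ => ⟨e.trans f⟩⟩

/-- `Mor(β, α)` in the category of pseudobordisms: isomorphism classes of pseudobordisms. -/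
def BordismMor (n β α : ℕ) : Type 1 := Quotient (isoSetoid n β α)

/-- The class of a pseudobordism. -/
def BordismMor.mk {n β α : ℕ} (X : Pseudobordism n β α) : BordismMor n β α :=
  Quotient.mk (isoSetoid n β α) X

/-! ### Infinite symmetric groups and double cosets

The set permuted is `ℕ = {0, 1, 2, …}`, in agreement with the numbering of labels. -/

/-- `S(∞)`: the permutations of `ℕ` that move finitely many points. -/
def SInf : Subgroup (Equiv.Perm ℕ) where
  carrier := {σ | {x | σ x ≠ x}.Finite}
  one_mem' := by simp
  mul_mem' := by
    intro σ τ hσ hτ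
    refine (Set.Finite.union hσ hτ).subset fun x hx => ?_
    by_contra h
    simp only [Set.mem_union, Set.mem_ofPred_eq, not_or, not_not] at h
    exact hx (by rw [Equiv.Perm.mul_apply, h.2, h.1])
  inv_mem' := by
    intro σ hσ
    refine Set.Finite.subset hσ fun x hx h => hx ?_
    exact Equiv.Perm.inv_eq_iff_eq.mpr (Eq.symm h)

/-- `G = S(∞)^{n+1}`; the copies of `S(∞)` are indexed by the colors. -/
abbrev G (n : ℕ) : Type := Fin (n + 1) → SInf

/-- `K(α)`: the diagonal elements `(σ, …, σ)` of `G` such that `σ` fixes the first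
`α` points. -/
def K (n α : ℕ) : Subgroup (G n) where
  carrier := {k | ∃ σ : SInf, (∀ i < α, σ.1 i = i) ∧ k = fun _ => σ}
  one_mem' := ⟨1, by simp, rfl⟩
  mul_mem' := by
    rintro _ _ ⟨σ, hσ, rfl⟩ ⟨τ, hτ, rfl⟩
    refine ⟨σ * τ, fun i hi => ?_, rfl⟩
    change σ.1 (τ.1 i) = i
    rw [hτ i hi, hσ i hi]
  inv_mem' := by
    rintro _ ⟨σ, hσ, rfl⟩
    exact ⟨σ⁻¹, fun i hi => Equiv.Perm.inv_eq_iff_eq.mpr (hσ i hi).symm, rfl⟩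

/-- The map exchanging the blocks `β, …, β + j - 1` and `β + j, …, β + 2 j - 1`. -/
def thetaFun (β j x : ℕ) : ℕ :=
  if β ≤ x ∧ x < β + j then x + j else if β + j ≤ x ∧ x < β + 2 * j then x - j else x

theorem thetaFun_thetaFun (β j x : ℕ) : thetaFun β j (thetaFun β j x) = x := by
  unfold thetaFun
  split_ifs <;> omega

/-- The element `θ_β[j]` of `S(∞)`. -/
def theta (β j : ℕ) : SInf :=
  ⟨⟨thetaFun β j, thetaFun β j, thetaFun_thetaFun β j, thetaFun_thetaFun β j⟩, by
    refine (Set.finite_lt_nat (β + 2 * j)).subset fun x hx => ?_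
    by_contra h
    refine hx ?_
    simp only [Set.mem_ofPred_eq, not_lt] at h
    change thetaFun β j x = x
    unfold thetaFun
    split_ifs <;> omega⟩

/-- `Mor(β, α) = K(α) \ G / K(β)` in the category of double cosets. -/
def CosetMor (n β α : ℕ) : Type :=
  DoubleCoset.Quotient (K n α : Set (G n)) (K n β : Set (G n))

/-- The double coset `K(α) g K(β)`. -/
def CosetMor.mk (n β α : ℕ) (g : G n) : CosetMor n β α :=
  DoubleCoset.mk (K n α) (K n β) g

/-! ### The labeled infinite pseudomanifold of an element of `G` -/

/-- Faces of the disjoint union of chambers `(p, true)` (the plus-chamber with label `p`)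
and `(q, false)` (the minus-chamber with label `q`), `p, q ∈ ℕ`: the vertices of a chamber are
identified with the colors, hence the faces with the non-empty sets of colors. -/
structure LabeledFace (n : ℕ) where
  label : ℕ
  sign : Bool
  colors : Finset (Fin (n + 1))
  nonempty : colors.Nonempty

/-- The plus-chamber `p` and the minus-chamber `q` are glued along their faces of color `c`, i.e.
opposite to the vertices of color `c`, if `p = g_c(q)`. -/
def attachRel {n : ℕ} (g : G n) (x y : LabeledFace n) : Prop :=
  x.sign = true ∧ y.sign = false ∧ x.colors = y.colors ∧
    ∃ c, c ∉ x.colors ∧ x.label = (g c).1 y.label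

/-- The labeled colored infinite pseudomanifold attached to `g`. -/
def attached {n : ℕ} (g : G n) : Decorated n ℕ ℕ where
  Cell := Quot (attachRel g)
  order := quotPreorder
    (fun x y => x.label = y.label ∧ x.sign = y.sign ∧ x.colors ⊆ y.colors) (attachRel g)
  HasSign z b := ∃ x : LabeledFace n, Quot.mk _ x = z ∧ x.colors = Finset.univ ∧ x.sign = b
  HasVertexColor z c := ∃ x : LabeledFace n, Quot.mk _ x = z ∧ x.colors = {c}
  HasFacetColor z c := ∃ x : LabeledFace n, Quot.mk _ x = z ∧ x.colors = {c}ᶜ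
  HasPlusLabel z p := ∃ x : LabeledFace n, Quot.mk _ x = z ∧ x.colors = Finset.univ ∧
    x.sign = true ∧ x.label = p
  HasMinusLabel z q := ∃ x : LabeledFace n, Quot.mk _ x = z ∧ x.colors = Finset.univ ∧
    x.sign = false ∧ x.label = q

/-! ### Categories with objects `0, 1, 2, …` -/

/-- A category with the set of objects `ℕ` and given sets `Mor β α` of morphisms `β → α`. -/
structure NatCategory (Mor : ℕ → ℕ → Type u) where
  id : ∀ α, Mor α α
  comp : ∀ {γ β α}, Mor β α → Mor γ β → Mor γ α
  id_comp : ∀ {β α} (f : Mor β α), comp (id α) f = f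
  comp_id : ∀ {β α} (f : Mor β α), comp f (id β) = f
  assoc : ∀ {δ γ β α} (f : Mor β α) (g : Mor γ β) (h : Mor δ γ),
    comp (comp f g) h = comp f (comp g h)

/-- The objects of a category with the set of objects `ℕ`. -/
def NatCategory.Obj {Mor : ℕ → ℕ → Type u} (_ : NatCategory Mor) : Type := ℕ

instance {Mor : ℕ → ℕ → Type u} (𝒞 : NatCategory Mor) : Category.{u} 𝒞.Obj where
  Hom β α := Mor β α
  id α := 𝒞.id α
  comp g f := 𝒞.comp f g
  id_comp f := 𝒞.comp_id f
  comp_id f := 𝒞.id_comp f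
  assoc h g f := (𝒞.assoc f g h).symm

/-- A functor which is the identity on objects. -/
structure NatFunctor {M : ℕ → ℕ → Type u} {N : ℕ → ℕ → Type v}
    (𝒞 : NatCategory M) (𝒟 : NatCategory N) where
  map : ∀ {β α}, M β α → N β α
  map_id : ∀ α, map (𝒞.id α) = 𝒟.id α
  map_comp : ∀ {γ β α} (f : M β α) (g : M γ β), map (𝒞.comp f g) = 𝒟.comp (map f) (map g)

/-- The underlying functor. -/
def NatFunctor.toFunctor {M : ℕ → ℕ → Type u} {N : ℕ → ℕ → Type v}
    {𝒞 : NatCategory M} {𝒟 : NatCategory N} (F : NatFunctor 𝒞 𝒟) : 𝒞.Obj ⥤ 𝒟.Obj where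
  obj α := (α : ℕ)
  map f := F.map f
  map_id α := F.map_id α
  map_comp g f := F.map_comp f g

/-- `𝒞` is the category of double cosets: the product of the double cosets of `g` and `h` is the
eventual value of the sequence `K(α) g θ_β[j] h K(γ)`, for all representatives `g` and `h`. -/
def IsCosetCategory (n : ℕ) (𝒞 : NatCategory (CosetMor n)) : Prop :=
  ∀ (γ β α : ℕ) (g h : G n), ∀ᶠ j in Filter.atTop,
    CosetMor.mk n γ α (g * (fun _ => theta β j) * h) =
      𝒞.comp (CosetMor.mk n β α g) (CosetMor.mk n γ β h)

/-- `𝒟` is the category of pseudobordisms: the product of the classes of `X` and `Y` is the class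
of `X ⋄ Y`, for all representatives `X` and `Y`. -/
def IsBordismCategory (n : ℕ) (𝒟 : NatCategory (BordismMor n)) : Prop :=
  ∀ (γ β α : ℕ) (X : Pseudobordism n β α) (Y : Pseudobordism n γ β),
    ∃ Z : Pseudobordism n γ α, Nonempty (Decorated.Iso Z.1 (X.1.diamond Y.1)) ∧
      𝒟.comp (BordismMor.mk X) (BordismMor.mk Y) = BordismMor.mk Z

end PsBor

namespace PsBor

/-! The proof replaces complexes by their dual graphs. A `Gem` is a set of chambers with signs,
labels and one sign-reversing involution `adj c` for each color `c`, which crosses the wall of color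
`c`. Since the vertices of a chamber have distinct colors, its faces are the non-empty sets of
colors. A `Presentation X D` says that `X` is glued from the chambers of `D`, with walls prescribed
by `adj` and possible extra coincidences in codimension at least two. It is `Faithful` if two
chambers share the face with color set `S` only when they are joined by crossing walls of colors
outside `S`.

Every colored labeled pseudomanifold has a presentation (`exists_presentation`). Faithfulness is
exactly normality (`isNormal`, `faithful_of_isNormal`): the link of a face is connected when the
chambers around it are joined through walls containing it. A faithfully presented complex is
determined by its gem (`Presentation.iso`), and the gem by the complex
(`Presentation.exists_embedding`). The geometric operations become combinatorial: gluing replaces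
the gems by `Gem.comp`, normalization keeps the gem and restores faithfulness, and removal of
label-less double-chambers becomes `Gem.trim`.

The complex of `g` has the gem `Gem.ofPerm g`, in which `g c` matches minus-chambers with
plus-chambers. Finite support makes almost all chambers bare. Conversely, numbering the chambers of
a finite gem and extending the matchings by the identity produces some `g` (`exists_numbering`).
Different numberings differ by a permutation of plus-chambers and one of minus-chambers, each
preserving labels, which is a change of representative of the double coset. This gives the bijection
`CosetMor.toBordismMor_bijective`.

For products, the only role of `theta` is to fix the labels below `β` and to move the remaining
relevant points of `h` away from those of `g`. Any permutation that does this gives the same double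
coset (`CosetMor.mk_eq_of_separates`). Such freedom gives the stability of the product and its
associativity. In `g * θ * h` the shared labels join the walls of the two removed chambers, while
other chambers of the two factors occupy disjoint sets of numbers and everything else is bare
(`Gem.exists_embedding_comp`). Hence the product of double cosets corresponds to `diamond`, and the
category of pseudobordisms may be defined by transporting the category laws along the bijection. -/

/-! ### Faces of a simplex and orders on quotients -/

/-- The non-empty sets of colors, i.e. the faces of a chamber with colored vertices. -/
abbrev ColorSet (n : ℕ) : Type := {s : Finset (Fin (n + 1)) // s.Nonempty}

theorem card_colorSet (k : ℕ) : Nat.card (ColorSet k) = 2 ^ (k + 1) - 1 := by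
  rw [Nat.card_eq_fintype_card, Fintype.card_subtype]
  have : (Finset.univ.filter fun s : Finset (Fin (k + 1)) => s.Nonempty) =
      Finset.univ.erase ∅ := by
    ext s; simp [Finset.nonempty_iff_ne_empty]
  rw [this, Finset.card_erase_of_mem (Finset.mem_univ _)]
  simp

/-- A `k`-simplex has `2 ^ (k + 1) - 1` faces, so the number of faces below `x` determines `k`. -/
theorem IsFace.dim_unique {P : Type} [Preorder P] {k l : ℕ} {x : P} (hk : IsFace k x)
    (hl : IsFace l x) : k = l := by
  obtain ⟨e⟩ := hk
  obtain ⟨f⟩ := hl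
  have h := Nat.card_congr (e.symm.trans f).toEquiv
  change Nat.card (ColorSet k) = Nat.card (ColorSet l) at h
  rw [card_colorSet, card_colorSet] at h
  have h1 := Nat.one_le_two_pow (n := k + 1)
  have h2 := Nat.one_le_two_pow (n := l + 1)
  have := Nat.pow_right_injective (le_refl 2) (show 2 ^ (k + 1) = 2 ^ (l + 1) by omega)
  omega

/-- The dimensions of the faces of a simplex with the set of vertices `Fin (n + 1)`. -/
theorem isFace_iff_card {n k : ℕ} {α : Type} [Preorder α] {f : ColorSet n → α}
    (hle : ∀ S T, f S ≤ f T ↔ S ≤ T) (hlower : ∀ T z, z ≤ f T → ∃ S, f S = z) (T : ColorSet n) :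
    IsFace k (f T) ↔ T.1.card = k + 1 := by
  have key : ∀ k, T.1.card = k + 1 → IsFace k (f T) := by
    intro k hT
    let e : Fin (k + 1) ↪ Fin (n + 1) :=
      (Finset.equivFinOfCardEq hT).symm.toEmbedding.trans (Function.Embedding.subtype _)
    have hsub : ∀ s : Finset (Fin (k + 1)), s.map e ⊆ T.1 := by
      intro s c hc
      obtain ⟨i, _, rfl⟩ := Finset.mem_map.1 hc
      exact ((Finset.equivFinOfCardEq hT).symm i).2
    let F : ColorSet k → Set.Iic (f T) := fun s =>
      ⟨f ⟨s.1.map e, s.2.map⟩, (hle _ T).2 (hsub s.1)⟩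
    have hF : ∀ s t, F s ≤ F t ↔ s ≤ t := fun s t => (hle _ _).trans Finset.map_subset_map
    refine ⟨(RelIso.ofSurjective (OrderEmbedding.ofMapLEIff F hF) ?_).symm⟩
    rintro ⟨z, hz⟩
    obtain ⟨S, rfl⟩ := hlower _ _ hz
    have hST : S ≤ T := (hle S T).1 hz
    have hm : (S.1.preimage e e.injective.injOn).map e = S.1 := by
      ext c
      simp only [Finset.mem_map, Finset.mem_preimage]
      constructor
      · rintro ⟨i, hi, rfl⟩
        exact hi
      · intro hc
        have : e (Finset.equivFinOfCardEq hT ⟨c, hST hc⟩) = c := by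
          simp [e]
        exact ⟨_, this.symm ▸ hc, this⟩
    refine ⟨⟨S.1.preimage e e.injective.injOn, ?_⟩, ?_⟩
    · rw [← Finset.map_nonempty (f := e), hm]
      exact S.2
    · exact Subtype.ext (congrArg f (Subtype.ext hm))
  -- For the converse, `key` supplies one dimension of the face, and dimensions are unique.
  refine ⟨fun h => ?_, key k⟩
  have h1 := T.2.card_pos
  have := h.dim_unique (key (T.1.card - 1) (by omega))
  omega

/-- The order on a quotient when smaller elements can be moved along the relation. -/
theorem quotPreorder_le_mk {P : Type} {le r : P → P → Prop} (hrefl : ∀ a, le a a)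
    (htrans : ∀ a b c, le a b → le b c → le a c)
    (hr : ∀ a b, r a b → (∀ a', le a' a → ∃ b', le b' b ∧ Quot.mk r a' = Quot.mk r b') ∧
      ∀ b', le b' b → ∃ a', le a' a ∧ Quot.mk r a' = Quot.mk r b') (z : Quot r) (y : P) :
    (quotPreorder le r).le z (Quot.mk r y) ↔ ∃ x, le x y ∧ Quot.mk r x = z := by
  -- The lifting property passes from `r` to the equivalence relation that it generates.
  have key : ∀ a b, Relation.EqvGen r a b →
      (∀ a', le a' a → ∃ b', le b' b ∧ Quot.mk r a' = Quot.mk r b') ∧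
      ∀ b', le b' b → ∃ a', le a' a ∧ Quot.mk r a' = Quot.mk r b' := by
    intro a b h
    induction h with
    | rel a b h => exact hr a b h
    | refl a => exact ⟨fun a' h => ⟨a', h, rfl⟩, fun a' h => ⟨a', h, rfl⟩⟩
    | symm a b _ ih =>
      refine ⟨fun a' h => ?_, fun a' h => ?_⟩
      · obtain ⟨b', h1, h2⟩ := ih.2 a' h
        exact ⟨b', h1, h2.symm⟩
      · obtain ⟨b', h1, h2⟩ := ih.1 a' h
        exact ⟨b', h1, h2.symm⟩
    | trans a b c _ _ ih1 ih2 =>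
      refine ⟨fun a' h => ?_, fun a' h => ?_⟩
      · obtain ⟨b', h1, h2⟩ := ih1.1 a' h
        obtain ⟨c', h3, h4⟩ := ih2.1 b' h1
        exact ⟨c', h3, h2.trans h4⟩
      · obtain ⟨b', h1, h2⟩ := ih2.2 a' h
        obtain ⟨c', h3, h4⟩ := ih1.2 b' h1
        exact ⟨c', h3, h4.trans h2⟩
  constructor
  · intro h
    change Relation.ReflTransGen (Relation.Map le (Quot.mk r) (Quot.mk r)) z (Quot.mk r y) at h
    -- Going down the chain, each new element is moved along the relation to lie below the
    -- representative already found; then `htrans` compares it with `y`.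
    induction h using Relation.ReflTransGen.head_induction_on with
    | refl => exact ⟨y, hrefl y, rfl⟩
    | head h _ ih =>
      obtain ⟨x, hx, rfl⟩ := ih
      obtain ⟨p, q, hpq, rfl, hq⟩ := h
      obtain ⟨x', h1, h2⟩ := (key q x (Quot.eqvGen_exact hq)).1 p hpq
      exact ⟨x', htrans _ _ _ h1 hx, h2.symm⟩
  · rintro ⟨x, hx, rfl⟩
    exact Relation.ReflTransGen.single ⟨x, y, hx, rfl, rfl⟩

/-! ### Gems: the dual graphs of colored complexes -/

/-- Chambers with signs, labels, and the involutions `adj c` that exchange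
the two chambers with a common face of color `c`. -/
structure Gem (n : ℕ) (A B : Type) where
  Chamber : Type
  sign : Chamber → Bool
  adj : Fin (n + 1) → Chamber → Chamber
  adj_adj : ∀ c x, adj c (adj c x) = x
  sign_adj : ∀ c x, sign (adj c x) = !sign x
  plus : A → Chamber
  plus_injective : Function.Injective plus
  sign_plus : ∀ a, sign (plus a) = true
  minus : B → Chamber
  minus_injective : Function.Injective minus
  sign_minus : ∀ b, sign (minus b) = false

namespace Gem

variable {n : ℕ} {A B : Type}

/-- `x` and `y` are joined by steps over faces whose colors are not in `S`. -/
def Conn (D : Gem n A B) (S : Finset (Fin (n + 1))) : D.Chamber → D.Chamber → Prop :=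
  Relation.ReflTransGen fun x y => ∃ c ∉ S, D.adj c x = y

theorem adj_ne (D : Gem n A B) (c : Fin (n + 1)) (x : D.Chamber) : D.adj c x ≠ x := by
  intro h
  have := D.sign_adj c x
  rw [h] at this
  cases hx : D.sign x <;> simp [hx] at this

theorem Conn.refl {D : Gem n A B} {S : Finset (Fin (n + 1))} (x : D.Chamber) : D.Conn S x x :=
  Relation.ReflTransGen.refl

theorem Conn.trans {D : Gem n A B} {S : Finset (Fin (n + 1))} {x y z : D.Chamber}
    (h : D.Conn S x y) (h' : D.Conn S y z) : D.Conn S x z :=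
  Relation.ReflTransGen.trans h h'

theorem conn_adj {D : Gem n A B} {S : Finset (Fin (n + 1))} {c : Fin (n + 1)} (hc : c ∉ S)
    (x : D.Chamber) : D.Conn S x (D.adj c x) :=
  Relation.ReflTransGen.single ⟨c, hc, rfl⟩

theorem Conn.symm {D : Gem n A B} {S : Finset (Fin (n + 1))} {x y : D.Chamber}
    (h : D.Conn S x y) : D.Conn S y x := by
  induction h with
  | refl => exact Conn.refl _
  | tail _ h ih =>
    obtain ⟨c, hc, rfl⟩ := h
    exact (Relation.ReflTransGen.single ⟨c, hc, D.adj_adj c _⟩ : D.Conn S _ _).trans ih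

theorem Conn.mono {D : Gem n A B} {S T : Finset (Fin (n + 1))} (hST : S ⊆ T) {x y : D.Chamber}
    (h : D.Conn T x y) : D.Conn S x y := by
  induction h with
  | refl => exact Conn.refl _
  | tail _ h ih =>
    obtain ⟨c, hc, h⟩ := h
    exact ih.trans (Relation.ReflTransGen.single ⟨c, fun hS => hc (hST hS), h⟩)

theorem Conn.induction {D : Gem n A B} {S : Finset (Fin (n + 1))} {p : D.Chamber → Prop}
    (hp : ∀ x, ∀ c ∉ S, p x → p (D.adj c x)) {x y : D.Chamber} (h : D.Conn S x y) (hx : p x) :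
    p y := by
  induction h with
  | refl => exact hx
  | tail _ h ih =>
    obtain ⟨c, hc, rfl⟩ := h
    exact hp _ c hc ih

theorem Conn.eq_of_univ {D : Gem n A B} {x y : D.Chamber} (h : D.Conn Finset.univ x y) : x = y :=
  Conn.induction (p := fun z => x = z) (fun _ _ hc _ => absurd (Finset.mem_univ _) hc) h rfl

theorem Conn.of_facet {D : Gem n A B} {c : Fin (n + 1)} {x y : D.Chamber}
    (h : D.Conn {c}ᶜ x y) : y = x ∨ y = D.adj c x := by
  refine Conn.induction (p := fun z => z = x ∨ z = D.adj c x) ?_ h (Or.inl rfl)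
  intro z d hd hz
  obtain rfl : d = c := by simpa using hd
  rcases hz with rfl | rfl
  · exact Or.inr rfl
  · exact Or.inl (D.adj_adj _ _)

/-- Embeddings as a union of connected components. -/
structure Embedding (D E : Gem n A B) where
  toFun : D.Chamber → E.Chamber
  injective : Function.Injective toFun
  sign : ∀ x, E.sign (toFun x) = D.sign x
  adj : ∀ c x, E.adj c (toFun x) = toFun (D.adj c x)
  plus : ∀ a, toFun (D.plus a) = E.plus a
  minus : ∀ b, toFun (D.minus b) = E.minus b

/-- The image is closed under every `adj c`, so a path that starts in it never leaves it and can be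
pulled back. -/
theorem Embedding.conn_iff {D E : Gem n A B} (φ : Embedding D E) (S : Finset (Fin (n + 1)))
    (x y : D.Chamber) : E.Conn S (φ.toFun x) (φ.toFun y) ↔ D.Conn S x y := by
  constructor
  · intro h
    have : ∃ y', φ.toFun y' = φ.toFun y ∧ D.Conn S x y' := by
      refine Conn.induction (p := fun z => ∃ y', φ.toFun y' = z ∧ D.Conn S x y') ?_ h
        ⟨x, rfl, Conn.refl x⟩
      rintro _ c hc ⟨y', rfl, h⟩
      exact ⟨D.adj c y', (φ.adj c y').symm, h.trans (conn_adj hc _)⟩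
    obtain ⟨y', h1, h2⟩ := this
    exact φ.injective h1 ▸ h2
  · intro h
    refine Conn.induction (p := fun z => E.Conn S (φ.toFun x) (φ.toFun z)) ?_ h (Conn.refl _)
    intro z c hc hz
    rw [← φ.adj]
    exact hz.trans (conn_adj hc _)

/-- The chamber belongs to a label-less double-chamber. -/
def Bare (D : Gem n A B) (x : D.Chamber) : Prop :=
  ∃ y, (∀ c, D.adj c x = y) ∧ (∀ a, x ≠ D.plus a ∧ y ≠ D.plus a) ∧
    ∀ b, x ≠ D.minus b ∧ y ≠ D.minus b

theorem Bare.adj {D : Gem n A B} {x : D.Chamber} (h : D.Bare x) (c : Fin (n + 1)) :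
    D.Bare (D.adj c x) := by
  obtain ⟨y, h1, h2, h3⟩ := h
  refine ⟨x, fun d => ?_, fun a => (h1 c).symm ▸ (h2 a).symm, fun b => (h1 c).symm ▸ (h3 b).symm⟩
  rw [h1 c, ← h1 d, D.adj_adj]

theorem bare_adj_iff {D : Gem n A B} {x : D.Chamber} (c : Fin (n + 1)) :
    D.Bare (D.adj c x) ↔ D.Bare x :=
  ⟨fun h => by simpa only [D.adj_adj] using h.adj c, fun h => h.adj c⟩

theorem not_bare_plus (D : Gem n A B) (a : A) : ¬ D.Bare (D.plus a) :=
  fun ⟨_, _, h, _⟩ => (h a).1 rfl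

theorem not_bare_minus (D : Gem n A B) (b : B) : ¬ D.Bare (D.minus b) :=
  fun ⟨_, _, _, h⟩ => (h b).1 rfl

/-- Removal of the bare chambers. -/
def trim (D : Gem n A B) : Gem n A B where
  Chamber := {x : D.Chamber // ¬ D.Bare x}
  sign x := D.sign x.1
  adj c x := ⟨D.adj c x.1, fun h => x.2 ((bare_adj_iff c).1 h)⟩
  adj_adj c x := Subtype.ext (D.adj_adj c x.1)
  sign_adj c x := D.sign_adj c x.1
  plus a := ⟨D.plus a, D.not_bare_plus a⟩
  plus_injective _ _ h := D.plus_injective (congrArg Subtype.val h)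
  sign_plus a := D.sign_plus a
  minus b := ⟨D.minus b, D.not_bare_minus b⟩
  minus_injective _ _ h := D.minus_injective (congrArg Subtype.val h)
  sign_minus b := D.sign_minus b

/-- The inclusion of the trimmed gem. -/
def trimEmbedding (D : Gem n A B) : Embedding D.trim D where
  toFun := Subtype.val
  injective := Subtype.val_injective
  sign _ := rfl
  adj _ _ := rfl
  plus _ := rfl
  minus _ := rfl

theorem Embedding.bare_iff {D E : Gem n A B} (φ : Embedding D E) (x : D.Chamber) :
    E.Bare (φ.toFun x) ↔ D.Bare x := by
  constructor
  · rintro ⟨y, h1, h2, h3⟩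
    obtain rfl : φ.toFun (D.adj 0 x) = y := by rw [← φ.adj, h1]
    refine ⟨D.adj 0 x, fun c => φ.injective (by rw [← φ.adj, h1]), fun a => ?_, fun b => ?_⟩
    · exact ⟨fun h => (h2 a).1 (by rw [h, φ.plus]), fun h => (h2 a).2 (by rw [h, φ.plus])⟩
    · exact ⟨fun h => (h3 b).1 (by rw [h, φ.minus]), fun h => (h3 b).2 (by rw [h, φ.minus])⟩
  · rintro ⟨y, h1, h2, h3⟩
    refine ⟨φ.toFun y, fun c => by rw [φ.adj, h1], fun a => ?_, fun b => ?_⟩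
    · rw [← φ.plus]
      exact ⟨fun h => (h2 a).1 (φ.injective h), fun h => (h2 a).2 (φ.injective h)⟩
    · rw [← φ.minus]
      exact ⟨fun h => (h3 b).1 (φ.injective h), fun h => (h3 b).2 (φ.injective h)⟩

/-- The restriction of an embedding to the chambers that are not bare. -/
def Embedding.trim {D E : Gem n A B} (φ : Embedding D E) : Embedding D.trim E.trim where
  toFun x := ⟨φ.toFun x.1, fun h => x.2 ((φ.bare_iff x.1).1 h)⟩
  injective _ _ h := Subtype.ext (φ.injective (congrArg Subtype.val h))
  sign x := φ.sign x.1
  adj c x := Subtype.ext (φ.adj c x.1)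
  plus a := Subtype.ext (φ.plus a)
  minus b := Subtype.ext (φ.minus b)

/-- An embedding preserves and reflects bareness, so the preimage of a chamber that survives also
survives. -/
theorem Embedding.trim_surjective {D E : Gem n A B} (φ : Embedding D E)
    (h : ∀ y, y ∈ Set.range φ.toFun ∨ E.Bare y) : Function.Surjective φ.trim.toFun := by
  rintro ⟨y, hy⟩
  obtain ⟨x, rfl⟩ := (h y).resolve_right hy
  exact ⟨⟨x, fun hx => hy ((φ.bare_iff x).2 hx)⟩, rfl⟩

end Gem

/-! ### Complexes presented by gems -/

/-- `X` is glued from the chambers of `D`, and `toFun x S` is the face of the chamber `x` with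
the set of colors `S`.  Coincidences of faces of codimension at least two are not restricted. -/
structure Presentation {n : ℕ} {A B : Type} (X : Decorated n A B) (D : Gem n A B) where
  toFun : D.Chamber → ColorSet n → X.Cell
  surj : ∀ z, ∃ x S, toFun x S = z
  le_iff : ∀ x S T, toFun x S ≤ toFun x T ↔ S ≤ T
  lower : ∀ x T z, z ≤ toFun x T → ∃ S, toFun x S = z
  adj : ∀ x S c, c ∉ S.1 → toFun (D.adj c x) S = toFun x S
  chamber_inj : ∀ x y S, S.1 = Finset.univ → toFun x S = toFun y S → x = y
  facet_inj : ∀ x y S c, S.1 = {c}ᶜ → toFun x S = toFun y S → y = x ∨ y = D.adj c x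
  sign : ∀ x S b, X.HasSign (toFun x S) b ↔ S.1 = Finset.univ ∧ D.sign x = b
  vertexColor : ∀ x S c, X.HasVertexColor (toFun x S) c ↔ S.1 = {c}
  facetColor : ∀ x S c, X.HasFacetColor (toFun x S) c ↔ S.1 = {c}ᶜ
  plusLabel : ∀ x S a, X.HasPlusLabel (toFun x S) a ↔ S.1 = Finset.univ ∧ x = D.plus a
  minusLabel : ∀ x S b, X.HasMinusLabel (toFun x S) b ↔ S.1 = Finset.univ ∧ x = D.minus b

namespace Presentation

variable {n : ℕ} {A B : Type} {X Y : Decorated n A B} {D E : Gem n A B}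

/-- Faces coincide only if they coincide in a sequence of common `(n - 1)`-dimensional faces. -/
def Faithful (P : Presentation X D) : Prop :=
  ∀ x y S, P.toFun x S = P.toFun y S → D.Conn S.1 x y

/-- The set of all colors. -/
def full (n : ℕ) : ColorSet n := ⟨Finset.univ, Finset.univ_nonempty⟩

/-- A single color. -/
def single {n : ℕ} (c : Fin (n + 1)) : ColorSet n := ⟨{c}, Finset.singleton_nonempty c⟩

/-- All colors but one. -/
def cofull {n : ℕ} [NeZero n] (c : Fin (n + 1)) : ColorSet n := ⟨{c}ᶜ, by
  rw [← Finset.card_pos, Finset.card_compl, Finset.card_singleton, Fintype.card_fin]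
  exact NeZero.pos n⟩

theorem le_full (S : ColorSet n) : S ≤ full n := Finset.subset_univ S.1

theorem eq_of_conn (P : Presentation X D) {x y : D.Chamber} {S : ColorSet n}
    (h : D.Conn S.1 x y) : P.toFun x S = P.toFun y S :=
  Gem.Conn.induction (p := fun z => P.toFun x S = P.toFun z S)
    (fun z c hc hz => hz.trans (P.adj z S c hc).symm) h rfl

/-- The colors of a face can be read off from the vertices below it, whichever chamber is used to
name the face. -/
theorem subset_of_eq (P : Presentation X D) {x y : D.Chamber} {S T : ColorSet n}
    (h : P.toFun x S = P.toFun y T) : S ≤ T := by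
  intro c hc
  have h1 : P.toFun x (single c) ≤ P.toFun y T := by
    rw [← h, P.le_iff]
    exact Finset.singleton_subset_iff.2 hc
  obtain ⟨U, hU⟩ := P.lower _ _ _ h1
  have h2 : U.1 = {c} := by
    rw [← P.vertexColor y U c, hU, P.vertexColor]
    rfl
  have h3 : U ≤ T := by
    rw [← P.le_iff y, hU]
    exact h1
  exact h3 (h2 ▸ Finset.mem_singleton_self c)

theorem colors_eq (P : Presentation X D) {x y : D.Chamber} {S T : ColorSet n}
    (h : P.toFun x S = P.toFun y T) : S = T :=
  le_antisymm (P.subset_of_eq h) (P.subset_of_eq h.symm)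

/-- Everything below a face of `y` is a face of `y`, and color sets are intrinsic. Thus coincidences
of faces with equal color sets determine the whole order. -/
theorem le_iff_exists (P : Presentation X D) (x y : D.Chamber) (S T : ColorSet n) :
    P.toFun x S ≤ P.toFun y T ↔ S ≤ T ∧ P.toFun x S = P.toFun y S := by
  constructor
  · intro h
    obtain ⟨U, hU⟩ := P.lower _ _ _ h
    obtain rfl := P.colors_eq hU
    rw [← hU, P.le_iff] at h
    exact ⟨h, hU.symm⟩
  · rintro ⟨h1, h2⟩
    rw [h2, P.le_iff]
    exact h1

theorem lt_iff_exists (P : Presentation X D) (x y : D.Chamber) (S T : ColorSet n) :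
    P.toFun x S < P.toFun y T ↔ S < T ∧ P.toFun x S = P.toFun y S := by
  rw [lt_iff_le_not_ge, lt_iff_le_not_ge, P.le_iff_exists, P.le_iff_exists]
  constructor
  · rintro ⟨⟨h1, h2⟩, h3⟩
    exact ⟨⟨h1, fun h => h3 ⟨h, by rw [le_antisymm h h1, h2]⟩⟩, h2⟩
  · rintro ⟨⟨h1, h2⟩, h3⟩
    exact ⟨⟨h1, h3⟩, fun h => h2 h.1⟩

theorem isFace_iff (P : Presentation X D) {k : ℕ} (x : D.Chamber) (T : ColorSet n) :
    IsFace k (P.toFun x T) ↔ T.1.card = k + 1 :=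
  isFace_iff_card (P.le_iff x) (P.lower x) T

theorem isChamber_iff (P : Presentation X D) (x : D.Chamber) (T : ColorSet n) :
    IsFace n (P.toFun x T) ↔ T = full n := by
  rw [P.isFace_iff, Subtype.ext_iff]
  have h := Finset.card_eq_iff_eq_univ T.1
  rwa [Fintype.card_fin] at h

theorem isChamber_full (P : Presentation X D) (x : D.Chamber) : IsFace n (P.toFun x (full n)) :=
  (P.isChamber_iff x _).2 rfl

theorem exists_of_isChamber (P : Presentation X D) {z : X.Cell} (h : IsFace n z) :
    ∃ x, P.toFun x (full n) = z := by
  obtain ⟨x, S, rfl⟩ := P.surj z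
  rw [P.isChamber_iff] at h
  exact ⟨x, by rw [h]⟩

theorem isFacet_iff [NeZero n] (P : Presentation X D) (x : D.Chamber) (T : ColorSet n) :
    IsFace (n - 1) (P.toFun x T) ↔ ∃ c, T = cofull c := by
  have hn := NeZero.pos n
  rw [P.isFace_iff]
  constructor
  · intro h
    have h1 : (T.1ᶜ).card = 1 := by
      rw [Finset.card_compl, Fintype.card_fin]
      omega
    obtain ⟨c, hc⟩ := Finset.card_eq_one.1 h1
    exact ⟨c, Subtype.ext (compl_eq_comm.1 hc).symm⟩
  · rintro ⟨c, rfl⟩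
    rw [cofull, Finset.card_compl, Fintype.card_fin, Finset.card_singleton]
    omega

theorem isVertex_iff (P : Presentation X D) (x : D.Chamber) (T : ColorSet n) :
    IsFace 0 (P.toFun x T) ↔ ∃ c, T = single c := by
  rw [P.isFace_iff, zero_add, Finset.card_eq_one]
  exact exists_congr fun c => (Subtype.ext_iff (a1 := T) (a2 := single c)).symm

theorem full_injective (P : Presentation X D) {x y : D.Chamber}
    (h : P.toFun x (full n) = P.toFun y (full n)) : x = y :=
  P.chamber_inj x y _ rfl h

theorem cofull_eq_iff [NeZero n] (P : Presentation X D) {x y : D.Chamber} {c : Fin (n + 1)} :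
    P.toFun x (cofull c) = P.toFun y (cofull c) ↔ y = x ∨ y = D.adj c x := by
  constructor
  · exact P.facet_inj x y _ c rfl
  · rintro (rfl | rfl)
    · rfl
    · exact (P.adj x _ c (by simp [cofull])).symm

theorem cofull_le_full [NeZero n] (P : Presentation X D) {x y : D.Chamber} {c : Fin (n + 1)} :
    P.toFun x (cofull c) ≤ P.toFun y (full n) ↔ y = x ∨ y = D.adj c x := by
  rw [P.le_iff_exists, P.cofull_eq_iff]
  exact and_iff_right (le_full _)

/-- The decorated complexes that are glued in the same way are isomorphic. -/
noncomputable def iso (P : Presentation X D) (hP : P.Faithful) (Q : Presentation Y E)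
    (hQ : Q.Faithful) (φ : Gem.Embedding D E) (hφ : Function.Surjective φ.toFun) :
    Decorated.Iso X Y := by
  -- By faithfulness both coincidences amount to connectedness in the gems, which `φ` preserves and
  -- reflects.
  have hwd : ∀ x y S, P.toFun x S = P.toFun y S ↔
      Q.toFun (φ.toFun x) S = Q.toFun (φ.toFun y) S := by
    intro x y S
    constructor
    · intro h
      exact Q.eq_of_conn ((φ.conn_iff _ _ _).2 (hP _ _ _ h))
    · intro h
      exact P.eq_of_conn ((φ.conn_iff _ _ _).1 (hQ _ _ _ h))
  choose f S hf using P.surj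
  have hF : ∀ x T, Q.toFun (φ.toFun (f (P.toFun x T))) (S (P.toFun x T)) =
      Q.toFun (φ.toFun x) T := by
    intro x T
    have h := hf (P.toFun x T)
    have h1 := P.colors_eq h
    rw [h1] at h ⊢
    exact (hwd _ _ _).1 h
  have hle : ∀ z w, Q.toFun (φ.toFun (f z)) (S z) ≤ Q.toFun (φ.toFun (f w)) (S w) ↔ z ≤ w := by
    intro z w
    conv_rhs => rw [← hf z, ← hf w]
    rw [Q.le_iff_exists, P.le_iff_exists, hwd]
  have hinj : Function.Injective fun z => Q.toFun (φ.toFun (f z)) (S z) := by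
    intro z w h
    have h1 : S z = S w := Q.colors_eq h
    rw [← hf z, ← hf w]
    change Q.toFun (φ.toFun (f z)) (S z) = Q.toFun (φ.toFun (f w)) (S w) at h
    rw [h1] at h ⊢
    exact (hwd _ _ _).2 h
  have hsurj : Function.Surjective fun z => Q.toFun (φ.toFun (f z)) (S z) := by
    intro w
    obtain ⟨y, T, rfl⟩ := Q.surj w
    obtain ⟨x, rfl⟩ := hφ y
    exact ⟨P.toFun x T, hF x T⟩
  have hval : ∀ x T, (Equiv.ofBijective _ ⟨hinj, hsurj⟩) (P.toFun x T) =
    Q.toFun (φ.toFun x) T := hF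
  refine ⟨⟨Equiv.ofBijective _ ⟨hinj, hsurj⟩, fun {z w} => hle z w⟩, ?_, ?_, ?_, ?_, ?_⟩
  · intro z b
    obtain ⟨x, T, rfl⟩ := P.surj z
    change _ ↔ Y.HasSign (Equiv.ofBijective _ ⟨hinj, hsurj⟩ (P.toFun x T)) b
    rw [hval, P.sign, Q.sign, φ.sign]
  · intro z c
    obtain ⟨x, T, rfl⟩ := P.surj z
    change _ ↔ Y.HasVertexColor (Equiv.ofBijective _ ⟨hinj, hsurj⟩ (P.toFun x T)) c
    rw [hval, P.vertexColor, Q.vertexColor]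
  · intro z c
    obtain ⟨x, T, rfl⟩ := P.surj z
    change _ ↔ Y.HasFacetColor (Equiv.ofBijective _ ⟨hinj, hsurj⟩ (P.toFun x T)) c
    rw [hval, P.facetColor, Q.facetColor]
  · intro z a
    obtain ⟨x, T, rfl⟩ := P.surj z
    change _ ↔ Y.HasPlusLabel (Equiv.ofBijective _ ⟨hinj, hsurj⟩ (P.toFun x T)) a
    rw [hval, P.plusLabel, Q.plusLabel, ← φ.plus, φ.injective.eq_iff]
  · intro z b
    obtain ⟨x, T, rfl⟩ := P.surj z
    change _ ↔ Y.HasMinusLabel (Equiv.ofBijective _ ⟨hinj, hsurj⟩ (P.toFun x T)) b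
    rw [hval, P.minusLabel, Q.minusLabel, ← φ.minus, φ.injective.eq_iff]

/-- Presentations are carried by isomorphisms. -/
def ofIso (P : Presentation X D) (e : Decorated.Iso X Y) : Presentation Y D where
  toFun x S := e.toEquiv (P.toFun x S)
  surj z := by
    obtain ⟨x, S, h⟩ := P.surj (e.toEquiv.symm z)
    exact ⟨x, S, by rw [h, OrderIso.apply_symm_apply]⟩
  le_iff x S T := e.toEquiv.le_iff_le.trans (P.le_iff x S T)
  lower x T z h := by
    have h1 : e.toEquiv.symm z ≤ P.toFun x T := (e.toEquiv.symm_apply_le).2 h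
    obtain ⟨S, hS⟩ := P.lower _ _ _ h1
    exact ⟨S, by rw [hS, OrderIso.apply_symm_apply]⟩
  adj x S c h := congrArg e.toEquiv (P.adj x S c h)
  chamber_inj x y S hS h := P.chamber_inj x y S hS (e.toEquiv.injective h)
  facet_inj x y S c hS h := P.facet_inj x y S c hS (e.toEquiv.injective h)
  sign x S b := (e.sign _ _).symm.trans (P.sign x S b)
  vertexColor x S b := (e.vertexColor _ _).symm.trans (P.vertexColor x S b)
  facetColor x S b := (e.facetColor _ _).symm.trans (P.facetColor x S b)
  plusLabel x S b := (e.plusLabel _ _).symm.trans (P.plusLabel x S b)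
  minusLabel x S b := (e.minusLabel _ _).symm.trans (P.minusLabel x S b)

/-- Two gems of the same complex are isomorphic. -/
theorem exists_embedding [NeZero n] (P : Presentation X D) (Q : Presentation X E) :
    ∃ φ : Gem.Embedding D E, Function.Surjective φ.toFun := by
  have h1 : ∀ x, ∃ y, Q.toFun y (full n) = P.toFun x (full n) := fun x =>
    Q.exists_of_isChamber (P.isChamber_full x)
  choose f hf using h1
  have hinj : Function.Injective f := by
    intro x y h
    apply P.full_injective
    rw [← hf, ← hf, h]
  -- `x` and `f x` name the same chamber of `X`. Its faces under the two presentations match because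
  -- both color sets are those of the vertices below.
  have hlow : ∀ x S, Q.toFun (f x) S = P.toFun x S := by
    intro x
    have hsub : ∀ S T, Q.toFun (f x) T = P.toFun x S → T ≤ S := by
      intro S T h c hc
      have h2 : Q.toFun (f x) (single c) ≤ P.toFun x S := by
        rw [← h, Q.le_iff]
        exact Finset.singleton_subset_iff.2 hc
      obtain ⟨U, hU⟩ := P.lower _ _ _ h2
      have h3 : U.1 = {c} := by
        rw [← P.vertexColor x U c, hU, Q.vertexColor]
        rfl
      rw [← hU, P.le_iff] at h2
      exact h2 (h3 ▸ Finset.mem_singleton_self c)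
    have hsub' : ∀ S T, Q.toFun (f x) T = P.toFun x S → S ≤ T := by
      intro S T h c hc
      have h2 : P.toFun x (single c) ≤ Q.toFun (f x) T := by
        rw [h, P.le_iff]
        exact Finset.singleton_subset_iff.2 hc
      obtain ⟨U, hU⟩ := Q.lower _ _ _ h2
      have h3 : U.1 = {c} := by
        rw [← Q.vertexColor (f x) U c, hU, P.vertexColor]
        rfl
      rw [← hU, Q.le_iff] at h2
      exact h2 (h3 ▸ Finset.mem_singleton_self c)
    intro S
    have h2 : P.toFun x S ≤ Q.toFun (f x) (full n) := by
      rw [hf, P.le_iff]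
      exact le_full S
    obtain ⟨T, hT⟩ := Q.lower _ _ _ h2
    rw [← le_antisymm (hsub _ _ hT) (hsub' _ _ hT), hT]
    rw [le_antisymm (hsub _ _ hT) (hsub' _ _ hT)]
  refine ⟨⟨f, hinj, fun x => ?_, fun c x => ?_, fun a => ?_, fun b => ?_⟩, fun y => ?_⟩
  · have h := (P.sign x (full n) (D.sign x)).2 ⟨rfl, rfl⟩
    rw [← hf, Q.sign] at h
    exact h.2
  -- The wall is shared by `f x` and `f (D.adj c x)`. These are distinct, so the second is the
  -- neighbor of the first.
  · have h : Q.toFun (f x) (cofull c) = Q.toFun (f (D.adj c x)) (cofull c) := by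
      rw [hlow, hlow]
      exact P.cofull_eq_iff.2 (Or.inr rfl)
    rcases Q.cofull_eq_iff.1 h with h | h
    · exact absurd (hinj h) (D.adj_ne c x)
    · exact h.symm
  · have h := (P.plusLabel (D.plus a) (full n) a).2 ⟨rfl, rfl⟩
    rw [← hf, Q.plusLabel] at h
    exact h.2
  · have h := (P.minusLabel (D.minus b) (full n) b).2 ⟨rfl, rfl⟩
    rw [← hf, Q.minusLabel] at h
    exact h.2
  · obtain ⟨x, hx⟩ := P.exists_of_isChamber (Q.isChamber_full y)
    exact ⟨x, Q.full_injective (by rw [hf, hx])⟩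

end Presentation

/-! ### The gem of a gluing and the gem of a group element -/

namespace Gem

variable {n : ℕ} {A B C : Type}

theorem minus_ne_plus (D : Gem n A B) (b : B) (a : A) : D.minus b ≠ D.plus a := by
  intro h
  have := D.sign_minus b
  rw [h, D.sign_plus] at this
  cases this

theorem adj_plus_ne_plus (D : Gem n A B) (c : Fin (n + 1)) (a a' : A) :
    D.adj c (D.plus a) ≠ D.plus a' := by
  intro h
  have := D.sign_adj c (D.plus a)
  rw [h, D.sign_plus, D.sign_plus] at this
  cases this

theorem adj_minus_ne_minus (D : Gem n A B) (c : Fin (n + 1)) (b b' : B) :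
    D.adj c (D.minus b) ≠ D.minus b' := by
  intro h
  have := D.sign_adj c (D.minus b)
  rw [h, D.sign_minus, D.sign_minus] at this
  cases this

/-- The chambers that remain in the gluing. -/
abbrev CompChamber (D : Gem n A B) (E : Gem n B C) : Type :=
  {x : D.Chamber // ∀ s, x ≠ D.minus s} ⊕ {y : E.Chamber // ∀ s, y ≠ E.plus s}

open Classical in
/-- The neighbors of the chambers that remain in the gluing. -/
noncomputable def compAdj (D : Gem n A B) (E : Gem n B C) (c : Fin (n + 1)) :
    CompChamber D E → CompChamber D E
  | Sum.inl x => if h : ∃ s, D.adj c x.1 = D.minus s then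
      Sum.inr ⟨E.adj c (E.plus h.choose), E.adj_plus_ne_plus c _⟩
    else Sum.inl ⟨D.adj c x.1, fun s hs => h ⟨s, hs⟩⟩
  | Sum.inr y => if h : ∃ s, E.adj c y.1 = E.plus s then
      Sum.inl ⟨D.adj c (D.minus h.choose), D.adj_minus_ne_minus c _⟩
    else Sum.inr ⟨E.adj c y.1, fun s hs => h ⟨s, hs⟩⟩

section

variable (D : Gem n A B) (E : Gem n B C) {c : Fin (n + 1)}

theorem compAdj_inl_of_eq {x : {x : D.Chamber // ∀ s, x ≠ D.minus s}} {s : B}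
    (h : D.adj c x.1 = D.minus s) :
    compAdj D E c (Sum.inl x) = Sum.inr ⟨E.adj c (E.plus s), E.adj_plus_ne_plus c _⟩ := by
  have h1 : ∃ s, D.adj c x.1 = D.minus s := ⟨s, h⟩
  have h2 : h1.choose = s := D.minus_injective (h1.choose_spec.symm.trans h)
  rw [compAdj, dif_pos h1]
  simp only [h2]

theorem compAdj_inl_of_ne {x : {x : D.Chamber // ∀ s, x ≠ D.minus s}}
    (h : ∀ s, D.adj c x.1 ≠ D.minus s) :
    compAdj D E c (Sum.inl x) = Sum.inl ⟨D.adj c x.1, h⟩ := by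
  rw [compAdj, dif_neg (not_exists.2 h)]

theorem compAdj_inr_of_eq {y : {y : E.Chamber // ∀ s, y ≠ E.plus s}} {s : B}
    (h : E.adj c y.1 = E.plus s) :
    compAdj D E c (Sum.inr y) = Sum.inl ⟨D.adj c (D.minus s), D.adj_minus_ne_minus c _⟩ := by
  have h1 : ∃ s, E.adj c y.1 = E.plus s := ⟨s, h⟩
  have h2 : h1.choose = s := E.plus_injective (h1.choose_spec.symm.trans h)
  rw [compAdj, dif_pos h1]
  simp only [h2]

theorem compAdj_inr_of_ne {y : {y : E.Chamber // ∀ s, y ≠ E.plus s}}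
    (h : ∀ s, E.adj c y.1 ≠ E.plus s) :
    compAdj D E c (Sum.inr y) = Sum.inr ⟨E.adj c y.1, h⟩ := by
  rw [compAdj, dif_neg (not_exists.2 h)]

end

/-- The gem of the gluing of two complexes. -/
noncomputable def comp (D : Gem n A B) (E : Gem n B C) : Gem n A C where
  Chamber := CompChamber D E
  sign := Sum.elim (fun x => D.sign x.1) fun y => E.sign y.1
  adj := compAdj D E
  adj_adj c x := by
    rcases x with x | y
    -- A wall leading to a removed chamber continues on the other side at the chamber with the same
    -- label. Coming back meets the same label, so two crossings cancel.
    · by_cases h : ∃ s, D.adj c x.1 = D.minus s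
      · obtain ⟨s, hs⟩ := h
        rw [compAdj_inl_of_eq D E hs, compAdj_inr_of_eq D E (s := s) (E.adj_adj c _)]
        congr 1
        exact Subtype.ext ((congrArg (D.adj c) hs.symm).trans (D.adj_adj c x.1))
      · rw [compAdj_inl_of_ne D E (not_exists.1 h), compAdj_inl_of_ne]
        · congr 1
          exact Subtype.ext (D.adj_adj c x.1)
        · intro s
          rw [D.adj_adj]
          exact x.2 s
    · by_cases h : ∃ s, E.adj c y.1 = E.plus s
      · obtain ⟨s, hs⟩ := h
        rw [compAdj_inr_of_eq D E hs, compAdj_inl_of_eq D E (s := s) (D.adj_adj c _)]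
        congr 1
        exact Subtype.ext ((congrArg (E.adj c) hs.symm).trans (E.adj_adj c y.1))
      · rw [compAdj_inr_of_ne D E (not_exists.1 h), compAdj_inr_of_ne]
        · congr 1
          exact Subtype.ext (E.adj_adj c y.1)
        · intro s
          rw [E.adj_adj]
          exact y.2 s
  sign_adj c x := by
    rcases x with x | y
    · by_cases h : ∃ s, D.adj c x.1 = D.minus s
      · obtain ⟨s, hs⟩ := h
        rw [compAdj_inl_of_eq D E hs]
        have := D.sign_adj c x.1
        rw [hs, D.sign_minus] at this
        change E.sign (E.adj c (E.plus s)) = !D.sign x.1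
        rw [E.sign_adj, E.sign_plus, ← this]
        rfl
      · rw [compAdj_inl_of_ne D E (not_exists.1 h)]
        exact D.sign_adj c x.1
    · by_cases h : ∃ s, E.adj c y.1 = E.plus s
      · obtain ⟨s, hs⟩ := h
        rw [compAdj_inr_of_eq D E hs]
        have := E.sign_adj c y.1
        rw [hs, E.sign_plus] at this
        change D.sign (D.adj c (D.minus s)) = !E.sign y.1
        rw [D.sign_adj, D.sign_minus, ← this]
        rfl
      · rw [compAdj_inr_of_ne D E (not_exists.1 h)]
        exact E.sign_adj c y.1
  plus a := Sum.inl ⟨D.plus a, fun s h => D.minus_ne_plus s a h.symm⟩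
  plus_injective a a' h := D.plus_injective (congrArg Subtype.val (Sum.inl_injective h))
  sign_plus a := D.sign_plus a
  minus b := Sum.inr ⟨E.minus b, fun s => E.minus_ne_plus b s⟩
  minus_injective b b' h := E.minus_injective (congrArg Subtype.val (Sum.inr_injective h))
  sign_minus b := E.sign_minus b

/-- The gem of an element of the group. -/
def ofPerm (g : G n) (α β : ℕ) : Gem n (Fin α) (Fin β) where
  Chamber := ℕ × Bool
  sign x := x.2
  adj c x := bif x.2 then ((g c).1⁻¹ x.1, false) else ((g c).1 x.1, true)
  adj_adj c x := by
    rcases x with ⟨x, _ | _⟩ <;> simp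
  sign_adj c x := by
    rcases x with ⟨x, _ | _⟩ <;> simp
  plus a := (a, true)
  plus_injective a a' h := Fin.ext (congrArg Prod.fst h)
  sign_plus _ := rfl
  minus b := (b, false)
  minus_injective a a' h := Fin.ext (congrArg Prod.fst h)
  sign_minus _ := rfl

end Gem

namespace Presentation

variable {n : ℕ} {A B C : Type} {X : Decorated n A B} {D : Gem n A B}

/-! ### The complex of an element of the group -/

/-- Each elementary identification crosses a wall whose color is missing from the face, i.e. is a
single step of `Conn`. Faithfulness of the complex of `g` follows from this. -/
theorem eqvGen_attachRel {g : G n} (α β : ℕ) {x y : LabeledFace n}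
    (h : Relation.EqvGen (attachRel g) x y) : x.colors = y.colors ∧
      (Gem.ofPerm g α β).Conn x.colors (x.label, x.sign) (y.label, y.sign) := by
  induction h with
  | rel x y h =>
    obtain ⟨h1, h2, h3, c, hc, h4⟩ := h
    refine ⟨h3, Gem.Conn.symm ?_⟩
    have h5 : (Gem.ofPerm g α β).adj c (y.label, y.sign) = (x.label, x.sign) := by
      simp [Gem.ofPerm, h1, h2, h4]
    exact h5 ▸ Gem.conn_adj hc _
  | refl x => exact ⟨rfl, Gem.Conn.refl _⟩
  | symm x y _ ih => exact ⟨ih.1.symm, ih.1 ▸ ih.2.symm⟩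
  | trans x y z _ _ ih1 ih2 => exact ⟨ih1.1.trans ih2.1, ih1.2.trans (ih1.1 ▸ ih2.2)⟩

/-- A color missing from a face is missing from all its subfaces, so identifications restrict to
subfaces. -/
theorem attached_le_iff (g : G n) (z : (attached g).Cell) (y : LabeledFace n) :
    z ≤ (Quot.mk _ y : (attached g).Cell) ↔
      ∃ x : LabeledFace n, (x.label = y.label ∧ x.sign = y.sign ∧ x.colors ⊆ y.colors) ∧
        Quot.mk _ x = z := by
  refine quotPreorder_le_mk (fun a => ⟨rfl, rfl, subset_rfl⟩)
    (fun a b c h h' => ⟨h.1.trans h'.1, h.2.1.trans h'.2.1, h.2.2.trans h'.2.2⟩) ?_ z y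
  rintro a b ⟨h1, h2, h3, c, hc, h4⟩
  constructor
  · rintro a' ⟨h5, h6, h7⟩
    refine ⟨⟨b.label, b.sign, a'.colors, a'.nonempty⟩, ⟨rfl, rfl, h3 ▸ h7⟩, Quot.sound ?_⟩
    exact ⟨h6.trans h1, h2, rfl, c, fun h => hc (h7 h), h5.trans h4⟩
  · rintro b' ⟨h5, h6, h7⟩
    refine ⟨⟨a.label, a.sign, b'.colors, b'.nonempty⟩, ⟨rfl, rfl, h3 ▸ h7⟩, Quot.sound ?_⟩
    exact ⟨h1, h6.trans h2, rfl, c, fun h => hc (h3 ▸ h7 h), by rw [h4, h5]⟩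

/-- The presentation of the complex of an element of the group. -/
def attached (g : G n) (α β : ℕ) :
    Presentation ((PsBor.attached g).forget α β) (Gem.ofPerm g α β) := by
  have key : ∀ {x y : LabeledFace n}, (Quot.mk (attachRel g) x) = Quot.mk _ y →
      x.colors = y.colors ∧
        (Gem.ofPerm g α β).Conn x.colors (x.label, x.sign) (y.label, y.sign) :=
    fun h => eqvGen_attachRel α β (Quot.eqvGen_exact h)
  refine
    { toFun := fun x S => Quot.mk _ ⟨x.1, x.2, S.1, S.2⟩
      surj := ?_
      le_iff := ?_
      lower := ?_
      adj := ?_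
      chamber_inj := ?_
      facet_inj := ?_
      sign := ?_
      vertexColor := ?_
      facetColor := ?_
      plusLabel := ?_
      minusLabel := ?_ }
  · rintro ⟨x⟩
    exact ⟨(x.label, x.sign), ⟨x.colors, x.nonempty⟩, rfl⟩
  · intro x S T
    refine (attached_le_iff g _ _).trans
      ⟨?_, fun h => ⟨⟨x.1, x.2, S.1, S.2⟩, ⟨rfl, rfl, h⟩, rfl⟩⟩
    rintro ⟨y, ⟨-, -, h⟩, hy⟩
    have h1 : y.colors = S.1 := (key hy).1
    change S.1 ⊆ T.1
    exact h1 ▸ h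
  · intro x T z hz
    obtain ⟨y, ⟨h1, h2, -⟩, rfl⟩ := (attached_le_iff g _ _).1 hz
    rcases y with ⟨l, s, S, hS⟩
    obtain rfl : l = x.1 := h1
    obtain rfl : s = x.2 := h2
    exact ⟨⟨S, hS⟩, rfl⟩
  · rintro ⟨x, _ | _⟩ S c hc
    · exact Quot.sound ⟨rfl, rfl, rfl, c, hc, rfl⟩
    -- `attachRel` is directed from plus to minus; from a plus-chamber it is used backwards, at the
    -- preimage of `x` under `g c`.
    · have h : attachRel g ⟨x, true, S.1, S.2⟩ ⟨(g c).1⁻¹ x, false, S.1, S.2⟩ :=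
        ⟨rfl, rfl, rfl, c, hc, (Equiv.apply_symm_apply (g c).1 x).symm⟩
      exact (Quot.sound h).symm
  · rintro x y S hS h
    have h1 := (key h).2
    simp only [hS] at h1
    exact h1.eq_of_univ
  · rintro x y S c hS h
    have h1 := (key h).2
    simp only [hS] at h1
    exact h1.of_facet
  · rintro x S b
    constructor
    · rintro ⟨y, hy, h1, h2⟩
      have h3 : y.colors = S.1 := (key hy).1
      have h4 := (key hy).2
      rw [h1] at h4
      have h5 := h4.eq_of_univ
      exact ⟨h3 ▸ h1, (congrArg Prod.snd h5).symm.trans h2⟩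
    · rintro ⟨h1, h2⟩
      exact ⟨_, rfl, h1, h2⟩
  · intro x S c
    constructor
    · rintro ⟨y, hy, h1⟩
      exact (key hy).1.symm.trans h1
    · intro h
      exact ⟨_, rfl, h⟩
  · intro x S c
    constructor
    · rintro ⟨y, hy, h1⟩
      exact (key hy).1.symm.trans h1
    · intro h
      exact ⟨_, rfl, h⟩
  · intro x S a
    constructor
    · rintro ⟨y, hy, h1, h2, h3⟩
      have h4 := (key hy).2
      rw [h1] at h4
      have h5 := h4.eq_of_univ
      rw [h2, h3] at h5
      exact ⟨(key hy).1.symm.trans h1, h5.symm⟩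
    · rintro ⟨h1, rfl⟩
      exact ⟨_, rfl, h1, rfl, rfl⟩
  · intro x S a
    constructor
    · rintro ⟨y, hy, h1, h2, h3⟩
      have h4 := (key hy).2
      rw [h1] at h4
      have h5 := h4.eq_of_univ
      rw [h2, h3] at h5
      exact ⟨(key hy).1.symm.trans h1, h5.symm⟩
    · rintro ⟨h1, rfl⟩
      exact ⟨_, rfl, h1, rfl, rfl⟩

theorem attached_faithful (g : G n) (α β : ℕ) : (attached g α β).Faithful :=
  fun _ _ _ h => (eqvGen_attachRel α β (Quot.eqvGen_exact h)).2

/-! ### Normalization -/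

/-- The faces of the chambers. -/
def chamberFace (P : Presentation X D) (x : D.Chamber) (S : ColorSet n) : X.ChamberFace :=
  ⟨P.toFun x (full n), P.toFun x S, P.isChamber_full x, (P.le_iff x S _).2 (le_full S)⟩

theorem exists_chamberFace (P : Presentation X D) (p : X.ChamberFace) :
    ∃ x S, P.chamberFace x S = p := by
  rcases p with ⟨C, F, hC, hF⟩
  obtain ⟨x, rfl⟩ := P.exists_of_isChamber hC
  obtain ⟨S, rfl⟩ := P.lower _ _ _ hF
  exact ⟨x, S, rfl⟩

/-- The facet through which two faces are identified has the form `cofull c`. It contains the face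
`S` exactly when `c ∉ S`, and it lies in exactly two chambers, exchanged by `adj c`. -/
theorem normalizeRel_iff [NeZero n] (P : Presentation X D) (x y : D.Chamber) (S T : ColorSet n) :
    X.normalizeRel (P.chamberFace x S) (P.chamberFace y T) ↔
      S = T ∧ ∃ c ∉ S.1, y = x ∨ y = D.adj c x := by
  have hS : ∀ c, S ≤ cofull c ↔ c ∉ S.1 := by
    intro c
    change S.1 ⊆ {c}ᶜ ↔ _
    rw [Finset.subset_compl_comm, Finset.singleton_subset_iff, Finset.mem_compl]
  constructor
  · rintro ⟨h1, F, hF, h2, h3, h4⟩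
    obtain ⟨U, rfl⟩ := P.lower _ _ _ h3
    obtain ⟨c, rfl⟩ := (P.isFacet_iff _ _).1 hF
    refine ⟨P.colors_eq h1, c, ?_, ?_⟩
    · rw [← hS, ← P.le_iff x]
      exact h2
    · exact P.cofull_le_full.1 h4
  · rintro ⟨rfl, c, hc, h⟩
    have h1 := P.cofull_eq_iff.2 h
    refine ⟨P.eq_of_conn ?_, P.toFun x (cofull c), (P.isFacet_iff _ _).2 ⟨c, rfl⟩, ?_, ?_, ?_⟩
    · rcases h with rfl | rfl
      · exact Gem.Conn.refl _
      · exact Gem.conn_adj hc x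
    · exact (P.le_iff _ _ _).2 ((hS c).2 hc)
    · exact (P.le_iff _ _ _).2 (le_full _)
    · exact P.cofull_le_full.2 h

theorem eqvGen_normalizeRel [NeZero n] (P : Presentation X D) {p q : X.ChamberFace}
    (h : Relation.EqvGen X.normalizeRel p q) (x y : D.Chamber) (S T : ColorSet n)
    (hp : P.chamberFace x S = p) (hq : P.chamberFace y T = q) : S = T ∧ D.Conn S.1 x y := by
  have hinj : ∀ x y S T, P.chamberFace x S = P.chamberFace y T → S = T ∧ x = y := fun x y S T h =>
    ⟨P.colors_eq (congrArg Decorated.ChamberFace.face h),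
      P.full_injective (congrArg Decorated.ChamberFace.chamber h)⟩
  induction h generalizing x y S T with
  | rel p q h =>
    subst hp hq
    obtain ⟨rfl, c, hc, h | h⟩ := (P.normalizeRel_iff _ _ _ _).1 h
    · exact ⟨rfl, h ▸ Gem.Conn.refl _⟩
    · exact ⟨rfl, h ▸ Gem.conn_adj hc x⟩
  | refl p =>
    obtain ⟨rfl, rfl⟩ := hinj _ _ _ _ (hp.trans hq.symm)
    exact ⟨rfl, Gem.Conn.refl _⟩
  | symm p q _ ih =>
    obtain ⟨rfl, h⟩ := ih y x T S hq hp
    exact ⟨rfl, h.symm⟩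
  | trans p q r _ _ ih1 ih2 =>
    obtain ⟨z, U, hz⟩ := P.exists_chamberFace q
    obtain ⟨rfl, h1⟩ := ih1 x z S U hp hz
    obtain ⟨rfl, h2⟩ := ih2 z y S T hz hq
    exact ⟨rfl, h1.trans h2⟩

/-- No faithfulness of `P` is needed: the generated equivalence sees only the gem, not the
accidental coincidences in `X`. -/
theorem normalize_mk_eq_iff [NeZero n] (P : Presentation X D) (x y : D.Chamber)
    (S T : ColorSet n) :
    Quot.mk X.normalizeRel (P.chamberFace x S) = Quot.mk _ (P.chamberFace y T) ↔
      S = T ∧ D.Conn S.1 x y := by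
  constructor
  · intro h
    exact P.eqvGen_normalizeRel (Quot.eqvGen_exact h) _ _ _ _ rfl rfl
  · rintro ⟨rfl, h⟩
    refine Gem.Conn.induction (p := fun z => Quot.mk X.normalizeRel (P.chamberFace x S) =
      Quot.mk _ (P.chamberFace z S)) (fun z c hc hz => hz.trans (Quot.sound ?_)) h rfl
    exact (P.normalizeRel_iff _ _ _ _).2 ⟨rfl, c, hc, Or.inr rfl⟩

theorem normalize_le_iff [NeZero n] (P : Presentation X D) (z : X.normalize.Cell)
    (y : X.ChamberFace) : z ≤ (Quot.mk _ y : X.normalize.Cell) ↔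
      ∃ x : X.ChamberFace, (x.chamber = y.chamber ∧ x.face ≤ y.face) ∧ Quot.mk _ x = z := by
  -- The color of the crossed wall is missing from `T`, hence from the smaller set `S`.
  have hlift : ∀ x y S T U, S ≤ T → X.normalizeRel (P.chamberFace x T) (P.chamberFace y U) →
      Quot.mk X.normalizeRel (P.chamberFace x S) = Quot.mk _ (P.chamberFace y S) := by
    intro x y S T U hST h
    obtain ⟨rfl, c, hc, h⟩ := (P.normalizeRel_iff _ _ _ _).1 h
    exact Quot.sound ((P.normalizeRel_iff _ _ _ _).2 ⟨rfl, c, fun hS => hc (hST hS), h⟩)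
  refine quotPreorder_le_mk (fun a => ⟨rfl, le_rfl⟩)
    (fun a b c h h' => ⟨h.1.trans h'.1, h.2.trans h'.2⟩) ?_ z y
  intro a b h
  obtain ⟨x, S, rfl⟩ := P.exists_chamberFace a
  obtain ⟨y, T, rfl⟩ := P.exists_chamberFace b
  obtain ⟨rfl, -⟩ := (P.normalizeRel_iff _ _ _ _).1 h
  constructor
  · rintro a' ⟨h1, h2⟩
    obtain ⟨x', S', rfl⟩ := P.exists_chamberFace a'
    obtain rfl := P.full_injective h1
    have h3 : S' ≤ S := (P.le_iff _ _ _).1 h2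
    exact ⟨P.chamberFace y S', ⟨rfl, (P.le_iff _ _ _).2 h3⟩, hlift _ _ _ _ _ h3 h⟩
  · rintro b' ⟨h1, h2⟩
    obtain ⟨y', S', rfl⟩ := P.exists_chamberFace b'
    obtain rfl := P.full_injective h1
    have h3 : S' ≤ S := (P.le_iff _ _ _).1 h2
    exact ⟨P.chamberFace x S', ⟨rfl, (P.le_iff _ _ _).2 h3⟩, hlift _ _ _ _ _ h3 h⟩

/-- The presentation of the normalization. -/
def normalize [NeZero n] (P : Presentation X D) : Presentation X.normalize D where
  toFun x S := Quot.mk _ (P.chamberFace x S)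
  surj := by
    rintro ⟨p⟩
    obtain ⟨x, S, rfl⟩ := P.exists_chamberFace p
    exact ⟨x, S, rfl⟩
  le_iff x S T := by
    refine (P.normalize_le_iff _ _).trans ⟨?_, fun h => ⟨P.chamberFace x S,
      ⟨rfl, (P.le_iff _ _ _).2 h⟩, rfl⟩⟩
    rintro ⟨p, ⟨h1, h2⟩, h3⟩
    obtain ⟨y, U, rfl⟩ := P.exists_chamberFace p
    obtain rfl := P.full_injective h1
    obtain ⟨rfl, -⟩ := (P.normalize_mk_eq_iff _ _ _ _).1 h3
    exact (P.le_iff _ _ _).1 h2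
  lower x T z hz := by
    obtain ⟨p, ⟨h1, h2⟩, rfl⟩ := (P.normalize_le_iff _ _).1 hz
    obtain ⟨y, U, rfl⟩ := P.exists_chamberFace p
    obtain rfl := P.full_injective h1
    exact ⟨U, rfl⟩
  adj x S c hc := (P.normalize_mk_eq_iff _ _ _ _).2 ⟨rfl, (Gem.conn_adj hc x).symm⟩
  chamber_inj x y S hS h := by
    have h1 := ((P.normalize_mk_eq_iff _ _ _ _).1 h).2
    rw [hS] at h1
    exact h1.eq_of_univ
  facet_inj x y S c hS h := by
    have h1 := ((P.normalize_mk_eq_iff _ _ _ _).1 h).2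
    rw [hS] at h1
    exact h1.of_facet
  sign x S := P.sign x S
  vertexColor x S := P.vertexColor x S
  facetColor x S := P.facetColor x S
  plusLabel x S := P.plusLabel x S
  minusLabel x S := P.minusLabel x S

/-- A gluing may create coincidences in codimension at least two that are not forced by walls; after
normalization none are left. -/
theorem normalize_faithful [NeZero n] (P : Presentation X D) : P.normalize.Faithful :=
  fun _ _ _ h => ((P.normalize_mk_eq_iff _ _ _ _).1 h).2

/-! ### Gluing -/

section Glue

variable {Y : Decorated n B C} {E : Gem n B C} (P : Presentation X D) (Q : Presentation Y E)

theorem exists_vertex_iff (x : D.Chamber) (S : ColorSet n) (c : Fin (n + 1)) :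
    (∃ v, v ≤ P.toFun x S ∧ X.HasVertexColor v c) ↔ c ∈ S.1 := by
  constructor
  · rintro ⟨v, hv, h⟩
    obtain ⟨T, rfl⟩ := P.lower _ _ _ hv
    rw [P.vertexColor] at h
    rw [P.le_iff] at hv
    exact hv (h ▸ Finset.mem_singleton_self c)
  · intro h
    exact ⟨P.toFun x (single c), (P.le_iff _ _ _).2 (Finset.singleton_subset_iff.2 h),
      (P.vertexColor _ _ _).2 rfl⟩

theorem sameColors_iff (x : D.Chamber) (y : E.Chamber) (S T : ColorSet n) :
    Decorated.SameColors X Y (P.toFun x S) (Q.toFun y T) ↔ S = T := by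
  simp only [Decorated.SameColors, exists_vertex_iff]
  rw [Subtype.ext_iff, Finset.ext_iff]

/-- The faces of the remaining chambers before the gluing. -/
def cutFace : Gem.CompChamber D E → ColorSet n → Decorated.Cut X Y
  | Sum.inl x, S => Sum.inl ⟨P.toFun x.1 S, fun s h => x.2 s ((P.minusLabel _ _ _).1 h).2⟩
  | Sum.inr y, S => Sum.inr ⟨Q.toFun y.1 S, fun s h => y.2 s ((Q.plusLabel _ _ _).1 h).2⟩

theorem exists_notMem_of_ne_univ {S : Finset (Fin (n + 1))} (h : S ≠ Finset.univ) :
    ∃ c, c ∉ S := by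
  by_contra hc
  push Not at hc
  exact h (Finset.eq_univ_of_forall hc)

/-- A proper face of a removed chamber misses some color `c`, so it also belongs to the
`c`-neighbor. That neighbor has the opposite sign and is not removed. -/
theorem exists_cutFace (a : Decorated.Cut X Y) : ∃ x S, cutFace P Q x S = a := by
  rcases a with ⟨z, hz⟩ | ⟨z, hz⟩
  · obtain ⟨x, S, rfl⟩ := P.surj z
    by_cases hx : ∃ s, x = D.minus s
    · obtain ⟨s, rfl⟩ := hx
      have hS : S.1 ≠ Finset.univ := fun h => hz s ((P.minusLabel _ _ _).2 ⟨h, rfl⟩)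
      obtain ⟨c, hc⟩ := exists_notMem_of_ne_univ hS
      exact ⟨Sum.inl ⟨D.adj c (D.minus s), D.adj_minus_ne_minus c s⟩, S,
        congrArg Sum.inl (Subtype.ext (P.adj _ _ _ hc))⟩
    · exact ⟨Sum.inl ⟨x, not_exists.1 hx⟩, S, rfl⟩
  · obtain ⟨x, S, rfl⟩ := Q.surj z
    by_cases hx : ∃ s, x = E.plus s
    · obtain ⟨s, rfl⟩ := hx
      have hS : S.1 ≠ Finset.univ := fun h => hz s ((Q.plusLabel _ _ _).2 ⟨h, rfl⟩)
      obtain ⟨c, hc⟩ := exists_notMem_of_ne_univ hS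
      exact ⟨Sum.inr ⟨E.adj c (E.plus s), E.adj_plus_ne_plus c s⟩, S,
        congrArg Sum.inr (Subtype.ext (Q.adj _ _ _ hc))⟩
    · exact ⟨Sum.inr ⟨x, not_exists.1 hx⟩, S, rfl⟩

theorem cutFace_colors {x y : Gem.CompChamber D E} {S T : ColorSet n}
    (h : cutFace P Q x S = cutFace P Q y T) : S = T := by
  rcases x with x | x <;> rcases y with y | y
  · exact P.colors_eq (congrArg Subtype.val (Sum.inl_injective h))
  · cases h
  · cases h
  · exact Q.colors_eq (congrArg Subtype.val (Sum.inr_injective h))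

/-- Faces in the boundaries of the two removed chambers are proper, and for colored faces the
matching condition is equality of color sets. -/
theorem glueRel_iff (x y : Gem.CompChamber D E) (S T : ColorSet n) :
    Decorated.glueRel X Y (cutFace P Q x S) (cutFace P Q y T) ↔
      S = T ∧ S.1 ≠ Finset.univ ∧ ∃ x' y' s, x = Sum.inl x' ∧ y = Sum.inr y' ∧
        P.toFun x'.1 S = P.toFun (D.minus s) S ∧ Q.toFun y'.1 S = Q.toFun (E.plus s) S := by
  constructor
  · intro h
    rcases x with x | x <;> rcases y with y | y
    · exact h.elim
    · obtain ⟨s, K, K', h1, h2, h3, h4, h5⟩ := h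
      obtain rfl := (P.sameColors_iff Q _ _ _ _).1 h5
      obtain ⟨z, U, rfl⟩ := P.surj K
      obtain ⟨w, V, rfl⟩ := Q.surj K'
      obtain ⟨hU, rfl⟩ := (P.minusLabel _ _ _).1 h1
      obtain ⟨hV, rfl⟩ := (Q.plusLabel _ _ _).1 h2
      have h6 := (P.lt_iff_exists _ _ _ _).1 h3
      have h7 := (Q.lt_iff_exists _ _ _ _).1 h4
      refine ⟨rfl, fun h => ?_, x, y, s, rfl, rfl, h6.2, h7.2⟩
      exact absurd h6.1 (by rw [Subtype.ext (h.trans hU.symm)]; exact lt_irrefl _)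
    · exact h.elim
    · exact h.elim
  · rintro ⟨rfl, hS, x', y', s, rfl, rfl, h1, h2⟩
    have hlt : S < full n := lt_of_le_of_ne (le_full S) fun h => hS (congrArg Subtype.val h)
    exact ⟨s, P.toFun (D.minus s) (full n), Q.toFun (E.plus s) (full n),
      (P.minusLabel _ _ _).2 ⟨rfl, rfl⟩, (Q.plusLabel _ _ _).2 ⟨rfl, rfl⟩,
      (P.lt_iff_exists _ _ _ _).2 ⟨hlt, h1⟩, (Q.lt_iff_exists _ _ _ _).2 ⟨hlt, h2⟩,
      (P.sameColors_iff Q _ _ _ _).2 rfl⟩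

theorem cutFace_le_iff (x : Gem.CompChamber D E) (S T : ColorSet n) :
    cutFace P Q x S ≤ cutFace P Q x T ↔ S ≤ T := by
  rcases x with x | y
  · exact Sum.inl_le_inl_iff.trans (P.le_iff x.1 S T)
  · exact Sum.inr_le_inr_iff.trans (Q.le_iff y.1 S T)

theorem cutFace_lower (x : Gem.CompChamber D E) (T : ColorSet n) (a : Decorated.Cut X Y)
    (h : a ≤ cutFace P Q x T) : ∃ S, cutFace P Q x S = a := by
  rcases x with x | y <;> rcases a with a | a
  · have h' : a ≤ ⟨P.toFun x.1 T, _⟩ := Sum.inl_le_inl_iff.1 h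
    obtain ⟨S, hS⟩ := P.lower _ _ _ h'
    exact ⟨S, congrArg Sum.inl (Subtype.ext hS)⟩
  · exact absurd h Sum.not_inr_le_inl
  · exact absurd h Sum.not_inl_le_inr
  · have h' : a ≤ ⟨Q.toFun y.1 T, _⟩ := Sum.inr_le_inr_iff.1 h
    obtain ⟨S, hS⟩ := Q.lower _ _ _ h'
    exact ⟨S, congrArg Sum.inr (Subtype.ext hS)⟩

include P Q in
theorem glue_le_iff (z : (X.glue Y).Cell) (b : Decorated.Cut X Y) :
    z ≤ (Quot.mk _ b : (X.glue Y).Cell) ↔ ∃ a, a ≤ b ∧ Quot.mk _ a = z := by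
  -- A subface of a face on a removed chamber is on the same chamber, so the gluing restricts to
  -- subfaces.
  have hlift : ∀ x y S T, S ≤ T →
      Decorated.glueRel X Y (cutFace P Q x T) (cutFace P Q y T) →
      Quot.mk (Decorated.glueRel X Y) (cutFace P Q x S) = Quot.mk _ (cutFace P Q y S) := by
    intro x y S T hST h
    obtain ⟨-, hT, x', y', s, rfl, rfl, h1, h2⟩ := (glueRel_iff P Q _ _ _ _).1 h
    refine Quot.sound ((glueRel_iff P Q _ _ _ _).2 ⟨rfl, fun hS => hT ?_, x', y', s, rfl, rfl,
      ?_, ?_⟩)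
    · exact Finset.eq_univ_of_forall fun c => hST (hS ▸ Finset.mem_univ c)
    · exact ((P.le_iff_exists _ _ _ _).1 (h1 ▸ (P.le_iff _ _ _).2 hST)).2
    · exact ((Q.le_iff_exists _ _ _ _).1 (h2 ▸ (Q.le_iff _ _ _).2 hST)).2
  refine quotPreorder_le_mk (fun a => le_refl a) (fun a b c h h' => le_trans h h') ?_ z b
  intro a b h
  obtain ⟨x, S, rfl⟩ := exists_cutFace P Q a
  obtain ⟨y, T, rfl⟩ := exists_cutFace P Q b
  obtain ⟨rfl, -⟩ := (glueRel_iff P Q _ _ _ _).1 h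
  constructor
  · intro a' h'
    obtain ⟨S', rfl⟩ := cutFace_lower P Q _ _ _ h'
    rw [cutFace_le_iff] at h'
    exact ⟨cutFace P Q y S', (cutFace_le_iff P Q _ _ _).2 h', hlift _ _ _ _ h' h⟩
  · intro a' h'
    obtain ⟨S', rfl⟩ := cutFace_lower P Q _ _ _ h'
    rw [cutFace_le_iff] at h'
    exact ⟨cutFace P Q x S', (cutFace_le_iff P Q _ _ _).2 h', hlift _ _ _ _ h' h⟩

/-- Equalities in the glued complex are analyzed by choosing a predicate invariant under `glueRel`,
which avoids describing the generated equivalence relation. -/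
theorem _root_.Quot.iff_of_mk_eq {α : Type*} {r : α → α → Prop} (p : α → Prop)
    (hp : ∀ a b, r a b → (p a ↔ p b)) {a b : α} (h : Quot.mk r a = Quot.mk r b) : p a ↔ p b :=
  iff_of_eq (congrArg (Quot.lift p fun a b h => propext (hp a b h)) h)

theorem glue_colors {x y : Gem.CompChamber D E} {S T : ColorSet n}
    (h : Quot.mk (Decorated.glueRel X Y) (cutFace P Q x S) = Quot.mk _ (cutFace P Q y T)) :
    S = T := by
  have h1 := Quot.iff_of_mk_eq (fun a => ∃ x, cutFace P Q x S = a) ?_ h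
  · obtain ⟨z, hz⟩ := h1.1 ⟨x, rfl⟩
    exact cutFace_colors P Q hz
  · intro a b h
    obtain ⟨x, U, rfl⟩ := exists_cutFace P Q a
    obtain ⟨y, V, rfl⟩ := exists_cutFace P Q b
    obtain ⟨rfl, -⟩ := (glueRel_iff P Q _ _ _ _).1 h
    constructor
    · rintro ⟨z, hz⟩
      obtain rfl := cutFace_colors P Q hz
      exact ⟨y, rfl⟩
    · rintro ⟨z, hz⟩
      obtain rfl := cutFace_colors P Q hz
      exact ⟨x, rfl⟩

/-- Only proper faces are glued, so the predicate of being this particular chamber is invariant. -/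
theorem glue_chamber {x y : Gem.CompChamber D E} {S : ColorSet n} (hS : S.1 = Finset.univ)
    (h : Quot.mk (Decorated.glueRel X Y) (cutFace P Q x S) = Quot.mk _ (cutFace P Q y S)) :
    x = y := by
  have h1 := Quot.iff_of_mk_eq (fun a => cutFace P Q x S = a) ?_ h
  · have h2 := h1.1 rfl
    rcases x with x | x <;> rcases y with y | y
    · exact congrArg Sum.inl (Subtype.ext
        (P.chamber_inj _ _ S hS (congrArg Subtype.val (Sum.inl_injective h2))))
    · cases h2
    · cases h2
    · exact congrArg Sum.inr (Subtype.ext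
        (Q.chamber_inj _ _ S hS (congrArg Subtype.val (Sum.inr_injective h2))))
  · intro a b h
    obtain ⟨x, U, rfl⟩ := exists_cutFace P Q a
    obtain ⟨y, V, rfl⟩ := exists_cutFace P Q b
    obtain ⟨rfl, hU, -⟩ := (glueRel_iff P Q _ _ _ _).1 h
    constructor
    · intro hz
      exact absurd (cutFace_colors P Q hz ▸ hS) hU
    · intro hz
      exact absurd (cutFace_colors P Q hz ▸ hS) hU

theorem cutFace_facet {x y : Gem.CompChamber D E} {S : ColorSet n} {c : Fin (n + 1)}
    (hS : S.1 = {c}ᶜ) (h : cutFace P Q x S = cutFace P Q y S) :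
    y = x ∨ y = Gem.compAdj D E c x := by
  rcases x with x | x <;> rcases y with y | y
  · rcases P.facet_inj _ _ S c hS (congrArg Subtype.val (Sum.inl_injective h)) with h1 | h1
    · exact Or.inl (congrArg Sum.inl (Subtype.ext h1))
    · right
      rw [Gem.compAdj_inl_of_ne D E fun s => h1 ▸ y.2 s]
      exact congrArg Sum.inl (Subtype.ext h1)
  · cases h
  · cases h
  · rcases Q.facet_inj _ _ S c hS (congrArg Subtype.val (Sum.inr_injective h)) with h1 | h1
    · exact Or.inl (congrArg Sum.inr (Subtype.ext h1))
    · right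
      rw [Gem.compAdj_inr_of_ne D E fun s => h1 ▸ y.2 s]
      exact congrArg Sum.inr (Subtype.ext h1)

/-- Each wall is shared with a removed chamber. As `x` and `y` themselves remain, the removed
chambers are their `c`-neighbors, which is precisely the case where `compAdj` jumps across. -/
theorem glueRel_facet {x y : Gem.CompChamber D E} {S : ColorSet n} {c : Fin (n + 1)}
    (hS : S.1 = {c}ᶜ) (h : Decorated.glueRel X Y (cutFace P Q x S) (cutFace P Q y S)) :
    y = Gem.compAdj D E c x := by
  obtain ⟨-, -, x, y, s, rfl, rfl, h1, h2⟩ := (glueRel_iff P Q _ _ _ _).1 h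
  have h3 := (P.facet_inj _ _ S c hS h1).resolve_left fun h => x.2 s h.symm
  have h4 := (Q.facet_inj _ _ S c hS h2).resolve_left fun h => y.2 s h.symm
  rw [Gem.compAdj_inl_of_eq D E h3.symm]
  exact congrArg Sum.inr (Subtype.ext ((congrArg (E.adj c) h4).trans (E.adj_adj c y.1)).symm)

theorem glue_facet {x y : Gem.CompChamber D E} {S : ColorSet n} {c : Fin (n + 1)}
    (hS : S.1 = {c}ᶜ)
    (h : Quot.mk (Decorated.glueRel X Y) (cutFace P Q x S) = Quot.mk _ (cutFace P Q y S)) :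
    y = x ∨ y = Gem.compAdj D E c x := by
  have hadj : ∀ z, Gem.compAdj D E c (Gem.compAdj D E c z) = z := (Gem.comp D E).adj_adj c
  -- The pair consisting of `x` and its `c`-neighbor is closed under crossing walls of color `c`;
  -- its set of walls is the invariant used below.
  have hW : ∀ z w, (z = x ∨ z = Gem.compAdj D E c x) → (w = z ∨ w = Gem.compAdj D E c z) →
      (w = x ∨ w = Gem.compAdj D E c x) := by
    rintro z w (rfl | rfl) (rfl | rfl)
    · exact Or.inl rfl
    · exact Or.inr rfl
    · exact Or.inr rfl
    · exact Or.inl (hadj _)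
  have h1 := Quot.iff_of_mk_eq
    (fun a => ∃ w, (w = x ∨ w = Gem.compAdj D E c x) ∧ cutFace P Q w S = a) ?_ h
  · obtain ⟨w, hw, hwy⟩ := h1.1 ⟨x, Or.inl rfl, rfl⟩
    exact hW _ _ hw (cutFace_facet P Q hS hwy)
  · intro a b h
    obtain ⟨u, U, rfl⟩ := exists_cutFace P Q a
    obtain ⟨v, V, rfl⟩ := exists_cutFace P Q b
    obtain ⟨rfl, -⟩ := (glueRel_iff P Q _ _ _ _).1 h
    constructor
    · rintro ⟨w, hw, hwu⟩
      obtain rfl := cutFace_colors P Q hwu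
      exact ⟨v, hW _ _ (hW _ _ hw (cutFace_facet P Q hS hwu))
        (Or.inr (glueRel_facet P Q hS h)), rfl⟩
    · rintro ⟨w, hw, hwv⟩
      obtain rfl := cutFace_colors P Q hwv
      refine ⟨u, hW _ _ (hW _ _ hw (cutFace_facet P Q hS hwv)) (Or.inr ?_), rfl⟩
      rw [glueRel_facet P Q hS h, hadj]

/-- The presentation of the gluing. -/
def glue : Presentation (X.glue Y) (D.comp E) where
  toFun x S := Quot.mk _ (cutFace P Q x S)
  surj := by
    rintro ⟨a⟩
    obtain ⟨x, S, rfl⟩ := exists_cutFace P Q a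
    exact ⟨x, S, rfl⟩
  le_iff x S T := by
    refine (glue_le_iff P Q _ _).trans ⟨?_, fun h => ⟨_, (cutFace_le_iff P Q x S T).2 h, rfl⟩⟩
    rintro ⟨a, h1, h2⟩
    obtain ⟨U, rfl⟩ := cutFace_lower P Q _ _ _ h1
    obtain rfl := glue_colors P Q h2
    exact (cutFace_le_iff P Q _ _ _).1 h1
  lower x T z hz := by
    obtain ⟨a, h1, rfl⟩ := (glue_le_iff P Q _ _).1 hz
    obtain ⟨U, rfl⟩ := cutFace_lower P Q _ _ _ h1
    exact ⟨U, rfl⟩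
  adj x S c hc := by
    -- A face missing `c` is proper, hence eligible for gluing.
    have hS : S.1 ≠ Finset.univ := fun h => hc (h ▸ Finset.mem_univ c)
    change Quot.mk _ (cutFace P Q (Gem.compAdj D E c x) S) = _
    rcases x with x | y
    · by_cases h : ∃ s, D.adj c x.1 = D.minus s
      · obtain ⟨s, hs⟩ := h
        rw [Gem.compAdj_inl_of_eq D E hs]
        refine (Quot.sound ((glueRel_iff P Q _ _ _ _).2
          ⟨rfl, hS, x, _, s, rfl, rfl, ?_, ?_⟩) : Quot.mk (Decorated.glueRel X Y) _ = _).symm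
        · rw [← hs, P.adj _ _ _ hc]
        · rw [Q.adj _ _ _ hc]
      · rw [Gem.compAdj_inl_of_ne D E (not_exists.1 h)]
        exact congrArg _ (congrArg Sum.inl (Subtype.ext (P.adj _ _ _ hc)))
    · by_cases h : ∃ s, E.adj c y.1 = E.plus s
      · obtain ⟨s, hs⟩ := h
        rw [Gem.compAdj_inr_of_eq D E hs]
        refine Quot.sound ((glueRel_iff P Q _ _ _ _).2 ⟨rfl, hS, _, y, s, rfl, rfl, ?_, ?_⟩)
        · rw [P.adj _ _ _ hc]
        · rw [← hs, Q.adj _ _ _ hc]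
      · rw [Gem.compAdj_inr_of_ne D E (not_exists.1 h)]
        exact congrArg _ (congrArg Sum.inr (Subtype.ext (Q.adj _ _ _ hc)))
  chamber_inj x y S hS h := glue_chamber P Q hS h
  facet_inj x y S c hS h := glue_facet P Q hS h
  sign x S b := by
    constructor
    · rintro ⟨a, h1, h2⟩
      obtain ⟨y, T, rfl⟩ := exists_cutFace P Q a
      obtain rfl := glue_colors P Q h1
      have h3 : T.1 = Finset.univ ∧ (D.comp E).sign y = b := by
        rcases y with y | y
        · exact (P.sign _ _ _).1 h2
        · exact (Q.sign _ _ _).1 h2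
      exact ⟨h3.1, glue_chamber P Q h3.1 h1 ▸ h3.2⟩
    · intro h
      refine ⟨_, rfl, ?_⟩
      rcases x with x | x
      · exact (P.sign _ _ _).2 h
      · exact (Q.sign _ _ _).2 h
  vertexColor x S b := by
    constructor
    · rintro ⟨a, h1, h2⟩
      obtain ⟨y, T, rfl⟩ := exists_cutFace P Q a
      obtain rfl := glue_colors P Q h1
      rcases y with y | y
      · exact (P.vertexColor _ _ _).1 h2
      · exact (Q.vertexColor _ _ _).1 h2
    · intro h
      refine ⟨_, rfl, ?_⟩
      rcases x with x | x
      · exact (P.vertexColor _ _ _).2 h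
      · exact (Q.vertexColor _ _ _).2 h
  facetColor x S b := by
    constructor
    · rintro ⟨a, h1, h2⟩
      obtain ⟨y, T, rfl⟩ := exists_cutFace P Q a
      obtain rfl := glue_colors P Q h1
      rcases y with y | y
      · exact (P.facetColor _ _ _).1 h2
      · exact (Q.facetColor _ _ _).1 h2
    · intro h
      refine ⟨_, rfl, ?_⟩
      rcases x with x | x
      · exact (P.facetColor _ _ _).2 h
      · exact (Q.facetColor _ _ _).2 h
  plusLabel x S a := by
    constructor
    · rintro ⟨z, h1, h2⟩
      obtain ⟨y, T, hy⟩ := exists_cutFace P Q (Sum.inl z)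
      rw [← hy] at h1
      obtain rfl := glue_colors P Q h1
      rcases y with y | y
      · obtain rfl := Sum.inl_injective hy
        obtain ⟨h3, h4⟩ := (P.plusLabel _ _ _).1 h2
        exact ⟨h3, (glue_chamber P Q h3 h1).symm.trans (congrArg Sum.inl (Subtype.ext h4))⟩
      · cases hy
    · rintro ⟨h, rfl⟩
      exact ⟨_, rfl, (P.plusLabel _ _ _).2 ⟨h, rfl⟩⟩
  minusLabel x S a := by
    constructor
    · rintro ⟨z, h1, h2⟩
      obtain ⟨y, T, hy⟩ := exists_cutFace P Q (Sum.inr z)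
      rw [← hy] at h1
      obtain rfl := glue_colors P Q h1
      rcases y with y | y
      · cases hy
      · obtain rfl := Sum.inr_injective hy
        obtain ⟨h3, h4⟩ := (Q.minusLabel _ _ _).1 h2
        exact ⟨h3, (glue_chamber P Q h3 h1).symm.trans (congrArg Sum.inr (Subtype.ext h4))⟩
    · rintro ⟨h, rfl⟩
      exact ⟨_, rfl, (Q.minusLabel _ _ _).2 ⟨h, rfl⟩⟩

end Glue

/-! ### Removal of bare double-chambers -/

theorem unlabeled_iff (P : Presentation X D) (x : D.Chamber) : X.Unlabeled (P.toFun x (full n)) ↔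
    (∀ a, x ≠ D.plus a) ∧ ∀ b, x ≠ D.minus b := by
  simp only [Decorated.Unlabeled, P.plusLabel, P.minusLabel]
  simp [full]

section Trim

variable [NeZero n] (P : Presentation X D)

/-- Equality of boundaries forces the wall of every color to be common. Conversely, the pair is
closed under all `adj c`, and faithfulness is what prevents other chambers from touching it in small
faces. -/
theorem isDoubleChamber_iff (hP : P.Faithful) (x y : D.Chamber) :
    X.IsDoubleChamber (P.toFun x (full n)) (P.toFun y (full n)) ↔ ∀ c, D.adj c x = y := by
  have hcof : ∀ c : Fin (n + 1), cofull c < full n := fun c =>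
    lt_of_le_of_ne (le_full _) fun h => by
      have h1 : c ∈ (cofull c).1 := h ▸ Finset.mem_univ c
      simp [cofull] at h1
  constructor
  · rintro ⟨-, -, hxy, h, -⟩ c
    have h1 := (h (P.toFun x (cofull c))).1 ((P.lt_iff_exists _ _ _ _).2 ⟨hcof c, rfl⟩)
    rcases P.cofull_le_full.1 h1.le with h2 | h2
    · exact absurd (h2 ▸ rfl) hxy
    · exact h2.symm
  · intro h
    have h' : ∀ c, D.adj c y = x := fun c => by rw [← h c, D.adj_adj]
    refine ⟨P.isChamber_full x, P.isChamber_full y, fun hxy => ?_, fun z => ?_,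
      fun z w hz hzw => ?_⟩
    · exact D.adj_ne 0 x (by rw [h 0, P.full_injective hxy])
    · obtain ⟨w, S, rfl⟩ := P.surj z
      rw [P.lt_iff_exists, P.lt_iff_exists]
      refine and_congr_right fun hS => ?_
      obtain ⟨c, hc⟩ := exists_notMem_of_ne_univ (S := S.1) fun h => hS.ne (Subtype.ext h)
      rw [← h c, P.adj _ _ _ hc]
    · have hconn : ∀ S u v, D.Conn S u v → (u = x ∨ u = y) → (v = x ∨ v = y) := by
        intro S u v huv hu
        refine Gem.Conn.induction (p := fun v => v = x ∨ v = y) ?_ huv hu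
        rintro v c - (rfl | rfl)
        · exact Or.inr (h c)
        · exact Or.inl (h' c)
      obtain ⟨u, T, rfl⟩ := P.surj w
      obtain ⟨S, rfl⟩ := P.lower _ _ _ hzw
      rw [P.le_iff_exists, P.le_iff_exists] at hz ⊢
      have h1 : u = x ∨ u = y := by
        rcases hz with hz | hz
        · exact hconn _ _ _ (hP _ _ _ hz.2).symm (Or.inl rfl)
        · exact hconn _ _ _ (hP _ _ _ hz.2).symm (Or.inr rfl)
      rcases h1 with rfl | rfl
      · exact Or.inl ⟨le_full _, rfl⟩
      · exact Or.inr ⟨le_full _, rfl⟩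

theorem isBareDoubleChamber_iff (hP : P.Faithful) (x y : D.Chamber) :
    X.IsBareDoubleChamber (P.toFun x (full n)) (P.toFun y (full n)) ↔
      D.Bare x ∧ ∀ c, D.adj c x = y := by
  rw [Decorated.IsBareDoubleChamber, P.isDoubleChamber_iff hP, P.unlabeled_iff, P.unlabeled_iff]
  constructor
  · rintro ⟨h1, ⟨h2, h3⟩, h4, h5⟩
    exact ⟨⟨y, h1, fun a => ⟨h2 a, h4 a⟩, fun b => ⟨h3 b, h5 b⟩⟩, h1⟩
  · rintro ⟨⟨z, h1, h2, h3⟩, h4⟩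
    obtain rfl : z = y := (h1 0).symm.trans (h4 0)
    exact ⟨h1, ⟨fun a => (h2 a).1, fun b => (h3 b).1⟩, fun a => (h2 a).2, fun b => (h3 b).2⟩

/-- By faithfulness, chambers with a common face are joined by crossing walls, and bareness does not
change along such a path. Hence removal never takes away a face of a chamber that remains. -/
theorem mem_trim_iff (hP : P.Faithful) (x : D.Chamber) (S : ColorSet n) :
    (∀ K K', X.IsBareDoubleChamber K K' → ¬ (P.toFun x S ≤ K ∨ P.toFun x S ≤ K')) ↔
      ¬ D.Bare x := by
  constructor
  · rintro h hx
    obtain ⟨y, hy⟩ := id hx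
    refine h _ _ ((P.isBareDoubleChamber_iff hP x y).2 ⟨hx, hy.1⟩) (Or.inl ?_)
    exact (P.le_iff _ _ _).2 (le_full _)
  · intro hx K K' h hK
    obtain ⟨u, rfl⟩ := P.exists_of_isChamber h.1.1
    obtain ⟨v, rfl⟩ := P.exists_of_isChamber h.1.2.1
    obtain ⟨hu, hv⟩ := (P.isBareDoubleChamber_iff hP u v).1 h
    have hconn : ∀ S w, D.Conn S w x → ¬ D.Bare w := fun S w h hw =>
      hx (Gem.Conn.induction (p := D.Bare) (fun _ c _ h => h.adj c) h hw)
    rw [P.le_iff_exists, P.le_iff_exists] at hK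
    rcases hK with hK | hK
    · exact hconn _ _ (hP _ _ _ hK.2).symm hu
    · exact hconn _ _ (hP _ _ _ hK.2).symm (hv 0 ▸ hu.adj 0)

/-- The presentation of the trimmed complex. -/
def trim (hP : P.Faithful) : Presentation X.trim D.trim where
  toFun x S := ⟨P.toFun x.1 S, (P.mem_trim_iff hP x.1 S).2 x.2⟩
  surj := by
    rintro ⟨z, hz⟩
    obtain ⟨x, S, rfl⟩ := P.surj z
    exact ⟨⟨x, (P.mem_trim_iff hP x S).1 hz⟩, S, rfl⟩
  le_iff x S T := P.le_iff x.1 S T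
  lower x T z hz := by
    obtain ⟨S, hS⟩ := P.lower x.1 T z.1 hz
    exact ⟨S, Subtype.ext hS⟩
  adj x S c hc := Subtype.ext (P.adj x.1 S c hc)
  chamber_inj x y S hS h := Subtype.ext (P.chamber_inj _ _ S hS (congrArg Subtype.val h))
  facet_inj x y S c hS h :=
    (P.facet_inj _ _ S c hS (congrArg Subtype.val h)).imp Subtype.ext Subtype.ext
  sign x S b := P.sign x.1 S b
  vertexColor x S b := P.vertexColor x.1 S b
  facetColor x S b := P.facetColor x.1 S b
  plusLabel x S a := (P.plusLabel x.1 S a).trans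
    (and_congr_right fun _ => (Subtype.ext_iff (a1 := x) (a2 := D.trim.plus a)).symm)
  minusLabel x S a := (P.minusLabel x.1 S a).trans
    (and_congr_right fun _ => (Subtype.ext_iff (a1 := x) (a2 := D.trim.minus a)).symm)

theorem trim_faithful (hP : P.Faithful) : (P.trim hP).Faithful := by
  intro x y S h
  have h' : P.toFun x.1 S = P.toFun y.1 S := congrArg Subtype.val h
  exact (D.trimEmbedding.conn_iff S.1 x y).1 (hP x.1 y.1 S h')

/-- Complexes that differ by bare double-chambers are isomorphic after their removal. -/
theorem nonempty_trim_iso {Y : Decorated n A B} {E : Gem n A B} (hP : P.Faithful)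
    (Q : Presentation Y E) (hQ : Q.Faithful) (φ : Gem.Embedding D E)
    (hφ : ∀ y, y ∈ Set.range φ.toFun ∨ E.Bare y) : Nonempty (Decorated.Iso X.trim Y.trim) :=
  ⟨(P.trim hP).iso (P.trim_faithful hP) (Q.trim hQ) (Q.trim_faithful hQ) φ.trim
    (φ.trim_surjective hφ)⟩

end Trim

end Presentation

namespace Presentation

variable {n : ℕ} {A B : Type} {X : Decorated n A B} {D : Gem n A B}

theorem lt_cofull_of_card [NeZero n] {S : ColorSet n} {c : Fin (n + 1)} (hc : c ∉ S.1)
    (hS : S.1.card < n) : S < cofull c := by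
  refine lt_of_le_of_ne ?_ fun h => ?_
  · change S.1 ⊆ {c}ᶜ
    rwa [Finset.subset_compl_comm, Finset.singleton_subset_iff, Finset.mem_compl]
  · rw [h, cofull, Finset.card_compl, Fintype.card_fin, Finset.card_singleton] at hS
    omega

/-! ### Presented complexes are pseudobordisms -/

theorem isLabeled (P : Presentation X D) : X.IsLabeled where
  plus_chamber C a h := by
    obtain ⟨x, S, rfl⟩ := P.surj C
    obtain ⟨h1, rfl⟩ := (P.plusLabel _ _ _).1 h
    exact (P.sign _ _ _).2 ⟨h1, D.sign_plus a⟩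
  plus_unique a := by
    refine ⟨P.toFun (D.plus a) (full n), (P.plusLabel _ _ _).2 ⟨rfl, rfl⟩, fun C h => ?_⟩
    obtain ⟨x, S, rfl⟩ := P.surj C
    obtain ⟨h1, rfl⟩ := (P.plusLabel _ _ _).1 h
    rw [show S = full n from Subtype.ext h1]
  plus_injective C a a' h h' := by
    obtain ⟨x, S, rfl⟩ := P.surj C
    exact D.plus_injective
      (((P.plusLabel _ _ _).1 h).2.symm.trans ((P.plusLabel _ _ _).1 h').2)
  minus_chamber C a h := by
    obtain ⟨x, S, rfl⟩ := P.surj C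
    obtain ⟨h1, rfl⟩ := (P.minusLabel _ _ _).1 h
    exact (P.sign _ _ _).2 ⟨h1, D.sign_minus a⟩
  minus_unique a := by
    refine ⟨P.toFun (D.minus a) (full n), (P.minusLabel _ _ _).2 ⟨rfl, rfl⟩, fun C h => ?_⟩
    obtain ⟨x, S, rfl⟩ := P.surj C
    obtain ⟨h1, rfl⟩ := (P.minusLabel _ _ _).1 h
    rw [show S = full n from Subtype.ext h1]
  minus_injective C a a' h h' := by
    obtain ⟨x, S, rfl⟩ := P.surj C
    exact D.minus_injective
      (((P.minusLabel _ _ _).1 h).2.symm.trans ((P.minusLabel _ _ _).1 h').2)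

theorem finite_chamber (P : Presentation X D) (hX : X.IsPseudobordism) : Finite D.Chamber := by
  have := hX.finite
  exact Finite.of_injective (fun x => P.toFun x (full n)) fun _ _ h => P.full_injective h

section IsPseudobordism

variable [NeZero n] (P : Presentation X D)

include P

theorem isPseudomanifold : IsPseudomanifold X.Cell n where
  complex z := by
    obtain ⟨x, S, rfl⟩ := P.surj z
    have := S.2.card_pos
    exact ⟨S.1.card - 1, (P.isFace_iff _ _).2 (by omega)⟩
  pure z := by
    obtain ⟨x, S, rfl⟩ := P.surj z
    exact ⟨P.toFun x (full n), P.isChamber_full x, (P.le_iff _ _ _).2 (le_full S)⟩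
  two_chambers F hF := by
    obtain ⟨x, S, rfl⟩ := P.surj F
    obtain ⟨c, rfl⟩ := (P.isFacet_iff _ _).1 hF
    have h : {C : X.Cell | IsFace n C ∧ P.toFun x (cofull c) ≤ C} =
        {P.toFun x (full n), P.toFun (D.adj c x) (full n)} := by
      ext C
      constructor
      · rintro ⟨h1, h2⟩
        obtain ⟨y, rfl⟩ := P.exists_of_isChamber h1
        rcases P.cofull_le_full.1 h2 with rfl | rfl
        · exact Or.inl rfl
        · exact Or.inr rfl
      · rintro (rfl | rfl)
        · exact ⟨P.isChamber_full _, P.cofull_le_full.2 (Or.inl rfl)⟩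
        · exact ⟨P.isChamber_full _, P.cofull_le_full.2 (Or.inr rfl)⟩
    rw [h, Set.ncard_pair]
    intro h1
    exact D.adj_ne c x (P.full_injective h1).symm

/-- Every face above the given one lies in a chamber reachable from `x` by crossing walls that
contain the given face. In codimension at least two these walls are strictly larger than the face,
so they are points of the link and yield a chain there. -/
theorem isNormal (hP : P.Faithful) : IsNormal X.Cell n := by
  intro k z hk hz
  obtain ⟨x, S, rfl⟩ := P.surj z
  rw [P.isFace_iff] at hz
  have hS : S < full n := by
    refine lt_of_le_of_ne (le_full S) fun h => ?_
    rw [h, full, Finset.card_univ, Fintype.card_fin] at hz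
    omega
  have hlt : ∀ y, D.Conn S.1 x y → ∀ T, S < T → P.toFun x S < P.toFun y T := fun y hy T hT =>
    (P.lt_iff_exists _ _ _ _).2 ⟨hT, P.eq_of_conn hy⟩
  refine ⟨⟨⟨_, hlt x (Gem.Conn.refl x) _ hS⟩⟩, ?_⟩
  let r : {y : X.Cell // P.toFun x S < y} → {y : X.Cell // P.toFun x S < y} → Prop :=
    fun a b => a ≤ b ∨ b ≤ a
  have hsymm : ∀ a b, Relation.ReflTransGen r a b → Relation.ReflTransGen r b a := by
    intro a b h
    induction h with
    | refl => exact Relation.ReflTransGen.refl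
    | tail _ h ih => exact Relation.ReflTransGen.head h.symm ih
  have hchamber : ∀ y (hy : D.Conn S.1 x y), Relation.ReflTransGen r
      ⟨_, hlt x (Gem.Conn.refl x) _ hS⟩ ⟨_, hlt y hy _ hS⟩ := by
    intro y hy
    refine (Gem.Conn.induction (p := fun y => ∃ hy : D.Conn S.1 x y, Relation.ReflTransGen r
      ⟨_, hlt x (Gem.Conn.refl x) _ hS⟩ ⟨_, hlt y hy _ hS⟩) ?_ hy
      ⟨Gem.Conn.refl x, Relation.ReflTransGen.refl⟩).2
    rintro y c hc ⟨hy, h⟩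
    have hc' : S < cofull c := lt_cofull_of_card hc (by omega)
    have hy' := hy.trans (Gem.conn_adj hc y)
    have h1 : Relation.ReflTransGen r ⟨_, hlt x (Gem.Conn.refl x) _ hS⟩ ⟨_, hlt y hy _ hc'⟩ :=
      h.tail (Or.inr (P.cofull_le_full.2 (Or.inl rfl)))
    exact ⟨hy', h1.tail (Or.inl (P.cofull_le_full.2 (Or.inr rfl)))⟩
  have hall : ∀ a, Relation.ReflTransGen r ⟨_, hlt x (Gem.Conn.refl x) _ hS⟩ a := by
    rintro ⟨w, hw⟩
    obtain ⟨y, T, rfl⟩ := P.surj w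
    have h1 := (P.lt_iff_exists _ _ _ _).1 hw
    exact (hchamber y (hP _ _ _ h1.2)).tail (Or.inr ((P.le_iff _ _ _).2 (le_full T)))
  intro a b
  exact (hsymm _ _ (hall a)).trans (hall b)

theorem isColored : X.IsColored where
  sign_chamber C b h := by
    obtain ⟨x, S, rfl⟩ := P.surj C
    rw [P.isChamber_iff]
    exact Subtype.ext ((P.sign _ _ _).1 h).1
  sign_unique C h := by
    obtain ⟨x, rfl⟩ := P.exists_of_isChamber h
    exact ⟨D.sign x, (P.sign _ _ _).2 ⟨rfl, rfl⟩, fun b hb => ((P.sign _ _ _).1 hb).2.symm⟩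
  sign_adjacent C C' F hC hC' hF h h' hne b hb := by
    obtain ⟨x, rfl⟩ := P.exists_of_isChamber hC
    obtain ⟨y, rfl⟩ := P.exists_of_isChamber hC'
    obtain ⟨S, rfl⟩ := P.lower _ _ _ h
    obtain ⟨c, rfl⟩ := (P.isFacet_iff _ _).1 hF
    rcases P.cofull_le_full.1 h' with rfl | rfl
    · exact absurd rfl hne
    · rw [P.sign] at hb ⊢
      exact ⟨rfl, by rw [D.sign_adj, hb.2]⟩
  vertex_vertex z c h := by
    obtain ⟨x, S, rfl⟩ := P.surj z
    exact (P.isVertex_iff _ _).2 ⟨c, Subtype.ext ((P.vertexColor _ _ _).1 h)⟩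
  vertex_unique z h := by
    obtain ⟨x, S, rfl⟩ := P.surj z
    obtain ⟨c, rfl⟩ := (P.isVertex_iff _ _).1 h
    exact ⟨c, (P.vertexColor _ _ _).2 rfl,
      fun d hd => (Finset.singleton_injective ((P.vertexColor _ _ _).1 hd)).symm⟩
  vertex_injective C z w hC hz hw c hzc hwc := by
    obtain ⟨x, rfl⟩ := P.exists_of_isChamber hC
    obtain ⟨S, rfl⟩ := P.lower _ _ _ hz
    obtain ⟨T, rfl⟩ := P.lower _ _ _ hw
    rw [P.vertexColor] at hzc hwc
    rw [Subtype.ext (hzc.trans hwc.symm)]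
  facet_facet z c h := by
    obtain ⟨x, S, rfl⟩ := P.surj z
    exact (P.isFacet_iff _ _).2 ⟨c, Subtype.ext ((P.facetColor _ _ _).1 h)⟩
  facet_unique z h := by
    obtain ⟨x, S, rfl⟩ := P.surj z
    obtain ⟨c, rfl⟩ := (P.isFacet_iff _ _).1 h
    exact ⟨c, (P.facetColor _ _ _).2 rfl, fun d hd =>
      (Finset.singleton_injective (compl_injective ((P.facetColor _ _ _).1 hd))).symm⟩
  facet_injective C z w hC hz hw c hzc hwc := by
    obtain ⟨x, rfl⟩ := P.exists_of_isChamber hC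
    obtain ⟨S, rfl⟩ := P.lower _ _ _ hz
    obtain ⟨T, rfl⟩ := P.lower _ _ _ hw
    rw [P.facetColor] at hzc hwc
    rw [Subtype.ext (hzc.trans hwc.symm)]
  facet_opposite C F v hC hF hv hFC hvC hvF c := by
    obtain ⟨x, rfl⟩ := P.exists_of_isChamber hC
    obtain ⟨S, rfl⟩ := P.lower _ _ _ hFC
    obtain ⟨T, rfl⟩ := P.lower _ _ _ hvC
    obtain ⟨d, rfl⟩ := (P.isFacet_iff _ _).1 hF
    obtain ⟨e, rfl⟩ := (P.isVertex_iff _ _).1 hv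
    have hde : e = d := by
      by_contra h
      refine hvF ((P.le_iff _ _ _).2 ?_)
      change ({e} : Finset (Fin (n + 1))) ⊆ {d}ᶜ
      -- The vertex of color `e` avoids the facet missing `d` only if `e = d`.
      simpa using Ne.symm h
    rw [P.facetColor, P.vertexColor, hde]
    change ({d} : Finset (Fin (n + 1)))ᶜ = {c}ᶜ ↔ ({d} : Finset (Fin (n + 1))) = {c}
    rw [compl_inj_iff]

theorem isPseudobordism (hP : P.Faithful) [Finite D.Chamber] (hD : ∀ x, ¬ D.Bare x) :
    X.IsPseudobordism where
  finite := by
    refine Finite.of_surjective (fun p : D.Chamber × ColorSet n => P.toFun p.1 p.2) fun z => ?_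
    obtain ⟨x, S, h⟩ := P.surj z
    exact ⟨(x, S), h⟩
  pseudomanifold := P.isPseudomanifold
  normal := P.isNormal hP
  colored := P.isColored
  labeled := P.isLabeled
  no_bare C C' h := by
    obtain ⟨x, rfl⟩ := P.exists_of_isChamber h.1.1
    obtain ⟨y, rfl⟩ := P.exists_of_isChamber h.1.2.1
    exact hD x ((P.isBareDoubleChamber_iff hP x y).1 h).1

theorem not_bare (hP : P.Faithful) (hX : X.IsPseudobordism) (x : D.Chamber) : ¬ D.Bare x := by
  intro h
  obtain ⟨y, hy⟩ := id h
  exact hX.no_bare _ _ ((P.isBareDoubleChamber_iff hP x y).2 ⟨h, hy.1⟩)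

/-! ### Pseudobordisms are presented complexes -/

/-- Induction on codimension. Chambers and walls are covered by the definition of a presentation. In
codimension at least two, a chain in the link joins the two chambers: at each face of the chain, the
chambers containing it are joined by the induction hypothesis, through colors missing from a larger
set. -/
theorem faithful_of_isNormal (hX : IsNormal X.Cell n) : P.Faithful := by
  have key : ∀ m (S : ColorSet n), n + 1 ≤ S.1.card + m → ∀ x y, P.toFun x S = P.toFun y S →
      D.Conn S.1 x y := by
    intro m
    induction m with
    | zero =>
      intro S hS x y h
      have h1 : S.1 = Finset.univ := by
        rw [← Finset.card_eq_iff_eq_univ, Fintype.card_fin]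
        exact le_antisymm (by simpa using S.1.card_le_univ) hS
      rw [P.chamber_inj x y S h1 h]
      exact Gem.Conn.refl y
    | succ m ih =>
      intro S hS x y h
      by_cases hk : S.1.card + 1 ≤ n
      · have hpos := S.2.card_pos
        have hfull : S < full n := by
          refine lt_of_le_of_ne (le_full S) fun h => ?_
          rw [h, full, Finset.card_univ, Fintype.card_fin] at hk
          omega
        have hlink := (hX (S.1.card - 1) (P.toFun x S) (by omega)
          ((P.isFace_iff _ _).2 (by omega))).2
        have hup : ∀ b, P.toFun x S < b → ∀ w w', b ≤ P.toFun w (full n) →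
            b ≤ P.toFun w' (full n) → D.Conn S.1 w w' := by
          intro b hb w w' hw hw'
          obtain ⟨U, rfl⟩ := P.lower _ _ _ hw
          have hSU := ((P.lt_iff_exists _ _ _ _).1 hb).1
          have hcard : S.1.card < U.1.card := Finset.card_lt_card hSU
          exact (ih U (by omega) w w' ((P.le_iff_exists _ _ _ _).1 hw').2).mono hSU.le
        -- The statement carried along the chain concerns all chambers over the current face. Going
        -- up shrinks this set of chambers; going down requires `hup` at the new face.
        have hchain : ∀ b : {y : X.Cell // P.toFun x S < y},
            ∀ w, b.1 ≤ P.toFun w (full n) → D.Conn S.1 x w := by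
          intro b
          have hb := hlink ⟨P.toFun x (full n), (P.lt_iff_exists _ _ _ _).2 ⟨hfull, rfl⟩⟩ b
          induction hb with
          | refl =>
            intro w hw
            rw [P.full_injective ((P.le_iff_exists _ _ _ _).1 hw).2]
            exact Gem.Conn.refl w
          | @tail b b' _ hbb ih' =>
            intro w' hw'
            rcases hbb with hbb | hbb
            · exact ih' w' (le_trans hbb hw')
            · obtain ⟨w, U, hw⟩ := P.surj b.1
              have hw2 : b.1 ≤ P.toFun w (full n) := by
                rw [← hw, P.le_iff]
                exact le_full U
              exact (ih' w hw2).trans (hup b'.1 b'.2 w w' (le_trans hbb hw2) hw')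
        exact hchain ⟨P.toFun y (full n), (P.lt_iff_exists _ _ _ _).2 ⟨hfull, h⟩⟩ y le_rfl
      · by_cases hk' : S.1.card = n
        · obtain ⟨c, rfl⟩ := (P.isFacet_iff x S).1 ((P.isFace_iff _ _).2
            (by have := NeZero.pos n; omega))
          rcases P.cofull_eq_iff.1 h with rfl | rfl
          · exact Gem.Conn.refl _
          · exact Gem.conn_adj (by simp [cofull]) x
        · exact ih S (by omega) x y h
  exact fun x y S => key (n + 1) S (by omega) x y

end IsPseudobordism

/-- The faces of a chamber are numbered by their sets of colors. -/
theorem exists_colored_simplex (hX : X.IsColored) {C : X.Cell} (hC : IsFace n C) :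
    ∃ f : ColorSet n → X.Cell, (∀ S T, f S ≤ f T ↔ S ≤ T) ∧ (∀ T z, z ≤ f T → ∃ S, f S = z) ∧
      f (full n) = C ∧ ∀ c, X.HasVertexColor (f (single c)) c := by
  obtain ⟨e⟩ := id hC
  change Set.Iic C ≃o ColorSet n at e
  have hle : ∀ S T, (e.symm S).1 ≤ (e.symm T).1 ↔ S ≤ T := fun S T => e.symm.le_iff_le
  have hlow : ∀ z, z ≤ C → ∃ S, (e.symm S).1 = z := fun z hz => ⟨e ⟨z, hz⟩, by simp⟩
  have hlower : ∀ T z, z ≤ (e.symm T).1 → ∃ S, (e.symm S).1 = z :=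
    fun T z hz => hlow z (hz.trans (e.symm T).2)
  have htop : (e.symm (full n)).1 = C := by
    have h : e ⟨C, le_rfl⟩ = full n :=
      le_antisymm (le_full _) ((e.symm_apply_le).1 (e.symm (full n)).2)
    rw [← h, OrderIso.symm_apply_apply]
  have hv : ∀ i : Fin (n + 1), ∃! c, X.HasVertexColor (e.symm (single i)).1 c := by
    intro i
    refine hX.vertex_unique _ ?_
    have h := isFace_iff_card (k := 0) (f := fun S => (e.symm S).1) hle hlower (single i)
    exact h.2 (Finset.card_singleton i)
  choose κ hκ _ using hv
  have hinj : Function.Injective κ := by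
    intro i j hij
    have h := hX.vertex_injective C _ _ hC (e.symm (single i)).2 (e.symm (single j)).2 (κ i)
      (hκ i) (hij ▸ hκ j)
    have h1 := e.symm.injective (Subtype.ext h)
    exact Finset.singleton_injective (congrArg Subtype.val h1)
  -- Vertices of a chamber have distinct colors, so the coloring permutes the `n + 1` indices; it is
  -- used to rename vertices by their colors.
  let π : Equiv.Perm (Fin (n + 1)) := Equiv.ofBijective κ (Finite.injective_iff_bijective.1 hinj)
  have hπ : ∀ c, κ (π.symm c) = c := fun c => π.apply_symm_apply c
  refine ⟨fun S => (e.symm ⟨S.1.map π.symm.toEmbedding, S.2.map⟩).1, fun S T => ?_,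
    fun T z hz => ?_, ?_, fun c => ?_⟩
  · exact (hle _ _).trans Finset.map_subset_map
  · obtain ⟨S, rfl⟩ := hlower _ _ hz
    refine ⟨⟨S.1.map π.toEmbedding, S.2.map⟩, congrArg (fun S => (e.symm S).1) ?_⟩
    apply Subtype.ext
    ext i
    simp
  · have : (⟨(full n).1.map π.symm.toEmbedding, (full n).2.map⟩ : ColorSet n) = full n :=
      Subtype.ext (by simp [full])
    exact (congrArg (fun S => (e.symm S).1) this).trans htop
  · have : (⟨(single c).1.map π.symm.toEmbedding, (single c).2.map⟩ : ColorSet n) =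
      single (π.symm c) := Subtype.ext (by simp [single])
    have h := hκ (π.symm c)
    rw [hπ, ← this] at h
    exact h

/-- The chambers of the gem are those of `X`, and `adj c` is the other chamber at the wall opposite
to the vertex of color `c`. All identifications of faces are controlled by the fact that the color
set of a face does not depend on the chamber. -/
theorem exists_presentation [NeZero n] (hM : IsPseudomanifold X.Cell n) (hX : X.IsColored)
    (hL : X.IsLabeled) : ∃ D : Gem n A B, Nonempty (Presentation X D) := by
  have hf := fun C : {C : X.Cell // IsFace n C} => exists_colored_simplex hX C.2
  choose f hle hlower htop hcol using hf
  have hface : ∀ C k T, IsFace k (f C T) ↔ T.1.card = k + 1 := fun C k T =>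
    isFace_iff_card (hle C) (hlower C) T
  have hlow : ∀ (C : {C : X.Cell // IsFace n C}) z, z ≤ C.1 → ∃ S, f C S = z := fun C z hz =>
    hlower C (full n) z ((htop C).symm ▸ hz)
  have hfle : ∀ C S, f C S ≤ C.1 := fun C S => by
    conv_rhs => rw [← htop C]
    exact (hle C _ _).2 (le_full S)
  have hvert : ∀ C S c, X.HasVertexColor (f C S) c ↔ S.1 = {c} := by
    intro C S c
    constructor
    · intro h
      have h1 := (hface C 0 S).1 (hX.vertex_vertex _ _ h)
      obtain ⟨d, hd⟩ := Finset.card_eq_one.1 h1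
      obtain rfl : S = single d := Subtype.ext hd
      rw [(hX.vertex_unique _ (hX.vertex_vertex _ _ h)).unique h (hcol C d)]
      rfl
    · intro h
      obtain rfl : S = single c := Subtype.ext h
      exact hcol C c
  have hcof : ∀ C (S : ColorSet n), IsFace (n - 1) (f C S) ↔ ∃ c, S = cofull c := by
    intro C S
    have hn := NeZero.pos n
    rw [hface]
    constructor
    · intro h
      have h1 : (S.1ᶜ).card = 1 := by
        rw [Finset.card_compl, Fintype.card_fin]
        omega
      obtain ⟨c, hc⟩ := Finset.card_eq_one.1 h1
      exact ⟨c, Subtype.ext (compl_eq_comm.1 hc).symm⟩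
    · rintro ⟨c, rfl⟩
      rw [cofull, Finset.card_compl, Fintype.card_fin, Finset.card_singleton]
      omega
  have hopp : ∀ C d c, X.HasFacetColor (f C (cofull d)) c ↔ d = c := by
    intro C d c
    rw [hX.facet_opposite C.1 _ (f C (single d)) C.2 ((hcof _ _).2 ⟨d, rfl⟩)
      ((hface _ _ _).2 (Finset.card_singleton d)) (hfle _ _) (hfle _ _), hvert]
    · exact Finset.singleton_inj
    · rw [hle]
      intro h
      have : d ∈ (cofull d).1 := h (Finset.mem_singleton_self d)
      simp [cofull] at this
  have hfacet : ∀ C S c, X.HasFacetColor (f C S) c ↔ S.1 = {c}ᶜ := by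
    intro C S c
    constructor
    · intro h
      obtain ⟨d, rfl⟩ := (hcof C S).1 (hX.facet_facet _ _ h)
      rw [hopp] at h
      rw [h]
      rfl
    · intro h
      obtain rfl : S = cofull c := Subtype.ext h
      exact (hopp C c c).2 rfl
  have hmem : ∀ C (S : ColorSet n) c, c ∈ S.1 ↔ ∃ v, v ≤ f C S ∧ X.HasVertexColor v c := by
    intro C S c
    constructor
    · intro h
      exact ⟨_, (hle C _ _).2 (Finset.singleton_subset_iff.2 h), hcol C c⟩
    · rintro ⟨v, hv, h⟩
      obtain ⟨T, rfl⟩ := hlower _ _ _ hv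
      rw [hvert] at h
      rw [hle] at hv
      exact hv (h ▸ Finset.mem_singleton_self c)
  have hcolors : ∀ C C' S T, f C S = f C' T → S = T := by
    intro C C' S T h
    apply Subtype.ext
    ext c
    rw [hmem C, hmem C', h]
  -- A face of `C` lying in `C'` is some face of `C'`, and equality of color sets shows which one.
  have hmove : ∀ C S (C' : {C : X.Cell // IsFace n C}), f C S ≤ C'.1 → f C' S = f C S := by
    intro C S C' h
    obtain ⟨T, hT⟩ := hlow C' _ h
    rw [hcolors _ _ _ _ hT] at hT
    exact hT
  have hadj : ∀ c (C : {C : X.Cell // IsFace n C}), ∃ C' : {C : X.Cell // IsFace n C},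
      C' ≠ C ∧ ∀ K : {C : X.Cell // IsFace n C}, f C (cofull c) ≤ K.1 ↔ K = C ∨ K = C' := by
    intro c C
    obtain ⟨K, L, hKL, h⟩ := Set.ncard_eq_two.1
      (hM.two_chambers (f C (cofull c)) ((hcof _ _).2 ⟨c, rfl⟩))
    have hK : K ∈ ({K, L} : Set X.Cell) := Or.inl rfl
    have hL : L ∈ ({K, L} : Set X.Cell) := Or.inr rfl
    have hCm : C.1 ∈ ({K, L} : Set X.Cell) := h ▸ ⟨C.2, hfle _ _⟩
    rw [← h] at hK hL
    have hall : ∀ M : {C : X.Cell // IsFace n C}, f C (cofull c) ≤ M.1 ↔ M.1 = K ∨ M.1 = L := by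
      intro M
      constructor
      · intro hM
        have : M.1 ∈ ({K, L} : Set X.Cell) := h ▸ ⟨M.2, hM⟩
        exact this
      · rintro (hM | hM)
        · exact hM ▸ hK.2
        · exact hM ▸ hL.2
    rcases hCm with hCK | hCL
    · refine ⟨⟨L, hL.1⟩, fun h => hKL (hCK.symm.trans (congrArg Subtype.val h).symm), fun M => ?_⟩
      rw [hall, Subtype.ext_iff, Subtype.ext_iff, hCK]
    · refine ⟨⟨K, hK.1⟩, fun h => hKL ((congrArg Subtype.val h).trans hCL), fun M => ?_⟩
      rw [hall, Subtype.ext_iff, Subtype.ext_iff, hCL, or_comm]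
  choose adj hne hadj using hadj
  have hadjf : ∀ c C, f (adj c C) (cofull c) = f C (cofull c) := fun c C =>
    hmove _ _ _ ((hadj c C _).2 (Or.inr rfl))
  have hadj2 : ∀ c C, adj c (adj c C) = C := by
    intro c C
    have h := (hadj c C (adj c (adj c C))).1
      (hadjf c C ▸ (hadj c (adj c C) _).2 (Or.inr rfl))
    exact h.resolve_right (hne c _)
  have hsign := fun C : {C : X.Cell // IsFace n C} => hX.sign_unique C.1 C.2
  choose s hs hs' using hsign
  choose p hp hp' using hL.plus_unique
  choose q hq hq' using hL.minus_unique
  have hpC : ∀ a, IsFace n (p a) := fun a => hX.sign_chamber _ _ (hL.plus_chamber _ _ (hp a))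
  have hqC : ∀ a, IsFace n (q a) := fun a => hX.sign_chamber _ _ (hL.minus_chamber _ _ (hq a))
  let D : Gem n A B :=
    { Chamber := {C : X.Cell // IsFace n C}
      sign := s
      adj := adj
      adj_adj := hadj2
      sign_adj := fun c C => by
        refine (hs' (adj c C) _ (hX.sign_adjacent C.1 (adj c C).1 (f C (cofull c)) C.2 (adj c C).2
          ((hcof _ _).2 ⟨c, rfl⟩) (hfle _ _) ((hadj c C _).2 (Or.inr rfl)) ?_ _ (hs C))).symm
        exact fun h => hne c C (Subtype.ext h).symm
      plus := fun a => ⟨p a, hpC a⟩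
      plus_injective := fun a a' h => by
        have h' : p a = p a' := congrArg Subtype.val h
        exact hL.plus_injective (p a) a a' (hp a) (h' ▸ hp a')
      sign_plus := fun a => (hs' _ _ (hL.plus_chamber _ _ (hp a))).symm
      minus := fun a => ⟨q a, hqC a⟩
      minus_injective := fun a a' h => by
        have h' : q a = q a' := congrArg Subtype.val h
        exact hL.minus_injective (q a) a a' (hq a) (h' ▸ hq a')
      sign_minus := fun a => (hs' _ _ (hL.minus_chamber _ _ (hq a))).symm }
  have huniv : ∀ C S, IsFace n (f C S) ↔ S.1 = Finset.univ := by
    intro C S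
    have h := Finset.card_eq_iff_eq_univ S.1
    rw [Fintype.card_fin] at h
    exact (hface C n S).trans h
  have hfulls : ∀ C (S : ColorSet n), S.1 = Finset.univ → f C S = C.1 := by
    intro C S hS
    obtain rfl : S = full n := Subtype.ext hS
    exact htop C
  refine ⟨D, ⟨{
    toFun := f
    surj := ?_
    le_iff := hle
    lower := hlower
    adj := ?_
    chamber_inj := ?_
    facet_inj := ?_
    sign := ?_
    vertexColor := hvert
    facetColor := hfacet
    plusLabel := ?_
    minusLabel := ?_ }⟩⟩
  · intro z
    obtain ⟨C, hC, hz⟩ := hM.pure z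
    obtain ⟨S, hS⟩ := hlow ⟨C, hC⟩ z hz
    exact ⟨_, S, hS⟩
  · intro C S c hc
    refine hmove C S _ (le_trans ?_ ((hadj c C _).2 (Or.inr rfl)))
    rw [hle]
    change S.1 ⊆ {c}ᶜ
    rwa [Finset.subset_compl_comm, Finset.singleton_subset_iff, Finset.mem_compl]
  · intro C C' S hS h
    rw [hfulls _ _ hS, hfulls _ _ hS] at h
    exact Subtype.ext h
  · intro C C' S c hS h
    obtain rfl : S = cofull c := Subtype.ext hS
    exact (hadj c C C').1 (h ▸ hfle _ _)
  · intro C S b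
    constructor
    · intro h
      have h1 := (huniv _ _).1 (hX.sign_chamber _ _ h)
      rw [hfulls _ _ h1] at h
      exact ⟨h1, (hs' _ _ h).symm⟩
    · rintro ⟨h, rfl⟩
      rw [hfulls _ _ h]
      exact hs C
  · intro C S a
    constructor
    · intro h
      have h1 := (huniv _ _).1 (hX.sign_chamber _ _ (hL.plus_chamber _ _ h))
      rw [hfulls _ _ h1] at h
      exact ⟨h1, Subtype.ext (hp' _ _ h)⟩
    · rintro ⟨h, rfl⟩
      rw [hfulls _ _ h]
      exact hp a
  · intro C S a
    constructor
    · intro h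
      have h1 := (huniv _ _).1 (hX.sign_chamber _ _ (hL.minus_chamber _ _ h))
      rw [hfulls _ _ h1] at h
      exact ⟨h1, Subtype.ext (hq' _ _ h)⟩
    · rintro ⟨h, rfl⟩
      rw [hfulls _ _ h]
      exact hq a

end Presentation

variable {n : ℕ}

/-! ### Finitely supported permutations -/

/-- `σ` fixes the first `N` points. -/
def Fixes (N : ℕ) (σ : SInf) : Prop := ∀ i < N, σ.1 i = i

/-- `σ` moves only some of the first `N` points. -/
def SupportedBelow (N : ℕ) (σ : SInf) : Prop := ∀ i, N ≤ i → σ.1 i = i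

theorem SupportedBelow.mono {N M : ℕ} {σ : SInf} (h : SupportedBelow N σ) (hNM : N ≤ M) :
    SupportedBelow M σ := fun i hi => h i (hNM.trans hi)

theorem Fixes.mono {N M : ℕ} {σ : SInf} (h : Fixes N σ) (hNM : M ≤ N) : Fixes M σ :=
  fun i hi => h i (hi.trans_le hNM)

theorem Fixes.one (N : ℕ) : Fixes N 1 := fun _ _ => rfl

theorem Fixes.mul {N : ℕ} {σ τ : SInf} (hσ : Fixes N σ) (hτ : Fixes N τ) : Fixes N (σ * τ) := by
  intro i hi
  change σ.1 (τ.1 i) = i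
  rw [hτ i hi, hσ i hi]

theorem SupportedBelow.mul {N : ℕ} {σ τ : SInf} (hσ : SupportedBelow N σ)
    (hτ : SupportedBelow N τ) : SupportedBelow N (σ * τ) := by
  intro i hi
  change σ.1 (τ.1 i) = i
  rw [hτ i hi, hσ i hi]

theorem Fixes.inv {N : ℕ} {σ : SInf} (hσ : Fixes N σ) : Fixes N σ⁻¹ := by
  intro i hi
  change σ.1.symm i = i
  rw [Equiv.symm_apply_eq, hσ i hi]

theorem SupportedBelow.lt {N : ℕ} {σ : SInf} (hσ : SupportedBelow N σ) {i : ℕ} (hi : i < N) :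
    σ.1 i < N := by
  by_contra h
  have h1 := σ.1.injective (hσ _ (not_lt.1 h))
  omega

theorem Fixes.le {N : ℕ} {σ : SInf} (hσ : Fixes N σ) {i : ℕ} (hi : N ≤ i) : N ≤ σ.1 i := by
  by_contra h
  have h1 := σ.1.injective (hσ _ (not_le.1 h))
  omega

theorem SupportedBelow.commute {N : ℕ} {σ τ : SInf} (hσ : SupportedBelow N σ) (hτ : Fixes N τ) :
    σ * τ = τ * σ := by
  apply Subtype.ext
  ext i
  change σ.1 (τ.1 i) = τ.1 (σ.1 i)
  rcases lt_or_ge i N with h | h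
  · rw [hτ i h, hτ _ (hσ.lt h)]
  · rw [hσ i h, hσ _ (hτ.le h)]

theorem exists_supportedBelow (σ : SInf) : ∃ N, SupportedBelow N σ := by
  obtain ⟨N, hN⟩ := σ.2.bddAbove
  refine ⟨N + 1, fun i hi => ?_⟩
  by_contra h
  have := hN h
  omega

theorem exists_forall_supportedBelow (g : G n) : ∃ N, ∀ c, SupportedBelow N (g c) := by
  choose N hN using fun c => exists_supportedBelow (g c)
  exact ⟨Finset.univ.sup N, fun c => (hN c).mono (Finset.le_sup (Finset.mem_univ c))⟩

theorem supportedBelow_theta (β j : ℕ) : SupportedBelow (β + 2 * j) (theta β j) := by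
  intro i hi
  change thetaFun β j i = i
  unfold thetaFun
  split_ifs <;> omega

/-- Extension of an injective map of a finite set to a finitely supported permutation. -/
theorem exists_sInf_extending (s : Finset ℕ) (f : ℕ → ℕ) (hf : Set.InjOn f s) :
    ∃ σ : SInf, ∀ x ∈ s, σ.1 x = f x := by
  induction s using Finset.induction_on with
  | empty => exact ⟨1, by simp⟩
  | insert a s ha ih =>
    obtain ⟨σ, hσ⟩ := ih (hf.mono (by simp))
    -- This transposition corrects the value at `a`. It leaves the values on `s` alone, by
    -- injectivity of `σ` and of `f`.
    have hswap : Equiv.swap (σ.1 a) (f a) ∈ SInf := by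
      refine Set.Finite.subset (Set.toFinite {σ.1 a, f a}) fun x hx => ?_
      by_contra h
      simp only [Set.mem_insert_iff, Set.mem_singleton_iff, not_or] at h
      exact hx (Equiv.swap_apply_of_ne_of_ne h.1 h.2)
    refine ⟨⟨_, hswap⟩ * σ, fun x hx => ?_⟩
    change Equiv.swap (σ.1 a) (f a) (σ.1 x) = f x
    rcases Finset.mem_insert.1 hx with rfl | hx
    · exact Equiv.swap_apply_left _ _
    · have hne : x ≠ a := fun h => ha (h ▸ hx)
      rw [Equiv.swap_apply_of_ne_of_ne (fun h => hne (σ.1.injective h)), hσ x hx]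
      rw [hσ x hx]
      exact fun h => hne (hf (by simp [hx]) (by simp) h)

/-- The permutation fixes the first `β` points and moves the points `i < M` with `i ≥ β` to points
that are not less than `N`. -/
structure Separates (β N M : ℕ) (θ : SInf) : Prop where
  fixes : Fixes β θ
  le : ∀ i, β ≤ i → i < M → N ≤ θ.1 i

/-- The condition `M ≤ j` puts every relevant point into the first block, which moves up by `j ≥ N`.
-/
theorem separates_theta {β N M j : ℕ} (hN : N ≤ j) (hM : M ≤ j) :
    Separates β N M (theta β j) := by
  constructor
  · intro i hi
    change thetaFun β j i = i
    unfold thetaFun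
    split_ifs <;> omega
  · intro i hi hiM
    change N ≤ thetaFun β j i
    unfold thetaFun
    split_ifs <;> omega

/-- On points below `M`, `θ` and `θ'` agree below `β` and send the others beyond `N`; a correction
`τ` acting beyond `N` can therefore carry one set of images to the other. What remains is absorbed
by `ρ`. -/
theorem Separates.exists_eq {β N M : ℕ} {θ θ' : SInf} (hθ : Separates β N M θ)
    (hθ' : Separates β N M θ') (hβ : β ≤ N) :
    ∃ τ ρ : SInf, Fixes N τ ∧ Fixes M ρ ∧ θ' = τ * θ * ρ := by
  obtain ⟨τ, hτ⟩ := exists_sInf_extending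
    (Finset.range N ∪ (Finset.Ico β M).image θ.1)
    (fun x => if x < N then x else θ'.1 (θ.1.symm x)) (by
      have h : ∀ x ∈ Finset.range N ∪ (Finset.Ico β M).image θ.1, ¬ x < N →
          N ≤ θ'.1 (θ.1.symm x) := by
        intro x hx hN
        rcases Finset.mem_union.1 hx with hx | hx
        · exact absurd (Finset.mem_range.1 hx) hN
        · obtain ⟨i, hi, rfl⟩ := Finset.mem_image.1 hx
          rw [Equiv.symm_apply_apply]
          exact hθ'.le i (Finset.mem_Ico.1 hi).1 (Finset.mem_Ico.1 hi).2
      intro x hx y hy hxy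
      simp only at hxy
      split_ifs at hxy with h1 h2 h2
      · exact hxy
      · have := h y hy h2
        omega
      · have := h x hx h1
        omega
      · exact θ.1.symm.injective (θ'.1.injective hxy))
  have hτN : Fixes N τ := by
    intro i hi
    rw [hτ i (by simp [hi]), if_pos hi]
  -- With this choice of `ρ` the factorization is automatic, and fixing the points below `M` means
  -- that `τ * θ` and `θ'` agree there.
  refine ⟨τ, (τ * θ)⁻¹ * θ', hτN, fun i hi => ?_, (mul_inv_cancel_left _ _).symm⟩
  change (τ * θ).1.symm (θ'.1 i) = i
  rw [Equiv.symm_apply_eq]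
  change θ'.1 i = τ.1 (θ.1 i)
  rcases lt_or_ge i β with h | h
  · rw [hθ.fixes i h, hθ'.fixes i h, hτN i (h.trans_le hβ)]
  · have h1 := hθ.le i h hi
    rw [hτ (θ.1 i), if_neg (not_lt.2 h1), Equiv.symm_apply_apply]
    exact Finset.mem_union_right _ (Finset.mem_image_of_mem _ (Finset.mem_Ico.2 ⟨h, hi⟩))

/-! ### Double cosets -/

theorem CosetMor.mk_eq_iff {α β : ℕ} {g g' : G n} :
    CosetMor.mk n β α g = CosetMor.mk n β α g' ↔
      ∃ σ τ : SInf, Fixes α σ ∧ Fixes β τ ∧ g' = fun c => σ * g c * τ := by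
  refine (DoubleCoset.eq _ _ g g').trans ⟨?_, ?_⟩
  · rintro ⟨_, ⟨σ, hσ, rfl⟩, _, ⟨τ, hτ, rfl⟩, rfl⟩
    exact ⟨σ, τ, hσ, hτ, rfl⟩
  · rintro ⟨σ, τ, hσ, hτ, rfl⟩
    exact ⟨_, ⟨σ, hσ, rfl⟩, _, ⟨τ, hτ, rfl⟩, rfl⟩

theorem CosetMor.exists_mk {α β : ℕ} (f : CosetMor n β α) : ∃ g, CosetMor.mk n β α g = f := by
  obtain ⟨g, hg⟩ := Quotient.exists_rep f
  exact ⟨g, hg⟩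

/-- The corrections `τ` and `ρ` have supports disjoint from those of all `g c` and `h c`. They
commute past them to the two ends, where they are absorbed into the double coset. -/
theorem CosetMor.mk_eq_of_separates {α β γ N M : ℕ} {g h : G n} {θ θ' : SInf}
    (hg : ∀ c, SupportedBelow N (g c)) (hh : ∀ c, SupportedBelow M (h c)) (hα : α ≤ N)
    (hβ : β ≤ N) (hγ : γ ≤ M) (hθ : Separates β N M θ) (hθ' : Separates β N M θ') :
    CosetMor.mk n γ α (fun c => g c * θ * h c) = CosetMor.mk n γ α (fun c => g c * θ' * h c) := by
  obtain ⟨τ, ρ, hτ, hρ, rfl⟩ := hθ.exists_eq hθ' hβ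
  refine CosetMor.mk_eq_iff.2 ⟨τ, ρ, hτ.mono hα, hρ.mono hγ, funext fun c => ?_⟩
  calc g c * (τ * θ * ρ) * h c = (g c * τ) * θ * (ρ * h c) := by simp only [mul_assoc]
    _ = τ * (g c * θ * h c) * ρ := by
      rw [(hg c).commute hτ, ← (hh c).commute hρ]
      simp only [mul_assoc]

theorem CosetMor.eventually_eq {α β γ : ℕ} {g g' h h' : G n}
    (hg : CosetMor.mk n β α g = CosetMor.mk n β α g')
    (hh : CosetMor.mk n γ β h = CosetMor.mk n γ β h') :
    ∃ J, ∀ j j', J ≤ j → J ≤ j' → CosetMor.mk n γ α (fun c => g c * theta β j * h c) =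
      CosetMor.mk n γ α (fun c => g' c * theta β j' * h' c) := by
  obtain ⟨σ, τ, hσ, hτ, rfl⟩ := CosetMor.mk_eq_iff.1 hg
  obtain ⟨σ', τ', hσ', hτ', rfl⟩ := CosetMor.mk_eq_iff.1 hh
  obtain ⟨N1, hN1⟩ := exists_forall_supportedBelow g
  obtain ⟨N2, hN2⟩ := exists_forall_supportedBelow h
  obtain ⟨N3, hN3⟩ := exists_supportedBelow τ
  obtain ⟨N4, hN4⟩ := exists_supportedBelow σ'
  refine ⟨N1 + N2 + N3 + N4 + α + β + γ, fun j j' hj hj' => ?_⟩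
  set N := N1 + N2 + N3 + N4 + α + β + γ
  have hτN := hN3.mono (show N3 ≤ N by omega)
  have hσN := hN4.mono (show N4 ≤ N by omega)
  -- Changing representatives inserts `τ` and `σ'` around `theta`. They fix the labels and act below
  -- `N`, so separation survives.
  have hsep : Separates β N N (τ * theta β j' * σ') := by
    have h := separates_theta (β := β) hj' hj'
    refine ⟨(hτ.mul h.fixes).mul hσ', fun i hi hiN => ?_⟩
    have h1 := h.le (σ'.1 i) (hσ'.le hi) (hσN.lt hiN)
    change N ≤ τ.1 ((theta β j').1 (σ'.1 i))
    rwa [hτN _ h1]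
  rw [CosetMor.mk_eq_of_separates (fun c => (hN1 c).mono (show N1 ≤ N by omega))
    (fun c => (hN2 c).mono (show N2 ≤ N by omega)) (by omega) (by omega) (by omega)
    (separates_theta hj hj) hsep]
  refine CosetMor.mk_eq_iff.2 ⟨σ, τ', hσ, hτ', funext fun c => ?_⟩
  simp only [mul_assoc]

theorem CosetMor.exists_comp {α β γ : ℕ} (f : CosetMor n β α) (k : CosetMor n γ β) :
    ∃ p : CosetMor n γ α, ∀ g h, CosetMor.mk n β α g = f → CosetMor.mk n γ β h = k →
      ∀ᶠ j in Filter.atTop, CosetMor.mk n γ α (fun c => g c * theta β j * h c) = p := by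
  obtain ⟨g, rfl⟩ := f.exists_mk
  obtain ⟨h, rfl⟩ := k.exists_mk
  obtain ⟨J, hJ⟩ := CosetMor.eventually_eq (α := α) (γ := γ) (Eq.refl (CosetMor.mk n β α g))
    (Eq.refl (CosetMor.mk n γ β h))
  refine ⟨CosetMor.mk n γ α (fun c => g c * theta β J * h c), fun g' h' hg hh => ?_⟩
  obtain ⟨J', hJ'⟩ := CosetMor.eventually_eq (α := α) (γ := γ) hg hh
  filter_upwards [Filter.eventually_ge_atTop (max J J')] with j hj
  rw [hJ' j (max J J') (le_trans (le_max_right _ _) hj) (le_max_right _ _)]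
  exact hJ _ _ (le_max_left _ _) le_rfl

/-- The product of double cosets. -/
noncomputable def CosetMor.comp {α β γ : ℕ} (f : CosetMor n β α) (k : CosetMor n γ β) :
    CosetMor n γ α := (CosetMor.exists_comp f k).choose

theorem CosetMor.eventually_comp {α β γ : ℕ} (g h : G n) : ∀ᶠ j in Filter.atTop,
    CosetMor.mk n γ α (fun c => g c * theta β j * h c) =
      (CosetMor.mk n β α g).comp (CosetMor.mk n γ β h) :=
  (CosetMor.exists_comp _ _).choose_spec g h rfl rfl

theorem CosetMor.comp_eq {α β γ N M : ℕ} {g h : G n} {θ : SInf}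
    (hg : ∀ c, SupportedBelow N (g c)) (hh : ∀ c, SupportedBelow M (h c)) (hα : α ≤ N)
    (hβ : β ≤ N) (hγ : γ ≤ M) (hθ : Separates β N M θ) :
    (CosetMor.mk n β α g).comp (CosetMor.mk n γ β h) =
      CosetMor.mk n γ α (fun c => g c * θ * h c) := by
  obtain ⟨j, h1, h2⟩ := ((CosetMor.eventually_comp (α := α) (β := β) (γ := γ) g h).and
    (Filter.eventually_ge_atTop (max N M))).exists
  rw [← h1]
  exact CosetMor.mk_eq_of_separates hg hh hα hβ hγ
    (separates_theta ((le_max_left _ _).trans h2) ((le_max_right _ _).trans h2)) hθ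

/-- Choose `κ = theta N M` that fixes the first `N` points, so that it commutes with every `h c`.
Then `κ` can be moved across `h`, turning the separator `κ * θ'` on the right into the separator `θ
* κ` on the left without changing the product. -/
theorem CosetMor.comp_assoc {α β γ δ : ℕ} (p : CosetMor n β α) (q : CosetMor n γ β)
    (r : CosetMor n δ γ) : (p.comp q).comp r = p.comp (q.comp r) := by
  obtain ⟨g, rfl⟩ := p.exists_mk
  obtain ⟨h, rfl⟩ := q.exists_mk
  obtain ⟨f, rfl⟩ := r.exists_mk
  obtain ⟨N1, hN1⟩ := exists_forall_supportedBelow g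
  obtain ⟨N2, hN2⟩ := exists_forall_supportedBelow h
  obtain ⟨N3, hN3⟩ := exists_forall_supportedBelow f
  obtain ⟨N, hN⟩ : ∃ N, N = N1 + N2 + N3 + α + β + γ + δ := ⟨_, rfl⟩
  have hg : ∀ c, SupportedBelow N (g c) := fun c => (hN1 c).mono (by omega)
  have hh : ∀ c, SupportedBelow N (h c) := fun c => (hN2 c).mono (by omega)
  have hf : ∀ c, SupportedBelow N (f c) := fun c => (hN3 c).mono (by omega)
  -- `N'` bounds the support of `g * θ * h`, and `M` below bounds that of `h * θ' * f`.
  obtain ⟨N', hN'⟩ : ∃ N', N' = β + 2 * N := ⟨_, rfl⟩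
  obtain ⟨M, hM⟩ : ∃ M, M = γ + 2 * N' := ⟨_, rfl⟩
  have hθ : Separates β N N (theta β N) := separates_theta le_rfl le_rfl
  have hθs : SupportedBelow N' (theta β N) := hN' ▸ supportedBelow_theta β N
  have hθ' : Separates γ N' N (theta γ N') := separates_theta le_rfl (by omega)
  have hθs' : SupportedBelow M (theta γ N') := hM ▸ supportedBelow_theta γ N'
  have hκ : Separates N M M (theta N M) := separates_theta le_rfl le_rfl
  have hθκ : Separates β N M (theta β N * theta N M) := by
    refine ⟨hθ.fixes.mul (hκ.fixes.mono (by omega)), fun i hi hiM => ?_⟩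
    change N ≤ (theta β N).1 ((theta N M).1 i)
    rcases lt_or_ge i N with h1 | h1
    · rw [hκ.fixes i h1]
      exact hθ.le i hi h1
    · have h2 := hκ.le i h1 hiM
      rw [hθs _ (by omega)]
      omega
  have hκθ : Separates γ N' N (theta N M * theta γ N') := by
    refine ⟨(hκ.fixes.mono (by omega)).mul hθ'.fixes, fun i hi hiN => ?_⟩
    change N' ≤ (theta N M).1 ((theta γ N').1 i)
    have h1 := hθ'.le i hi hiN
    have h2 := hκ.le _ (show N ≤ (theta γ N').1 i by omega)
      (hθs'.lt (show i < M by omega))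
    omega
  have hgh : ∀ c, SupportedBelow N' (g c * theta β N * h c) := fun c =>
    (((hg c).mono (by omega)).mul hθs).mul ((hh c).mono (by omega))
  have hhf : ∀ c, SupportedBelow M (h c * theta γ N' * f c) := fun c =>
    (((hh c).mono (by omega)).mul hθs').mul ((hf c).mono (by omega))
  rw [CosetMor.comp_eq hg hh (by omega) (by omega) (by omega) hθ,
    CosetMor.comp_eq hgh hf (by omega) (by omega) (by omega) hκθ,
    CosetMor.comp_eq hh hf (by omega) (by omega) (by omega)
      (⟨hθ'.fixes, fun i hi hiN => le_trans (by omega) (hθ'.le i hi hiN)⟩ :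
        Separates γ N N (theta γ N')),
    CosetMor.comp_eq hg hhf (by omega) (by omega) (by omega) hθκ]
  congr 1
  funext c
  calc g c * theta β N * h c * (theta N M * theta γ N') * f c
      = g c * theta β N * (h c * theta N M) * theta γ N' * f c := by simp only [mul_assoc]
    _ = g c * (theta β N * theta N M) * (h c * theta γ N' * f c) := by
      rw [(hh c).commute hκ.fixes]
      simp only [mul_assoc]

theorem CosetMor.id_comp {α β : ℕ} (f : CosetMor n β α) :
    (CosetMor.mk n α α 1).comp f = f := by
  obtain ⟨g, rfl⟩ := f.exists_mk
  obtain ⟨N, hN⟩ := exists_forall_supportedBelow g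
  -- The identity is supported below any bound; taking `N = α` lets the trivial permutation
  -- separate.
  rw [CosetMor.comp_eq (N := α) (M := N + β) (θ := 1) (fun _ _ _ => rfl)
    (fun c => (hN c).mono (by omega)) le_rfl le_rfl (by omega)
    ⟨Fixes.one α, fun i hi _ => hi⟩]
  congr 1

theorem CosetMor.comp_id {α β : ℕ} (f : CosetMor n β α) :
    f.comp (CosetMor.mk n β β 1) = f := by
  obtain ⟨g, rfl⟩ := f.exists_mk
  obtain ⟨N, hN⟩ := exists_forall_supportedBelow g
  -- With `M = β` there are no points to be moved away, so the trivial permutation separates.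
  rw [CosetMor.comp_eq (N := N + α + β) (M := β) (θ := 1) (fun c => (hN c).mono (by omega))
    (fun _ _ _ => rfl) (by omega) (by omega) le_rfl
    ⟨Fixes.one β, fun i hi hi' => absurd hi (not_le.2 hi')⟩]
  congr 1

/-- The category of double cosets. -/
noncomputable def cosetCategory (n : ℕ) : NatCategory (CosetMor n) where
  id α := CosetMor.mk n α α 1
  comp := CosetMor.comp
  id_comp := CosetMor.id_comp
  comp_id := CosetMor.comp_id
  assoc := CosetMor.comp_assoc

theorem isCosetCategory_cosetCategory (n : ℕ) : IsCosetCategory n (cosetCategory n) :=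
  fun _ _ _ g h => CosetMor.eventually_comp g h

/-! ### Numberings of finite gems and the gem of a product -/

namespace Gem

variable {α β γ N M : ℕ}

/-- Beyond the supports all `g c` fix `i`, so the two chambers numbered `i` share all walls; the
bounds on `α` and `β` exclude labels. -/
theorem bare_ofPerm {g : G n} (hg : ∀ c, SupportedBelow N (g c)) (hα : α ≤ N) (hβ : β ≤ N)
    {i : ℕ} (hi : N ≤ i) (b : Bool) : (ofPerm g α β).Bare (i, b) := by
  refine ⟨(i, !b), fun c => ?_, fun a => ⟨fun h => ?_, fun h => ?_⟩,
    fun a => ⟨fun h => ?_, fun h => ?_⟩⟩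
  · cases b
    · exact Prod.ext (hg c i hi) rfl
    · refine Prod.ext ?_ rfl
      change (g c).1.symm i = i
      rw [Equiv.symm_apply_eq, hg c i hi]
  all_goals
    have h1 : i = a := congrArg Prod.fst h
    have := a.2
    omega

theorem finite_trim_ofPerm (g : G n) (α β : ℕ) : Finite (ofPerm g α β).trim.Chamber := by
  obtain ⟨N, hN⟩ := exists_forall_supportedBelow g
  have hg : ∀ c, SupportedBelow (N + α + β) (g c) := fun c => (hN c).mono (by omega)
  have hlt : ∀ x : (ofPerm g α β).trim.Chamber, x.1.1 < N + α + β := by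
    intro x
    by_contra h
    exact x.2 (bare_ofPerm hg (by omega) (by omega) (not_lt.1 h) x.1.2)
  refine Finite.of_injective
    (fun x => ((⟨x.1.1, hlt x⟩, x.1.2) : Fin (N + α + β) × Bool)) fun x y h => ?_
  have h1 := congrArg Prod.fst h
  have h2 := congrArg Prod.snd h
  exact Subtype.ext (Prod.ext (congrArg Fin.val h1) h2)

theorem trim_not_bare {A B : Type} (D : Gem n A B) (x : D.trim.Chamber) : ¬ D.trim.Bare x :=
  fun h => x.2 ((D.trimEmbedding.bare_iff x).2 h)

/-- Plus-chambers and minus-chambers are numbered by `0, …, N - 1` in agreement with the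
labels, and `g` describes their adjacency. -/
structure Numbering (D : Gem n (Fin α) (Fin β)) (g : G n) (N : ℕ) where
  toFun : D.Chamber → ℕ
  lt : ∀ x, toFun x < N
  injective : ∀ x y, toFun x = toFun y → D.sign x = D.sign y → x = y
  surjective : ∀ i < N, ∀ b, ∃ x, toFun x = i ∧ D.sign x = b
  plus : ∀ a, toFun (D.plus a) = a
  minus : ∀ b, toFun (D.minus b) = b
  adj : ∀ c x, D.sign x = false → toFun (D.adj c x) = (g c).1 (toFun x)
  supported : ∀ c, SupportedBelow N (g c)

section

variable {D : Gem n (Fin α) (Fin β)} {g : G n} (φ : Numbering D g N)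

include φ

theorem Numbering.le_plus : α ≤ N := by
  by_contra h
  have h1 := φ.lt (D.plus ⟨N, not_le.1 h⟩)
  rw [φ.plus] at h1
  exact lt_irrefl _ h1

theorem Numbering.le_minus : β ≤ N := by
  by_contra h
  have h1 := φ.lt (D.minus ⟨N, not_le.1 h⟩)
  rw [φ.minus] at h1
  exact lt_irrefl _ h1

theorem Numbering.adj_plus (c : Fin (n + 1)) (x : D.Chamber) (hx : D.sign x = true) :
    φ.toFun (D.adj c x) = (g c).1.symm (φ.toFun x) := by
  rw [Equiv.eq_symm_apply, ← φ.adj c _ (by rw [D.sign_adj, hx]; rfl), D.adj_adj]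

/-- A numbering is an embedding into the infinite gem. -/
def Numbering.embedding : Embedding D (ofPerm g α β) where
  toFun x := (φ.toFun x, D.sign x)
  injective x y h := φ.injective x y (congrArg Prod.fst h) (congrArg Prod.snd h)
  sign _ := rfl
  adj c x := by
    refine Prod.ext ?_ ((ofPerm g α β).sign_adj c _ |>.trans (D.sign_adj c x).symm)
    cases hx : D.sign x
    · exact (φ.adj c x hx).symm
    · exact (φ.adj_plus c x hx).symm
  plus a := Prod.ext (φ.plus a) (D.sign_plus a)
  minus a := Prod.ext (φ.minus a) (D.sign_minus a)

theorem Numbering.bare_of_notMem_range (y : ℕ × Bool) :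
    y ∈ Set.range φ.embedding.toFun ∨ (ofPerm g α β).Bare y := by
  rcases lt_or_ge y.1 N with h | h
  · obtain ⟨x, h1, h2⟩ := φ.surjective y.1 h y.2
    exact Or.inl ⟨x, Prod.ext h1 h2⟩
  · exact Or.inr (bare_ofPerm φ.supported φ.le_plus φ.le_minus h y.2)

end

/-- An injective map of `Fin α` to a finite set extends to a numbering of the set. -/
theorem exists_equiv_fin {P : Type} [Finite P] {N : ℕ} (hN : Nat.card P = N) (p : Fin α → P)
    (hp : Function.Injective p) : ∃ e : P ≃ Fin N, ∀ a, (e (p a) : ℕ) = a := by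
  subst hN
  have hα : α ≤ Nat.card P := by
    simpa using Nat.card_le_card_of_injective p hp
  let e := Finite.equivFin P
  let f : Fin α → Fin (Nat.card P) := fun a => e (p a)
  have hf : Function.Injective f := e.injective.comp hp
  let s := (Equiv.ofInjective f hf).symm.trans
    (Equiv.ofInjective (Fin.castLE hα) (Fin.castLE_injective hα))
  refine ⟨e.trans s.extendSubtype, fun a => ?_⟩
  have hmem : e (p a) ∈ Set.range f := ⟨a, rfl⟩
  change (s.extendSubtype (e (p a)) : ℕ) = a
  rw [s.extendSubtype_apply_of_mem _ hmem]
  have h : (Equiv.ofInjective f hf).symm ⟨e (p a), hmem⟩ = a := by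
    rw [Equiv.symm_apply_eq]
    rfl
  change ((Equiv.ofInjective (Fin.castLE hα) (Fin.castLE_injective hα)
    ((Equiv.ofInjective f hf).symm ⟨e (p a), hmem⟩) : Fin (Nat.card P)) : ℕ) = a
  rw [h]
  rfl

/-- Number plus-chambers and minus-chambers separately, labels first. Each `adj c` then becomes a
permutation of `Fin N`, extended to `ℕ` by the identity. -/
theorem exists_numbering (D : Gem n (Fin α) (Fin β)) [Finite D.Chamber] :
    ∃ (g : G n) (N : ℕ), Nonempty (Numbering D g N) := by
  let adj : Fin (n + 1) → ({x // D.sign x = false} ≃ {x // D.sign x = true}) := fun c =>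
    { toFun := fun x => ⟨D.adj c x.1, by rw [D.sign_adj, x.2]; rfl⟩
      invFun := fun x => ⟨D.adj c x.1, by rw [D.sign_adj, x.2]; rfl⟩
      left_inv := fun x => Subtype.ext (D.adj_adj c x.1)
      right_inv := fun x => Subtype.ext (D.adj_adj c x.1) }
  obtain ⟨N, hN⟩ : ∃ N, Nat.card {x // D.sign x = true} = N := ⟨_, rfl⟩
  obtain ⟨e, he⟩ := exists_equiv_fin hN (fun a => ⟨D.plus a, D.sign_plus a⟩)
    fun a a' h => D.plus_injective (congrArg Subtype.val h)
  -- The involution of a single color already shows that both signs occur equally often.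
  obtain ⟨f, hf⟩ := exists_equiv_fin ((Nat.card_congr (adj 0)).trans hN)
    (fun a => ⟨D.minus a, D.sign_minus a⟩)
    fun a a' h => D.minus_injective (congrArg Subtype.val h)
  let σ : Fin (n + 1) → Equiv.Perm (Fin N) := fun c => (f.symm.trans (adj c)).trans e
  let τ : Fin (n + 1) → Equiv.Perm ℕ := fun c => (σ c).extendDomain Fin.equivSubtype
  have hτ : ∀ c (i : Fin N), τ c i = σ c i := fun c i =>
    (σ c).extendDomain_apply_image Fin.equivSubtype i
  have hτ' : ∀ c i, N ≤ i → τ c i = i := fun c i hi =>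
    (σ c).extendDomain_apply_not_subtype Fin.equivSubtype (not_lt.2 hi)
  have hmem : ∀ c, τ c ∈ SInf := by
    intro c
    refine (Set.finite_lt_nat N).subset fun x hx => ?_
    by_contra h
    exact hx (hτ' c x (not_lt.1 h))
  let φ : D.Chamber → ℕ := fun x => if h : D.sign x = true then e ⟨x, h⟩ else
    f ⟨x, Bool.eq_false_iff.2 h⟩
  have hφ1 : ∀ x (h : D.sign x = true), φ x = e ⟨x, h⟩ := fun x h => dif_pos h
  have hφ2 : ∀ x (h : D.sign x = false), φ x = f ⟨x, h⟩ := fun x h =>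
    dif_neg (by rw [h]; exact Bool.false_ne_true)
  refine ⟨fun c => ⟨τ c, hmem c⟩, N, ⟨⟨φ, ?_, ?_, ?_, ?_, ?_, ?_, hτ'⟩⟩⟩
  · intro x
    cases h : D.sign x
    · rw [hφ2 x h]
      exact Fin.is_lt _
    · rw [hφ1 x h]
      exact Fin.is_lt _
  · intro x y hxy hs
    cases h : D.sign x
    · rw [hφ2 x h, hφ2 y (hs ▸ h)] at hxy
      exact congrArg Subtype.val (f.injective (Fin.ext hxy))
    · rw [hφ1 x h, hφ1 y (hs ▸ h)] at hxy
      exact congrArg Subtype.val (e.injective (Fin.ext hxy))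
  · rintro i hi (_ | _)
    · refine ⟨(f.symm ⟨i, hi⟩).1, ?_, (f.symm ⟨i, hi⟩).2⟩
      rw [hφ2 _ (f.symm ⟨i, hi⟩).2, Subtype.coe_eta, Equiv.apply_symm_apply]
    · refine ⟨(e.symm ⟨i, hi⟩).1, ?_, (e.symm ⟨i, hi⟩).2⟩
      rw [hφ1 _ (e.symm ⟨i, hi⟩).2, Subtype.coe_eta, Equiv.apply_symm_apply]
  · intro a
    rw [hφ1 _ (D.sign_plus a), he]
  · intro a
    rw [hφ2 _ (D.sign_minus a), hf]
  · intro c x hx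
    rw [hφ2 x hx, hφ1 _ (show D.sign (D.adj c x) = true by rw [D.sign_adj, hx]; rfl)]
    change _ = τ c _
    rw [hτ]
    change _ = ((e (adj c (f.symm (f ⟨x, hx⟩)))) : ℕ)
    rw [Equiv.symm_apply_apply]
    rfl

/-- Maps compatible with the adjacency of minus-chambers are compatible with the adjacency. -/
def Embedding.ofMinus {A B : Type} {D E : Gem n A B} (f : D.Chamber → E.Chamber)
    (hf : Function.Injective f) (hsign : ∀ x, E.sign (f x) = D.sign x)
    (hadj : ∀ c x, D.sign x = false → E.adj c (f x) = f (D.adj c x))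
    (hplus : ∀ a, f (D.plus a) = E.plus a) (hminus : ∀ b, f (D.minus b) = E.minus b) :
    Embedding D E where
  toFun := f
  injective := hf
  sign := hsign
  adj c x := by
    cases hx : D.sign x
    · exact hadj c x hx
    · have h := hadj c (D.adj c x) (by rw [D.sign_adj, hx]; rfl)
      rw [D.adj_adj] at h
      rw [← h, E.adj_adj]
  plus := hplus
  minus := hminus

/-- The gem of the gluing embeds into the gem of the product. -/
theorem exists_embedding_comp {D : Gem n (Fin α) (Fin β)} {E : Gem n (Fin β) (Fin γ)} {g h : G n}
    (φ : Numbering D g N) (ψ : Numbering E h M) {θ : SInf} (hθ : Separates β N M θ) :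
    ∃ χ : Embedding (D.comp E) (ofPerm (fun c => g c * θ * h c) α γ),
      ∀ y, y ∈ Set.range χ.toFun ∨ (ofPerm (fun c => g c * θ * h c) α γ).Bare y := by
  have hβN := φ.le_minus
  have hβM := ψ.le_plus
  have hD : ∀ x : {x : D.Chamber // ∀ s, x ≠ D.minus s}, D.sign x.1 = false →
      β ≤ φ.toFun x.1 := by
    intro x hx
    by_contra h
    refine x.2 ⟨φ.toFun x.1, not_le.1 h⟩ (φ.injective _ _ (φ.minus ⟨_, not_le.1 h⟩).symm ?_)
    rw [hx, D.sign_minus]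
  have hE : ∀ y : {y : E.Chamber // ∀ s, y ≠ E.plus s}, E.sign y.1 = true →
      β ≤ ψ.toFun y.1 := by
    intro x hx
    by_contra h
    refine x.2 ⟨ψ.toFun x.1, not_le.1 h⟩ (ψ.injective _ _ (ψ.plus ⟨_, not_le.1 h⟩).symm ?_)
    rw [hx, E.sign_plus]
  have hθ' : ∀ i, β ≤ i → i < N → M ≤ θ.1.symm i := by
    intro i hi hiN
    by_contra hM
    rcases lt_or_ge (θ.1.symm i) β with h1 | h1
    · have := hθ.fixes _ h1
      rw [Equiv.apply_symm_apply] at this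
      omega
    · have := hθ.le _ h1 (not_le.1 hM)
      rw [Equiv.apply_symm_apply] at this
      omega
  -- Plus-chambers of `D` and minus-chambers of `E` keep their numbers. The other two kinds are
  -- renumbered by `θ`, which moves them outside the ranges of the first two.
  let f : CompChamber D E → ℕ × Bool := Sum.elim
    (fun x => (bif D.sign x.1 then φ.toFun x.1 else θ.1.symm (φ.toFun x.1), D.sign x.1))
    (fun y => (bif E.sign y.1 then θ.1 (ψ.toFun y.1) else ψ.toFun y.1, E.sign y.1))
  have hf : Function.Injective f := by
    have hne : ∀ x y, f (Sum.inl x) ≠ f (Sum.inr y) := by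
      intro x y hxy
      have h1 : (bif D.sign x.1 then φ.toFun x.1 else θ.1.symm (φ.toFun x.1)) =
        bif E.sign y.1 then θ.1 (ψ.toFun y.1) else ψ.toFun y.1 := congrArg Prod.fst hxy
      have h2 : D.sign x.1 = E.sign y.1 := congrArg Prod.snd hxy
      have h3 := φ.lt x.1
      have h4 := ψ.lt y.1
      cases hx : D.sign x.1
      · rw [← h2, hx] at h1
        have := hθ' _ (hD x hx) h3
        simp only [cond_false] at h1
        omega
      · rw [← h2, hx] at h1
        have := hθ.le _ (hE y (h2 ▸ hx)) h4
        simp only [cond_true] at h1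
        omega
    rintro (x | x) (y | y) hxy
    · have h1 : (bif D.sign x.1 then φ.toFun x.1 else θ.1.symm (φ.toFun x.1)) =
        bif D.sign y.1 then φ.toFun y.1 else θ.1.symm (φ.toFun y.1) := congrArg Prod.fst hxy
      have h2 : D.sign x.1 = D.sign y.1 := congrArg Prod.snd hxy
      refine congrArg Sum.inl (Subtype.ext (φ.injective _ _ ?_ h2))
      rw [← h2] at h1
      cases hx : D.sign x.1
      · rw [hx] at h1
        exact θ.1.symm.injective h1
      · rw [hx] at h1
        exact h1
    · exact absurd hxy (hne x y)
    · exact absurd hxy.symm (hne y x)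
    · have h1 : (bif E.sign x.1 then θ.1 (ψ.toFun x.1) else ψ.toFun x.1) =
        bif E.sign y.1 then θ.1 (ψ.toFun y.1) else ψ.toFun y.1 := congrArg Prod.fst hxy
      have h2 : E.sign x.1 = E.sign y.1 := congrArg Prod.snd hxy
      refine congrArg Sum.inr (Subtype.ext (ψ.injective _ _ ?_ h2))
      rw [← h2] at h1
      cases hx : E.sign x.1
      · rw [hx] at h1
        exact h1
      · rw [hx] at h1
        exact θ.1.injective h1
  have hsign : ∀ x, (f x).2 = (D.comp E).sign x := by
    rintro (x | x) <;> rfl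
  have hadj : ∀ c x, (D.comp E).sign x = false →
      (ofPerm (fun c => g c * θ * h c) α γ).adj c (f x) = f (compAdj D E c x) := by
    intro c x hx
    have hleft : (ofPerm (fun c => g c * θ * h c) α γ).adj c (f x) =
        ((g c).1 (θ.1 ((h c).1 (f x).1)), true) := by
      have h1 : (f x).2 = false := (hsign x).trans hx
      rw [← Prod.mk.eta (p := f x), h1]
      rfl
    rw [hleft]
    rcases x with x | y
    · change D.sign x.1 = false at hx
      have hx' : D.sign (D.adj c x.1) = true := by rw [D.sign_adj, hx]; rfl
      have h1 : (f (Sum.inl x)).1 = θ.1.symm (φ.toFun x.1) := by simp [f, hx]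
      have hne : ∀ s, D.adj c x.1 ≠ D.minus s := fun s hs => by
        rw [hs, D.sign_minus] at hx'
        cases hx'
      -- The number of a minus-chamber of `D` is beyond the support of `h`, so `h c` acts trivially,
      -- `θ` undoes the renumbering, and only `g c` acts.
      rw [compAdj_inl_of_ne D E hne, h1, ψ.supported c _ (hθ' _ (hD x hx) (φ.lt _)),
        Equiv.apply_symm_apply,
        ← φ.adj c _ hx]
      simp [f, hx']
      rfl
    · change E.sign y.1 = false at hx
      have hx' : E.sign (E.adj c y.1) = true := by rw [E.sign_adj, hx]; rfl
      have h1 : (f (Sum.inr y)).1 = ψ.toFun y.1 := by simp [f, hx]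
      rw [h1, ← ψ.adj c _ hx]
      by_cases hs : ∃ s, E.adj c y.1 = E.plus s
      · obtain ⟨s, hs⟩ := hs
        -- At a removed plus-chamber with label `s`, `θ` fixes `s` and `g c` leads to the neighbor
        -- of the removed minus-chamber with that label.
        rw [compAdj_inr_of_eq D E hs, hs, ψ.plus, hθ.fixes _ s.2, ← φ.minus,
          ← φ.adj c _ (D.sign_minus s)]
        have h2 : D.sign (D.adj c (D.minus s)) = true := by rw [D.sign_adj, D.sign_minus]; rfl
        simp [f, h2]
        rfl
      · rw [compAdj_inr_of_ne D E (not_exists.1 hs),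
          φ.supported c _ (hθ.le _ (hE ⟨_, not_exists.1 hs⟩ hx') (ψ.lt _))]
        simp [f, hx']
        rfl
  let χ : Embedding (D.comp E) (ofPerm (fun c => g c * θ * h c) α γ) :=
    Embedding.ofMinus f hf hsign hadj
      (fun a => Prod.ext (by simp [f, comp, D.sign_plus, φ.plus, ofPerm]) (D.sign_plus a))
      (fun a => Prod.ext (by simp [f, comp, E.sign_minus, ψ.minus, ofPerm]) (E.sign_minus a))
  refine ⟨χ, ?_⟩
  have hminus : ∀ q, (q, false) ∈ Set.range χ.toFun ∨
      (ofPerm (fun c => g c * θ * h c) α γ).Bare (q, false) := by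
    intro q
    rcases lt_or_ge q M with hq | hq
    · left
      obtain ⟨y, hy, hs⟩ := ψ.surjective q hq false
      refine ⟨Sum.inr ⟨y, fun s h => ?_⟩, Prod.ext ?_ hs⟩
      · rw [h, E.sign_plus] at hs
        cases hs
      · change (f (Sum.inr _)).1 = q
        simp [f, hs, hy]
    · have hqβ : β ≤ θ.1 q := hθ.fixes.le (hβM.trans hq)
      rcases lt_or_ge (θ.1 q) N with hq' | hq'
      · left
        obtain ⟨x, hx, hs⟩ := φ.surjective _ hq' false
        refine ⟨Sum.inl ⟨x, fun s h => ?_⟩, Prod.ext ?_ hs⟩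
        · rw [h, φ.minus] at hx
          have := s.2
          omega
        · change (f (Sum.inl _)).1 = q
          simp [f, hs, hx]
      -- Here `q` lies outside the support of `h` and `θ q` outside that of `g`, so all colors match
      -- `q` with `θ q`.
      · right
        have h1 := φ.le_plus
        have h2 := ψ.le_minus
        refine ⟨(θ.1 q, true), fun c => Prod.ext ?_ rfl, fun a => ⟨fun h => ?_, fun h => ?_⟩,
          fun a => ⟨fun h => ?_, fun h => ?_⟩⟩
        · change (g c).1 (θ.1 ((h c).1 q)) = θ.1 q
          rw [ψ.supported c q hq, φ.supported c _ hq']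
        · cases congrArg Prod.snd h
        · have h3 : θ.1 q = a := congrArg Prod.fst h
          have := a.2
          omega
        · have h3 : q = a := congrArg Prod.fst h
          have := a.2
          omega
        · cases congrArg Prod.snd h
  rintro ⟨p, _ | _⟩
  · exact hminus p
  · rcases hminus ((ofPerm (fun c => g c * θ * h c) α γ).adj 0 (p, true)).1 with h1 | h1
    · left
      obtain ⟨x, hx⟩ := h1
      refine ⟨(D.comp E).adj 0 x, ?_⟩
      rw [← χ.adj, hx]
      exact (ofPerm (fun c => g c * θ * h c) α γ).adj_adj 0 (p, true)
    · exact Or.inr ((bare_adj_iff 0).1 h1)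

end Gem

/-! ### Double cosets versus pseudobordisms -/

section Bordism

variable [NeZero n] {α β γ : ℕ}

/-- The pseudobordism of an element of the group. -/
def bordism (g : G n) (α β : ℕ) : Pseudobordism n β α :=
  ⟨((attached g).forget α β).trim, by
    have := Gem.finite_trim_ofPerm g α β
    exact ((Presentation.attached g α β).trim (Presentation.attached_faithful g α β)
      ).isPseudobordism (Presentation.trim_faithful _ _) (Gem.trim_not_bare _)⟩

/-- Replacing `g` by `σ * g * τ` renumbers plus-chambers by `σ` and minus-chambers by the inverse of
`τ`; labels are not affected. -/
theorem bordism_iso_of_mk_eq {g h : G n} (hgh : CosetMor.mk n β α g = CosetMor.mk n β α h) :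
    Nonempty (Decorated.Iso (bordism g α β).1 (bordism h α β).1) := by
  obtain ⟨σ, τ, hσ, hτ, rfl⟩ := CosetMor.mk_eq_iff.1 hgh
  let f : ℕ × Bool → ℕ × Bool := fun x => (bif x.2 then σ.1 x.1 else τ.1.symm x.1, x.2)
  have hf : Function.Bijective f := by
    constructor
    · rintro ⟨x, b⟩ ⟨y, b'⟩ h
      obtain rfl : b = b' := congrArg Prod.snd h
      have h1 := congrArg Prod.fst h
      cases b
      · exact Prod.ext (τ.1.symm.injective h1) rfl
      · exact Prod.ext (σ.1.injective h1) rfl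
    · rintro ⟨y, _ | _⟩
      · exact ⟨(τ.1 y, false), Prod.ext (Equiv.symm_apply_apply _ _) rfl⟩
      · exact ⟨(σ.1.symm y, true), Prod.ext (Equiv.apply_symm_apply _ _) rfl⟩
  let φ : Gem.Embedding (Gem.ofPerm g α β) (Gem.ofPerm (fun c => σ * g c * τ) α β) :=
    Gem.Embedding.ofMinus f hf.1 (fun _ => rfl) (by
        rintro c ⟨x, b⟩ hb
        obtain rfl : b = false := hb
        refine Prod.ext ?_ rfl
        change σ.1 ((g c).1 (τ.1 (τ.1.symm x))) = σ.1 ((g c).1 x)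
        rw [Equiv.apply_symm_apply])
      (fun a => Prod.ext (hσ a a.2) rfl) (fun b => Prod.ext (hτ.inv b b.2) rfl)
  exact Presentation.nonempty_trim_iso _ (Presentation.attached_faithful g α β) _
    (Presentation.attached_faithful _ α β) φ fun y => Or.inl (hf.2 y)

/-- An isomorphism matches only the non-bare chambers. Its action on plus-chambers extends to some
`σ`, and the permutation `ρ` of minus-chambers is then forced by the color `0`. The point is that
the other colors agree on bare chambers too. -/
theorem mk_eq_of_bordism_iso {g h : G n}
    (e : Decorated.Iso (bordism g α β).1 (bordism h α β).1) :
    CosetMor.mk n β α g = CosetMor.mk n β α h := by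
  obtain ⟨φ, hφ⟩ := (((Presentation.attached g α β).trim
    (Presentation.attached_faithful g α β)).ofIso e).exists_embedding
      ((Presentation.attached h α β).trim (Presentation.attached_faithful h α β))
  have hsnd : ∀ x, (φ.toFun x).1.2 = x.1.2 := φ.sign
  obtain ⟨N, hN⟩ := exists_forall_supportedBelow g
  have hlt : ∀ x : (Gem.ofPerm g α β).trim.Chamber, x.1.1 < N + α + β := by
    intro x
    by_contra h
    exact x.2 (Gem.bare_ofPerm (fun c => (hN c).mono (by omega)) (by omega) (by omega)
      (not_lt.1 h) x.1.2)
  classical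
  let f : ℕ → ℕ := fun p =>
    -- The value `0` is a dummy: `f` is used only at non-bare plus-chambers.
    if hp : (Gem.ofPerm g α β).Bare (p, true) then 0 else (φ.toFun ⟨(p, true), hp⟩).1.1
  have hf : ∀ p hp, f p = (φ.toFun ⟨(p, true), hp⟩).1.1 := fun p hp => dif_neg hp
  obtain ⟨σ, hσ⟩ := exists_sInf_extending
    ((Finset.range (N + α + β)).filter fun p => ¬ (Gem.ofPerm g α β).Bare (p, true)) f (by
      intro p hp q hq hpq
      have hp' := (Finset.mem_filter.1 hp).2
      have hq' := (Finset.mem_filter.1 hq).2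
      rw [hf p hp', hf q hq'] at hpq
      have h1 := φ.injective (Subtype.ext (Prod.ext hpq ((hsnd ⟨(p, true), hp'⟩).trans
        (hsnd ⟨(q, true), hq'⟩).symm)))
      exact congrArg (fun x => x.1.1) h1)
  have hplus : ∀ p hp, (φ.toFun ⟨(p, true), hp⟩).1 = (σ.1 p, true) := by
    intro p hp
    refine Prod.ext ?_ (hsnd _)
    change _ = σ.1 p
    rw [hσ p (Finset.mem_filter.2 ⟨Finset.mem_range.2 (hlt ⟨(p, true), hp⟩), hp⟩), hf p hp]
  obtain ⟨ρ, hρ⟩ : ∃ ρ : SInf, ρ = (h 0)⁻¹ * σ * g 0 := ⟨_, rfl⟩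
  have hρ0 : ∀ q, ρ.1 q = (h 0).1.symm (σ.1 ((g 0).1 q)) := fun q => by rw [hρ]; rfl
  have hminus : ∀ q (hq : ¬ (Gem.ofPerm g α β).Bare (q, false)) c,
      (h c).1 (φ.toFun ⟨(q, false), hq⟩).1.1 = σ.1 ((g c).1 q) := by
    intro q hq c
    have h1 := congrArg Subtype.val (φ.adj c ⟨(q, false), hq⟩)
    have h2 := hplus ((g c).1 q) (fun hb => hq ((Gem.bare_adj_iff c).1 hb))
    have h3 : (Gem.ofPerm h α β).adj c (φ.toFun ⟨(q, false), hq⟩).1 =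
      (σ.1 ((g c).1 q), true) := h1.trans h2
    have h4 : (φ.toFun ⟨(q, false), hq⟩).1 = ((φ.toFun ⟨(q, false), hq⟩).1.1, false) :=
      Prod.ext rfl (hsnd _)
    rw [h4] at h3
    exact congrArg Prod.fst h3
  have hρm : ∀ q (hq : ¬ (Gem.ofPerm g α β).Bare (q, false)),
      ρ.1 q = (φ.toFun ⟨(q, false), hq⟩).1.1 := by
    intro q hq
    rw [hρ0, Equiv.symm_apply_eq, hminus]
  have hmain : ∀ c q, (h c).1 (ρ.1 q) = σ.1 ((g c).1 q) := by
    intro c q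
    by_cases hq : (Gem.ofPerm g α β).Bare (q, false)
    · have hc : (g c).1 q = (g 0).1 q := by
        obtain ⟨y, hy, -⟩ := id hq
        exact congrArg Prod.fst ((hy c).trans (hy 0).symm)
      have hp : (Gem.ofPerm g α β).Bare ((g 0).1 q, true) := hq.adj 0
      -- Non-bare plus-chambers of `h` are all images of non-bare ones of `g`, so the injective `σ`
      -- sends bare to bare. Then all colors of `h` agree at this chamber.
      have hb : (Gem.ofPerm h α β).Bare (σ.1 ((g 0).1 q), true) := by
        by_contra hb
        obtain ⟨⟨⟨p, s⟩, hps⟩, hx⟩ := hφ ⟨(σ.1 ((g 0).1 q), true), hb⟩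
        have hs := hsnd ⟨(p, s), hps⟩
        rw [hx] at hs
        obtain rfl : s = true := hs.symm
        have h1 := hplus p hps
        rw [hx] at h1
        have h2 := σ.1.injective (congrArg Prod.fst h1)
        exact hps (h2 ▸ hp)
      obtain ⟨y, hy, -⟩ := hb
      have h1 : (h 0).1.symm (σ.1 ((g 0).1 q)) = (h c).1.symm (σ.1 ((g 0).1 q)) :=
        congrArg Prod.fst ((hy 0).trans (hy c).symm)
      rw [hρ0, h1, Equiv.apply_symm_apply, hc]
    · rw [hρm q hq, hminus]
  have hσα : Fixes α σ := by
    intro i hi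
    have h1 := hplus i ((Gem.ofPerm g α β).not_bare_plus ⟨i, hi⟩)
    have h2 := congrArg Subtype.val (φ.plus ⟨i, hi⟩)
    exact (congrArg Prod.fst (h1.symm.trans h2) :)
  have hρβ : Fixes β ρ := by
    intro i hi
    rw [hρm i ((Gem.ofPerm g α β).not_bare_minus ⟨i, hi⟩)]
    have h2 := congrArg Subtype.val (φ.minus ⟨i, hi⟩)
    exact congrArg Prod.fst h2
  refine CosetMor.mk_eq_iff.2 ⟨σ, ρ⁻¹, hσα, hρβ.inv, funext fun c => ?_⟩
  rw [eq_mul_inv_iff_mul_eq]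
  exact Subtype.ext (Equiv.ext (hmain c))

theorem Decorated.IsPseudobordism.exists_faithful {A B : Type} {X : Decorated n A B}
    (hX : X.IsPseudobordism) : ∃ (D : Gem n A B) (P : Presentation X D),
      P.Faithful ∧ Finite D.Chamber := by
  obtain ⟨D, ⟨P⟩⟩ := Presentation.exists_presentation hX.pseudomanifold hX.colored hX.labeled
  exact ⟨D, P, P.faithful_of_isNormal hX.normal, P.finite_chamber hX⟩

/-- A numbering embeds the gem of `X` into that of `g` with bare complement. Trimming identifies the
two, and `X` itself loses nothing by trimming. -/
theorem exists_bordism_iso (X : Pseudobordism n β α) :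
    ∃ g, Nonempty (Decorated.Iso (bordism g α β).1 X.1) := by
  obtain ⟨D, P, hP, hfin⟩ := X.2.exists_faithful
  obtain ⟨g, N, ⟨φ⟩⟩ := D.exists_numbering
  refine ⟨g, ?_⟩
  obtain ⟨e⟩ := P.nonempty_trim_iso hP (Presentation.attached g α β)
    (Presentation.attached_faithful g α β) φ.embedding φ.bare_of_notMem_range
  exact ⟨e.symm.trans ((P.trim hP).iso (P.trim_faithful hP) P hP D.trimEmbedding
    fun x => ⟨⟨x, P.not_bare hP X.2 x⟩, rfl⟩)⟩

/-- The class of the pseudobordism of a double coset. -/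
def CosetMor.toBordismMor (f : CosetMor n β α) : BordismMor n β α :=
  Quotient.liftOn' f (fun g => BordismMor.mk (bordism g α β)) fun _ _ h =>
    Quotient.sound (bordism_iso_of_mk_eq (Quotient.sound' h))

theorem CosetMor.toBordismMor_bijective :
    Function.Bijective (CosetMor.toBordismMor : CosetMor n β α → BordismMor n β α) := by
  constructor
  · intro f f' h
    obtain ⟨g, rfl⟩ := f.exists_mk
    obtain ⟨g', rfl⟩ := f'.exists_mk
    obtain ⟨e⟩ := Quotient.exact h
    exact mk_eq_of_bordism_iso e
  · intro X
    obtain ⟨X, rfl⟩ := Quotient.exists_rep X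
    obtain ⟨g, hg⟩ := exists_bordism_iso X
    exact ⟨CosetMor.mk n β α g, Quotient.sound hg⟩

/-- Double cosets are the same as classes of pseudobordisms. -/
noncomputable def CosetMor.equivBordismMor : CosetMor n β α ≃ BordismMor n β α :=
  Equiv.ofBijective _ CosetMor.toBordismMor_bijective

variable (n) in
/-- The category of pseudobordisms. -/
noncomputable def bordismCategory : NatCategory (BordismMor n) where
  id α := CosetMor.equivBordismMor ((cosetCategory n).id α)
  comp f g := CosetMor.equivBordismMor
    ((cosetCategory n).comp (CosetMor.equivBordismMor.symm f) (CosetMor.equivBordismMor.symm g))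
  id_comp f := by simp [(cosetCategory n).id_comp]
  comp_id f := by simp [(cosetCategory n).comp_id]
  assoc f g h := by simp [(cosetCategory n).assoc]

variable (n) in
/-- The functor from double cosets to pseudobordisms. -/
noncomputable def cosetFunctor : NatFunctor (cosetCategory n) (bordismCategory n) where
  map f := CosetMor.equivBordismMor f
  map_id _ := rfl
  map_comp f g := by simp [bordismCategory]

/-- Composition was transported from double cosets, so the content is that `diamond` represents it.
Both products come from numberings of the two gems and one separating permutation. -/
theorem isBordismCategory_bordismCategory : IsBordismCategory n (bordismCategory n) := by
  intro γ β α X Y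
  obtain ⟨D, P, hP, hD⟩ := X.2.exists_faithful
  obtain ⟨E, Q, hQ, hE⟩ := Y.2.exists_faithful
  obtain ⟨g, N, ⟨φ⟩⟩ := D.exists_numbering
  obtain ⟨h, M, ⟨ψ⟩⟩ := E.exists_numbering
  -- Any numbering of a faithful presentation computes the inverse of the bijection.
  have key : ∀ {α β N : ℕ} (X : Pseudobordism n β α) {D : Gem n (Fin α) (Fin β)}
      (P : Presentation X.1 D) (_ : P.Faithful) {g : G n} (_ : D.Numbering g N),
      CosetMor.equivBordismMor.symm (BordismMor.mk X) = CosetMor.mk n β α g := by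
    intro α β N X D P hP g φ
    rw [Equiv.symm_apply_eq]
    obtain ⟨e⟩ := P.nonempty_trim_iso hP (Presentation.attached g α β)
      (Presentation.attached_faithful g α β) φ.embedding φ.bare_of_notMem_range
    refine Quotient.sound ⟨Decorated.Iso.trans ?_ e⟩
    exact ((P.trim hP).iso (P.trim_faithful hP) P hP D.trimEmbedding
      fun x => ⟨⟨x, P.not_bare hP X.2 x⟩, rfl⟩).symm
  have hθ : Separates β N M (theta β (max N M)) :=
    separates_theta (le_max_left _ _) (le_max_right _ _)
  obtain ⟨χ, hχ⟩ := Gem.exists_embedding_comp φ ψ hθ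
  obtain ⟨e⟩ := (P.glue Q).normalize.nonempty_trim_iso (P.glue Q).normalize_faithful
    (Presentation.attached _ α γ) (Presentation.attached_faithful _ α γ) χ hχ
  refine ⟨bordism (fun c => g c * theta β (max N M) * h c) α γ, ⟨e.symm⟩, ?_⟩
  change CosetMor.equivBordismMor ((CosetMor.equivBordismMor.symm (BordismMor.mk X)).comp
    (CosetMor.equivBordismMor.symm (BordismMor.mk Y))) = _
  rw [key X P hP φ, key Y Q hQ ψ, CosetMor.comp_eq φ.supported ψ.supported φ.le_plus φ.le_minus
    ψ.le_minus hθ]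
  rfl

variable (n) in
theorem isEquivalence_cosetFunctor : (cosetFunctor n).toFunctor.IsEquivalence where
  faithful := ⟨fun h => CosetMor.equivBordismMor.injective h⟩
  full := ⟨fun f => CosetMor.equivBordismMor.surjective f⟩
  essSurj := ⟨fun α => ⟨α, ⟨Iso.refl _⟩⟩⟩

end Bordism

end PsBor

theorem mainTheorem1 (n : ℕ) (hn : 1 ≤ n) :
    ∃ (𝒦 : PsBor.NatCategory (PsBor.CosetMor n)) (𝒟 : PsBor.NatCategory (PsBor.BordismMor n)),
      PsBor.IsCosetCategory n 𝒦 ∧ PsBor.IsBordismCategory n 𝒟 ∧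
      ∃ Φ : PsBor.NatFunctor 𝒦 𝒟, Φ.toFunctor.IsEquivalence ∧
        ∀ (β α : ℕ) (g : PsBor.G n), ∃ X : PsBor.Pseudobordism n β α,
          Nonempty (PsBor.Decorated.Iso X.1 (((PsBor.attached g).forget α β).trim)) ∧
            Φ.map (PsBor.CosetMor.mk n β α g) = PsBor.BordismMor.mk X := by
  -- For `n ≥ 1` the complement of one color is non-empty, so walls are genuine faces.
  have : NeZero n := ⟨by omega⟩
  exact ⟨PsBor.cosetCategory n, PsBor.bordismCategory n, PsBor.isCosetCategory_cosetCategory n,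
    PsBor.isBordismCategory_bordismCategory, PsBor.cosetFunctor n,
    PsBor.isEquivalence_cosetFunctor n,
    fun β α g => ⟨PsBor.bordism g α β, ⟨PsBor.Decorated.Iso.refl _⟩, rfl⟩⟩
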